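/- **Theorem (bipartite permutation graphs, linear time).** A finite simple graph $G$ is a *permutation graph* if it is the intersection graph of straight line segments, each joining a point on one of two fixed horizontal lines to a point on the other, where distinct vertices have distinct points on each line. An *induced matching* of $G$ is a set of edges, no two of which share a vertex or are joined by an edge of $G$. The *strong chromatic index* $s\chi'(G)$ is the least number of colors in a *strong edge coloring* of $G$, that is, a coloring of the edges in which every color class is an induced matching. There is a linear-time algorithm that computes the strong chromatic index of bipartite permutation graphs: there are a random access machine program $P$ and a constant $c$ such that for every bipartite permutation graph $G$ with vertex set $\{0,\dots,n-1\}$ and $m$ edges, given by adjacency lists (in any order, without a permutation diagram or a bipartition), $P$ halts after at most $c\,(n+m+1)$ steps with output $s\chi'(G)$. Every elementary operation (constant, read or write of a variable or array cell, addition, truncated subtraction, comparison, Boolean connective, program control) costs one step, and no number computed during the run exceeds $c\,(n+m+1)$, so that words of $O(\log (n+m+2))$ bits suffice. -/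

import Mathlib

/-! ## Permutation graphs -/

/-- The line segment of a permutation diagram that joins the point at abscissa `s` on the
horizontal line `y = 1` to the point at abscissa `t` on the horizontal line `y = 0`. -/
def diagramSegment (s t : ℝ) : Set (ℝ × ℝ) := segment ℝ (s, 1) (t, 0)

/-- `G` is a permutation graph: each vertex `v` can be given one point `top v` on the upper line
and one point `bot v` on the lower line, distinct vertices receiving distinct points on each line,
such that `G` is the intersection graph of the line segments joining `top v` to `bot v`. -/
def IsPermutationGraph {V : Type*} (G : SimpleGraph V) : Prop :=
  ∃ top bot : V → ℝ, Function.Injective top ∧ Function.Injective bot ∧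
    ∀ u v : V, G.Adj u v ↔
      u ≠ v ∧ (diagramSegment (top u) (bot u) ∩ diagramSegment (top v) (bot v)).Nonempty

/-! ## The strong chromatic index -/

/-- `M` is an induced matching of `G`: a set of edges, no two of which meet a common vertex or are
joined by an edge of `G`. -/
def IsInducedMatching {V : Type*} (G : SimpleGraph V) (M : Set (Sym2 V)) : Prop :=
  M ⊆ G.edgeSet ∧
    ∀ e ∈ M, ∀ f ∈ M, e ≠ f → ∀ x ∈ e, ∀ y ∈ f, x ≠ y ∧ ¬ G.Adj x y

/-- A strong edge coloring of `G`: every color class is an induced matching. -/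
def IsStrongEdgeColoring {V α : Type*} (G : SimpleGraph V) (col : G.edgeSet → α) : Prop :=
  ∀ a : α, IsInducedMatching G (Subtype.val '' {e : G.edgeSet | col e = a})

/-- The strong chromatic index of `G`: the least number of colors in a strong edge coloring.
(If `G` has finitely many edges, giving them distinct colors shows that the set is nonempty.) -/
noncomputable def strongChromaticIndex {V : Type*} (G : SimpleGraph V) : ℕ :=
  sInf {k : ℕ | ∃ col : G.edgeSet → Fin k, IsStrongEdgeColoring G col}

/-! ## Random access machine

Programs are while programs over natural-number variables and random access arrays. A program names
its variables and arrays by constants, so it uses only finitely many of each. Every elementary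
operation costs one step. The machine has words of capacity `W`: an execution exists only if no
value that is ever computed exceeds `W`. -/

namespace Ram

/-- A memory state: the values of the variables and the contents of the arrays. -/
@[ext] structure State where
  var : ℕ → ℕ
  arr : ℕ → ℕ → ℕ

/-- Write `v` into the variable `x`. -/
def State.setVar (σ : State) (x v : ℕ) : State :=
  { σ with var := Function.update σ.var x v }

/-- Write `v` into cell `i` of the array `a`. -/
def State.setArr (σ : State) (a i v : ℕ) : State :=
  { σ with arr := Function.update σ.arr a (Function.update (σ.arr a) i v) }

/-- Arithmetic expressions: constants, variables, array cells, sums and truncated differences. -/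
inductive Expr where
  | const (k : ℕ) : Expr
  | var (x : ℕ) : Expr
  | arr (a : ℕ) (i : Expr) : Expr
  | add (e f : Expr) : Expr
  | sub (e f : Expr) : Expr

namespace Expr

/-- The value of an expression. -/
def eval (σ : State) : Expr → ℕ
  | const k => k
  | var x => σ.var x
  | arr a i => σ.arr a (i.eval σ)
  | add e f => e.eval σ + f.eval σ
  | sub e f => e.eval σ - f.eval σ

/-- The largest value that occurs while an expression is evaluated. -/
def peak (σ : State) : Expr → ℕ
  | const k => k
  | var x => σ.var x
  | arr a i => max (i.peak σ) (σ.arr a (i.eval σ))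
  | add e f => max (max (e.peak σ) (f.peak σ)) (e.eval σ + f.eval σ)
  | sub e f => max (e.peak σ) (f.peak σ)

/-- The number of steps needed to evaluate an expression: one per operation or operand. -/
def cost : Expr → ℕ
  | const _ => 1
  | var _ => 1
  | arr _ i => i.cost + 1
  | add e f => e.cost + f.cost + 1
  | sub e f => e.cost + f.cost + 1

end Expr

/-- Tests: comparisons of expressions, and their Boolean combinations. -/
inductive Test where
  | lt (e f : Expr) : Test
  | eq (e f : Expr) : Test
  | not (b : Test) : Test
  | and (b c : Test) : Test

namespace Test

/-- The truth value of a test. -/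
def Holds (σ : State) : Test → Prop
  | lt e f => e.eval σ < f.eval σ
  | eq e f => e.eval σ = f.eval σ
  | not b => ¬ b.Holds σ
  | and b c => b.Holds σ ∧ c.Holds σ

/-- The largest value that occurs while a test is evaluated. -/
def peak (σ : State) : Test → ℕ
  | lt e f => max (e.peak σ) (f.peak σ)
  | eq e f => max (e.peak σ) (f.peak σ)
  | not b => b.peak σ
  | and b c => max (b.peak σ) (c.peak σ)

/-- The number of steps needed to evaluate a test. -/
def cost : Test → ℕ
  | lt e f => e.cost + f.cost + 1
  | eq e f => e.cost + f.cost + 1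
  | not b => b.cost + 1
  | and b c => b.cost + c.cost + 1

end Test

/-- Programs. -/
inductive Prog where
  | skip : Prog
  | assign (x : ℕ) (e : Expr) : Prog
  | store (a : ℕ) (i e : Expr) : Prog
  | seq (p q : Prog) : Prog
  | ite (b : Test) (p q : Prog) : Prog
  | while (b : Test) (p : Prog) : Prog

/-- `Exec W p σ t τ`: on a machine with words of capacity `W`, the program `p` started in the
state `σ` halts after exactly `t` steps in the state `τ`. -/
inductive Exec (W : ℕ) : Prog → State → ℕ → State → Prop where
  | skip (σ : State) : Exec W Prog.skip σ 1 σ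
  | assign (x : ℕ) (e : Expr) (σ : State) (he : e.peak σ ≤ W) :
      Exec W (Prog.assign x e) σ (e.cost + 1) (σ.setVar x (e.eval σ))
  | store (a : ℕ) (i e : Expr) (σ : State) (hi : i.peak σ ≤ W) (he : e.peak σ ≤ W) :
      Exec W (Prog.store a i e) σ (i.cost + e.cost + 1) (σ.setArr a (i.eval σ) (e.eval σ))
  | seq {p q : Prog} {σ σ₁ τ : State} {t₁ t₂ : ℕ} (hp : Exec W p σ t₁ σ₁)
      (hq : Exec W q σ₁ t₂ τ) : Exec W (Prog.seq p q) σ (t₁ + t₂) τ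
  | ite_true {b : Test} {p q : Prog} {σ τ : State} {t : ℕ} (hW : b.peak σ ≤ W)
      (hb : b.Holds σ) (hp : Exec W p σ t τ) : Exec W (Prog.ite b p q) σ (b.cost + 1 + t) τ
  | ite_false {b : Test} {p q : Prog} {σ τ : State} {t : ℕ} (hW : b.peak σ ≤ W)
      (hb : ¬ b.Holds σ) (hq : Exec W q σ t τ) : Exec W (Prog.ite b p q) σ (b.cost + 1 + t) τ
  | while_true {b : Test} {p : Prog} {σ σ₁ τ : State} {t₁ t₂ : ℕ} (hW : b.peak σ ≤ W)
      (hb : b.Holds σ) (hp : Exec W p σ t₁ σ₁) (hw : Exec W (Prog.while b p) σ₁ t₂ τ) :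
      Exec W (Prog.while b p) σ (b.cost + 1 + t₁ + t₂) τ
  | while_false {b : Test} {p : Prog} {σ : State} (hW : b.peak σ ≤ W) (hb : ¬ b.Holds σ) :
      Exec W (Prog.while b p) σ (b.cost + 1) σ

/-- The initial state: the input is written in array `0`, every other cell and every variable
is `0`. -/
def State.init (input : List ℕ) : State where
  var := fun _ => 0
  arr := fun a i => if a = 0 then input.getD i 0 else 0

end Ram

/-! ## Graphs as inputs -/

/-- `adj` is a system of adjacency lists for `G`: `adj v` lists every neighbor of `v` exactly once,
in any order. -/
def IsAdjacencyLists {n : ℕ} (G : SimpleGraph (Fin n)) (adj : Fin n → List (Fin n)) : Prop :=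
  ∀ v : Fin n, (adj v).Nodup ∧ ∀ w : Fin n, w ∈ adj v ↔ G.Adj v w

/-- Adjacency lists written as one sequence of numbers: the number of vertices, followed, for
`v = 0, …, n - 1`, by the length of the list of `v` and its members. -/
def encodeAdjacencyLists {n : ℕ} (adj : Fin n → List (Fin n)) : List ℕ :=
  n :: (List.finRange n).flatMap
    (fun v => (adj v).length :: (adj v).map (fun w : Fin n => (w : ℕ)))

/-!
The dynamic program runs on a staircase. A bipartite permutation graph has a *strong ordering*: the
two color classes can be ordered so that crossing edges `a b'`, `a' b` with `a < a'`, `b < b'` force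
the edges `a b` and `a' b'`. If the isolated vertices are counted as rows, the adjacency matrix with
rows and columns in this order is a staircase: the edges at a row are a contiguous interval of
columns, and both ends of the intervals move to the right (`IsLayout.isMono`, `IsLayout.adj_iff`).
Two edges may not have the same color if and only if one of them has its column in the row of the
other. The remaining pairs are comparable in a strict partial order, so Dilworth's theorem makes the
strong chromatic index equal to the largest number of edges that pairwise exclude each other. Such a
largest clique is found by a dynamic program (`Staircase.best`), which adds the cells of a row at or
before a column, and whole columns of rows that end in the same column
(`IsLayout.strongChromaticIndex_eq_best`).

A strong ordering is found by two breadth-first searches with restarts (`IsSweep.isStrongOrdering`).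
The first prefers vertices of large degree, so it ends every component at one end of a strong
ordering, up to vertices with equal neighborhoods; the second breaks ties by the reversed order of
the first. Ties are broken in linear time by sorting all adjacency lists at once, and the initial
order by degrees is a bucket sort. The dynamic program takes constant time per edge. The numbers of
earlier rows with a given last column, weighted by the number of cells they contribute, are kept in
a block of memory that belongs to the first such row, so that the blocks together occupy no more
cells than the input.

The running time is bounded by counting loop iterations only. In the relation `Ram.Run` every sum
other than an increment is bounded by a number that is fixed beforehand, and `Ram.Run.exec` turns an
execution with `k` loop iterations into one with at most `weight * (k + 1)` steps, in which the
numbers exceed the bound by at most the number of steps. Hoare triples `Ram.Tri` with the rules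
`Ram.while_rule` and `Ram.for_rule` verify the programs together with their iteration counts.
-/

namespace Ram

/-! ### A program logic for the random access machine -/

@[simp] theorem State.setVar_var (σ : State) (x v y : ℕ) :
    (σ.setVar x v).var y = if y = x then v else σ.var y := by
  simp [State.setVar, Function.update_apply]

@[simp] theorem State.setVar_arr (σ : State) (x v : ℕ) : (σ.setVar x v).arr = σ.arr := rfl

@[simp] theorem State.setArr_var (σ : State) (a i v : ℕ) : (σ.setArr a i v).var = σ.var := rfl

@[simp] theorem State.setArr_arr (σ : State) (a i v b : ℕ) :
    (σ.setArr a i v).arr b = if b = a then Function.update (σ.arr a) i v else σ.arr b := by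
  simp [State.setArr, Function.update_apply]

/-- Side condition under which an expression stays within the words of the machine: constants are
at most `1`, and every sum is an increment or is bounded by `V`. Increments are free, since the
running time bounds how far they can raise a value. -/
def Expr.Ok (V : ℕ) (σ : State) : Expr → Prop
  | .const k => k ≤ 1
  | .var _ => True
  | .arr _ i => i.Ok V σ
  | .add e f => e.Ok V σ ∧ f.Ok V σ ∧ (f = .const 1 ∨ e.eval σ + f.eval σ ≤ V)
  | .sub e f => e.Ok V σ ∧ f.Ok V σ

/-- Side condition `Expr.Ok` for all expressions of a test. -/
def Test.Ok (V : ℕ) (σ : State) : Test → Prop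
  | .lt e f => e.Ok V σ ∧ f.Ok V σ
  | .eq e f => e.Ok V σ ∧ f.Ok V σ
  | .not b => b.Ok V σ
  | .and b c => b.Ok V σ ∧ c.Ok V σ

/-- `Run V p σ k τ`: started in `σ`, the program `p` halts in `τ` after `k` loop iterations in
total, and all sums other than increments are bounded by `V`. Unlike `Exec`, this relation
mentions neither the number of steps nor the word size; `Run.exec` recovers both. -/
inductive Run (V : ℕ) : Prog → State → ℕ → State → Prop where
  | skip (σ : State) : Run V Prog.skip σ 0 σ
  | assign (x : ℕ) (e : Expr) (σ : State) (he : e.Ok V σ) :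
      Run V (Prog.assign x e) σ 0 (σ.setVar x (e.eval σ))
  | store (a : ℕ) (i e : Expr) (σ : State) (hi : i.Ok V σ) (he : e.Ok V σ) :
      Run V (Prog.store a i e) σ 0 (σ.setArr a (i.eval σ) (e.eval σ))
  | seq {p q : Prog} {σ σ₁ τ : State} {k₁ k₂ : ℕ} (hp : Run V p σ k₁ σ₁)
      (hq : Run V q σ₁ k₂ τ) : Run V (Prog.seq p q) σ (k₁ + k₂) τ
  | ite_true {b : Test} {p q : Prog} {σ τ : State} {k : ℕ} (hV : b.Ok V σ)
      (hb : b.Holds σ) (hp : Run V p σ k τ) : Run V (Prog.ite b p q) σ k τ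
  | ite_false {b : Test} {p q : Prog} {σ τ : State} {k : ℕ} (hV : b.Ok V σ)
      (hb : ¬ b.Holds σ) (hq : Run V q σ k τ) : Run V (Prog.ite b p q) σ k τ
  | while_true {b : Test} {p : Prog} {σ σ₁ τ : State} {k₁ k₂ : ℕ} (hV : b.Ok V σ)
      (hb : b.Holds σ) (hp : Run V p σ k₁ σ₁) (hw : Run V (Prog.while b p) σ₁ k₂ τ) :
      Run V (Prog.while b p) σ (k₁ + 1 + k₂) τ
  | while_false {b : Test} {p : Prog} {σ : State} (hV : b.Ok V σ) (hb : ¬ b.Holds σ) :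
      Run V (Prog.while b p) σ 0 σ

/-- A number of steps that depends on the program text only and bounds the time per loop
iteration. -/
def Prog.weight : Prog → ℕ
  | .skip => 1
  | .assign _ e => e.cost + 1
  | .store _ i e => i.cost + e.cost + 1
  | .seq p q => p.weight + q.weight
  | .ite b p q => b.cost + 1 + p.weight + q.weight
  | .while b p => b.cost + 1 + p.weight

/-- Every value stored in the memory is at most `B`. -/
def State.Bounded (σ : State) (B : ℕ) : Prop := (∀ x, σ.var x ≤ B) ∧ ∀ a i, σ.arr a i ≤ B

theorem State.Bounded.mono {σ : State} {B C : ℕ} (h : σ.Bounded B) (hBC : B ≤ C) : σ.Bounded C :=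
  ⟨fun x => (h.1 x).trans hBC, fun a i => (h.2 a i).trans hBC⟩

theorem State.Bounded.setVar {σ : State} {B : ℕ} (h : σ.Bounded B) {x v : ℕ} (hv : v ≤ B) :
    (σ.setVar x v).Bounded B := by
  refine ⟨fun y => ?_, h.2⟩
  rw [State.setVar_var]
  split_ifs
  exacts [hv, h.1 y]

theorem State.Bounded.setArr {σ : State} {B : ℕ} (h : σ.Bounded B) {a i v : ℕ} (hv : v ≤ B) :
    (σ.setArr a i v).Bounded B := by
  refine ⟨h.1, fun b j => ?_⟩
  rw [State.setArr_arr]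
  split_ifs
  · rw [Function.update_apply]
    split_ifs
    exacts [hv, h.2 a j]
  · exact h.2 b j

theorem Expr.peak_le {V B : ℕ} {σ : State} (hB : 1 ≤ B) (hV : V ≤ B) (hσ : σ.Bounded B) (e : Expr)
    (he : e.Ok V σ) : e.peak σ ≤ B + e.cost ∧ e.eval σ ≤ B + e.cost := by
  induction e with
  | const k => simp only [Expr.Ok, Expr.peak, Expr.eval] at *; omega
  | var x => have := hσ.1 x; simp only [Expr.peak, Expr.eval, Expr.cost] at *; omega
  | arr a i ih =>
    have := hσ.2 a (i.eval σ)
    have := ih he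
    simp only [Expr.peak, Expr.eval, Expr.cost] at *; omega
  | add e f ihe ihf =>
    obtain ⟨h1, h2, h3⟩ := he
    have := ihe h1
    have := ihf h2
    simp only [Expr.peak, Expr.eval, Expr.cost] at *
    rcases h3 with rfl | h3
    · simp only [Expr.peak, Expr.eval, Expr.cost] at *; omega
    · omega
  | sub e f ihe ihf =>
    have := ihe he.1
    have := ihf he.2
    simp only [Expr.peak, Expr.eval, Expr.cost] at *; omega

theorem Test.peak_le {V B : ℕ} {σ : State} (hB : 1 ≤ B) (hV : V ≤ B) (hσ : σ.Bounded B) (b : Test)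
    (hb : b.Ok V σ) : b.peak σ ≤ B + b.cost := by
  induction b with
  | lt e f =>
    have := Expr.peak_le hB hV hσ e hb.1
    have := Expr.peak_le hB hV hσ f hb.2
    simp only [Test.peak, Test.cost]; omega
  | eq e f =>
    have := Expr.peak_le hB hV hσ e hb.1
    have := Expr.peak_le hB hV hσ f hb.2
    simp only [Test.peak, Test.cost]; omega
  | not b ih => have := ih hb; simp only [Test.peak, Test.cost]; omega
  | and b c ihb ihc =>
    have := ihb hb.1
    have := ihc hb.2
    simp only [Test.peak, Test.cost]; omega

/-- A run with `k` loop iterations takes at most `p.weight * (k + 1)` steps, and `t` steps raise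
the values in memory by at most `t`, except for sums that are bounded by `V`. -/
theorem Run.exec {V : ℕ} {p : Prog} {σ τ : State} {k : ℕ} (h : Run V p σ k τ) :
    ∃ t ≤ p.weight * (k + 1), ∀ B W, 1 ≤ B → V ≤ B → σ.Bounded B → B + t ≤ W →
      Exec W p σ t τ ∧ τ.Bounded (B + t) := by
  induction h with
  | skip σ =>
    exact ⟨1, by simp [Prog.weight], fun B W _ _ h _ => ⟨.skip σ, h.mono (by omega)⟩⟩
  | assign x e σ he =>
    refine ⟨e.cost + 1, by simp [Prog.weight], fun B W hB hV h hW => ?_⟩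
    have := Expr.peak_le hB hV h e he
    exact ⟨.assign x e σ (by omega), (h.mono (by omega)).setVar (by omega)⟩
  | store a i e σ hi he =>
    refine ⟨i.cost + e.cost + 1, by simp [Prog.weight], fun B W hB hV h hW => ?_⟩
    have := Expr.peak_le hB hV h e he
    have := Expr.peak_le hB hV h i hi
    exact ⟨.store a i e σ (by omega) (by omega), (h.mono (by omega)).setArr (by omega)⟩
  | @seq p q σ σ₁ τ k₁ k₂ _ _ ih₁ ih₂ =>
    obtain ⟨t₁, ht₁, h₁⟩ := ih₁
    obtain ⟨t₂, ht₂, h₂⟩ := ih₂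
    refine ⟨t₁ + t₂, ?_, fun B W hB hV h hW => ?_⟩
    · simp only [Prog.weight]; nlinarith
    · obtain ⟨e₁, b₁⟩ := h₁ B W hB hV h (by omega)
      obtain ⟨e₂, b₂⟩ := h₂ (B + t₁) W (by omega) (by omega) b₁ (by omega)
      exact ⟨.seq e₁ e₂, b₂.mono (by omega)⟩
  | @ite_true b p q σ τ k hV' hb _ ih =>
    obtain ⟨t, ht, h⟩ := ih
    refine ⟨b.cost + 1 + t, ?_, fun B W hB hV hσ hW => ?_⟩
    · simp only [Prog.weight]; nlinarith
    · have := Test.peak_le hB hV hσ b hV'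
      obtain ⟨e, bd⟩ := h B W hB hV hσ (by omega)
      exact ⟨.ite_true (by omega) hb e, bd.mono (by omega)⟩
  | @ite_false b p q σ τ k hV' hb _ ih =>
    obtain ⟨t, ht, h⟩ := ih
    refine ⟨b.cost + 1 + t, ?_, fun B W hB hV hσ hW => ?_⟩
    · simp only [Prog.weight]; nlinarith
    · have := Test.peak_le hB hV hσ b hV'
      obtain ⟨e, bd⟩ := h B W hB hV hσ (by omega)
      exact ⟨.ite_false (by omega) hb e, bd.mono (by omega)⟩
  | @while_true b p σ σ₁ τ k₁ k₂ hV' hb _ _ ih₁ ih₂ =>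
    obtain ⟨t₁, ht₁, h₁⟩ := ih₁
    obtain ⟨t₂, ht₂, h₂⟩ := ih₂
    refine ⟨b.cost + 1 + t₁ + t₂, ?_, fun B W hB hV hσ hW => ?_⟩
    · simp only [Prog.weight] at *; nlinarith
    · have := Test.peak_le hB hV hσ b hV'
      obtain ⟨e₁, b₁⟩ := h₁ B W hB hV hσ (by omega)
      obtain ⟨e₂, b₂⟩ := h₂ (B + t₁) W (by omega) (by omega) b₁ (by omega)
      exact ⟨.while_true (by omega) hb e₁ e₂, b₂.mono (by omega)⟩
  | @while_false b p σ hV' hb =>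
    refine ⟨b.cost + 1, ?_, fun B W hB hV hσ hW => ?_⟩
    · simp only [Prog.weight]; omega
    · have := Test.peak_le hB hV hσ b hV'
      exact ⟨.while_false (by omega) hb, hσ.mono (by omega)⟩

/-- The program never assigns the variable `x`. -/
def Prog.NoVar (x : ℕ) : Prog → Prop
  | .skip => True
  | .assign y _ => x ≠ y
  | .store _ _ _ => True
  | .seq p q => p.NoVar x ∧ q.NoVar x
  | .ite _ p q => p.NoVar x ∧ q.NoVar x
  | .while _ p => p.NoVar x

/-- The program never writes into the array `a`. -/
def Prog.NoArr (a : ℕ) : Prog → Prop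
  | .skip => True
  | .assign _ _ => True
  | .store b _ _ => a ≠ b
  | .seq p q => p.NoArr a ∧ q.NoArr a
  | .ite _ p q => p.NoArr a ∧ q.NoArr a
  | .while _ p => p.NoArr a

/-- The states `σ` and `τ` agree on all variables and arrays that `p` does not write. -/
def Same (p : Prog) (σ τ : State) : Prop :=
  (∀ x, p.NoVar x → τ.var x = σ.var x) ∧ ∀ a, p.NoArr a → τ.arr a = σ.arr a

theorem Same.refl (p : Prog) (σ : State) : Same p σ σ := ⟨fun _ _ => rfl, fun _ _ => rfl⟩

theorem Same.trans {p : Prog} {σ τ υ : State} (h : Same p σ τ) (h' : Same p τ υ) : Same p σ υ :=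
  ⟨fun x hx => (h'.1 x hx).trans (h.1 x hx), fun a ha => (h'.2 a ha).trans (h.2 a ha)⟩

theorem Same.of_imp {p q : Prog} {σ τ : State} (h : Same p σ τ) (hv : ∀ x, q.NoVar x → p.NoVar x)
    (ha : ∀ a, q.NoArr a → p.NoArr a) : Same q σ τ :=
  ⟨fun x hx => h.1 x (hv x hx), fun a h' => h.2 a (ha a h')⟩

theorem Run.same {V : ℕ} {p : Prog} {σ τ : State} {k : ℕ} (h : Run V p σ k τ) : Same p σ τ := by
  induction h with
  | skip σ => exact Same.refl _ _
  | assign x e σ he => exact ⟨fun y hy => by simp [show y ≠ x from hy], fun _ _ => rfl⟩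
  | store a i e σ hi he => exact ⟨fun _ _ => rfl, fun b hb => by simp [show b ≠ a from hb]⟩
  | seq _ _ ih₁ ih₂ =>
    exact (ih₁.of_imp (q := .seq _ _) (fun _ h => h.1) (fun _ h => h.1)).trans
      (ih₂.of_imp (fun _ h => h.2) (fun _ h => h.2))
  | ite_true _ _ _ ih => exact ih.of_imp (fun _ h => h.1) (fun _ h => h.1)
  | ite_false _ _ _ ih => exact ih.of_imp (fun _ h => h.2) (fun _ h => h.2)
  | while_true _ _ _ _ ih₁ ih₂ =>
    exact (ih₁.of_imp (q := .while _ _) (fun _ h => h) (fun _ h => h)).trans ih₂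
  | while_false _ _ => exact Same.refl _ _

/-- Total correctness: started in `σ`, the program `p` halts, and the number of loop iterations
and the final state satisfy `Q`. -/
def Tri (V : ℕ) (p : Prog) (σ : State) (Q : ℕ → State → Prop) : Prop :=
  ∃ k τ, Run V p σ k τ ∧ Q k τ

theorem Tri.mono {V : ℕ} {p : Prog} {σ : State} {Q R : ℕ → State → Prop} (h : Tri V p σ Q)
    (hQR : ∀ k τ, Same p σ τ → Q k τ → R k τ) : Tri V p σ R := by
  obtain ⟨k, τ, hr, hq⟩ := h
  exact ⟨k, τ, hr, hQR k τ hr.same hq⟩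

@[simp] theorem tri_skip {V : ℕ} {σ : State} {Q : ℕ → State → Prop} :
    Tri V .skip σ Q ↔ Q 0 σ := by
  constructor
  · rintro ⟨k, τ, h, hq⟩; cases h; exact hq
  · exact fun h => ⟨0, σ, .skip σ, h⟩

@[simp] theorem tri_assign {V x : ℕ} {e : Expr} {σ : State} {Q : ℕ → State → Prop} :
    Tri V (.assign x e) σ Q ↔ e.Ok V σ ∧ Q 0 (σ.setVar x (e.eval σ)) := by
  constructor
  · rintro ⟨k, τ, h, hq⟩; cases h with | assign _ _ _ he => exact ⟨he, hq⟩
  · exact fun h => ⟨0, _, .assign x e σ h.1, h.2⟩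

@[simp] theorem tri_store {V a : ℕ} {i e : Expr} {σ : State} {Q : ℕ → State → Prop} :
    Tri V (.store a i e) σ Q ↔
      i.Ok V σ ∧ e.Ok V σ ∧ Q 0 (σ.setArr a (i.eval σ) (e.eval σ)) := by
  constructor
  · rintro ⟨k, τ, h, hq⟩; cases h with | store _ _ _ _ hi he => exact ⟨hi, he, hq⟩
  · exact fun h => ⟨0, _, .store a i e σ h.1 h.2.1, h.2.2⟩

@[simp] theorem tri_seq {V : ℕ} {p q : Prog} {σ : State} {Q : ℕ → State → Prop} :
    Tri V (.seq p q) σ Q ↔ Tri V p σ fun k τ => Tri V q τ fun k' τ' => Q (k + k') τ' := by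
  constructor
  · rintro ⟨k, τ, h, hq⟩; cases h with | seq h₁ h₂ => exact ⟨_, _, h₁, _, _, h₂, hq⟩
  · rintro ⟨k, τ, h, k', τ', h', hq⟩; exact ⟨_, _, .seq h h', hq⟩

@[simp] theorem tri_ite {V : ℕ} {b : Test} {p q : Prog} {σ : State} {Q : ℕ → State → Prop} :
    Tri V (.ite b p q) σ Q ↔
      b.Ok V σ ∧ (b.Holds σ → Tri V p σ Q) ∧ (¬ b.Holds σ → Tri V q σ Q) := by
  constructor
  · rintro ⟨k, τ, h, hq⟩
    cases h with
    | ite_true hV hb h => exact ⟨hV, fun _ => ⟨_, _, h, hq⟩, fun h => absurd hb h⟩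
    | ite_false hV hb h => exact ⟨hV, fun h => absurd h hb, fun _ => ⟨_, _, h, hq⟩⟩
  · rintro ⟨hV, h₁, h₂⟩
    by_cases hb : b.Holds σ
    · obtain ⟨k, τ, h, hq⟩ := h₁ hb
      exact ⟨k, τ, .ite_true hV hb h, hq⟩
    · obtain ⟨k, τ, h, hq⟩ := h₂ hb
      exact ⟨k, τ, .ite_false hV hb h, hq⟩

/-- Loop rule. The first argument of the invariant is the number of iterations performed so far,
those of inner loops included; a bound on it proves termination and the time bound at once. -/
theorem while_rule {V : ℕ} {b : Test} {p : Prog} {σ : State} (Inv : ℕ → State → Prop) (M : ℕ)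
    (h0 : Inv 0 σ) (hM : ∀ K σ', Inv K σ' → K ≤ M) (hok : ∀ K σ', Inv K σ' → b.Ok V σ')
    (hstep : ∀ K σ', Inv K σ' → b.Holds σ' → Same p σ σ' →
      Tri V p σ' fun k τ => Inv (K + k + 1) τ) :
    Tri V (.while b p) σ fun k τ => Inv k τ ∧ ¬ b.Holds τ := by
  suffices H : ∀ d K σ', M - K ≤ d → Inv K σ' → Same p σ σ' →
      Tri V (.while b p) σ' fun k τ => Inv (K + k) τ ∧ ¬ b.Holds τ by
    simpa using H (M - 0) 0 σ le_rfl h0 (Same.refl _ _)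
  intro d
  induction d with
  | zero =>
    intro K σ' hd hI hs
    by_cases hb : b.Holds σ'
    · obtain ⟨k, τ, hr, hI'⟩ := hstep K σ' hI hb hs
      have := hM _ _ hI'
      omega
    · exact ⟨0, σ', .while_false (hok _ _ hI) hb, hI, hb⟩
  | succ d ih =>
    intro K σ' hd hI hs
    by_cases hb : b.Holds σ'
    · obtain ⟨k, τ, hr, hI'⟩ := hstep K σ' hI hb hs
      obtain ⟨k', τ', hr', hI'', hb'⟩ := ih (K + k + 1) τ (by omega) hI' (hs.trans hr.same)
      refine ⟨_, τ', .while_true (hok _ _ hI) hb hr hr', ?_, hb'⟩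
      rwa [show K + (k + 1 + k') = K + k + 1 + k' by omega]
    · exact ⟨0, σ', .while_false (hok _ _ hI) hb, hI, hb⟩

/-- Run `body` with variable `x` going through `0, …, n - 1`, where variable `y` holds `n`. -/
def Prog.forLoop (x y : ℕ) (body : Prog) : Prog :=
  .seq (.assign x (.const 0))
    (.while (.lt (.var x) (.var y)) (.seq body (.assign x (.add (.var x) (.const 1)))))

@[simp] theorem Prog.noVar_forLoop {x y z : ℕ} {body : Prog} :
    (Prog.forLoop x y body).NoVar z ↔ z ≠ x ∧ body.NoVar z := by
  simp only [Prog.forLoop, Prog.NoVar]; tauto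

@[simp] theorem Prog.noArr_forLoop {x y a : ℕ} {body : Prog} :
    (Prog.forLoop x y body).NoArr a ↔ body.NoArr a := by
  simp [Prog.forLoop, Prog.NoArr]

theorem for_rule {V x y n : ℕ} {body : Prog} {σ : State} (hxy : y ≠ x) (hx : body.NoVar x)
    (hy : body.NoVar y) (hn : σ.var y = n) (Inv : ℕ → ℕ → State → Prop)
    (h0 : Inv 0 0 (σ.setVar x 0))
    (hstep : ∀ i < n, ∀ K σ', Inv i K σ' → σ'.var x = i → Same (Prog.forLoop x y body) σ σ' →
      Tri V body σ' fun k τ => Inv (i + 1) (K + k + 1) (τ.setVar x (i + 1))) :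
    Tri V (Prog.forLoop x y body) σ fun k τ => Inv n k τ := by
  have hs0 : Same (Prog.forLoop x y body) σ (σ.setVar x 0) :=
    ⟨fun z hz => by simp [(Prog.noVar_forLoop.1 hz).1], fun _ _ => rfl⟩
  suffices H : ∀ d i K σ', n - i = d → i ≤ n → Inv i K σ' → σ'.var x = i →
      Same (Prog.forLoop x y body) σ σ' →
      Tri V (.while (.lt (.var x) (.var y)) (.seq body (.assign x (.add (.var x) (.const 1)))))
        σ' fun k τ => Inv n (K + k) τ by
    simp only [Prog.forLoop, tri_seq, tri_assign, Expr.Ok, Expr.eval, zero_le, true_and]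
    refine (H n 0 0 _ rfl (Nat.zero_le _) h0 (by simp) hs0).mono fun k τ _ h => by simpa using h
  intro d
  induction d with
  | zero =>
    intro i K σ' hd hi hI hxi hs
    obtain rfl : i = n := by omega
    have hyn : σ'.var y = i := (hs.1 y (by simp [hxy, hy])).trans hn
    exact ⟨0, σ', .while_false (by simp [Test.Ok, Expr.Ok])
      (by simp [Test.Holds, Expr.eval, hxi, hyn]), hI⟩
  | succ d ih =>
    intro i K σ' hd hi hI hxi hs
    have hyn : σ'.var y = n := (hs.1 y (by simp [hxy, hy])).trans hn
    obtain ⟨k, τ, hr, hI'⟩ := hstep i (by omega) K σ' hI hxi hs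
    have hxτ : τ.var x = i := (hr.same.1 x hx).trans hxi
    have hs' : Same (Prog.forLoop x y body) σ (τ.setVar x (i + 1)) := by
      refine hs.trans ⟨fun z hz => ?_, fun a ha => hr.same.2 a (Prog.noArr_forLoop.1 ha)⟩
      have hz := Prog.noVar_forLoop.1 hz
      simp [hz.1, hr.same.1 z hz.2]
    obtain ⟨k', τ', hr', hQ⟩ := ih (i + 1) (K + k + 1) _ (by omega) (by omega) hI' (by simp) hs'
    have ha : Run V (.assign x (.add (.var x) (.const 1))) τ 0 (τ.setVar x (i + 1)) := by
      have := Run.assign (V := V) x (.add (.var x) (.const 1)) τ (by simp [Expr.Ok])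
      simpa [Expr.eval, hxτ] using this
    refine ⟨_, τ', .while_true (by simp [Test.Ok, Expr.Ok]) ?_ (.seq hr ha) hr', ?_⟩
    · simp only [Test.Holds, Expr.eval, hxi, hyn]; omega
    · change Inv n (K + (k + 0 + 1 + k')) τ'
      rwa [show K + (k + 0 + 1 + k') = K + k + 1 + k' by omega]

end Ram

/-! ### Dilworth's theorem -/

/-- Dilworth's theorem. In Hall's bipartite graph between the elements and the elements together
with `k` spare vertices, where `x` is joined to everything above it, Hall's condition holds because
`S` minus the elements above `S` is an antichain. A matching is an injective successor function
whose ends are spare vertices. -/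
theorem exists_chain_coloring_of_antichain_card_le {α : Type*} [Finite α] (lt : α → α → Prop)
    (htrans : ∀ x y z, lt x y → lt y z → lt x z) (hirr : ∀ x, ¬ lt x x) (k : ℕ)
    (hk : ∀ S : Finset α, (∀ x ∈ S, ∀ y ∈ S, ¬ lt x y) → S.card ≤ k) :
    ∃ c : α → Fin k, ∀ x y, c x = c y → x ≠ y → lt x y ∨ lt y x := by
  classical
  have := Fintype.ofFinite α
  let up : α → Finset α := fun x => Finset.univ.filter (lt x)
  let t : α → Finset (α ⊕ Fin k) := fun x => (up x).disjSum Finset.univ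
  obtain ⟨g, hg, hgt⟩ : ∃ g : α → α ⊕ Fin k, Function.Injective g ∧ ∀ x, g x ∈ t x := by
    rw [← Finset.all_card_le_biUnion_card_iff_exists_injective]
    intro S
    rcases S.eq_empty_or_nonempty with rfl | ⟨x₀, hx₀⟩
    · simp
    have hsub : (S.biUnion up).disjSum (Finset.univ : Finset (Fin k)) ⊆ S.biUnion t := by
      intro z hz
      simp only [Finset.mem_disjSum, Finset.mem_biUnion, t] at hz ⊢
      rcases hz with ⟨y, ⟨x, hx, hy⟩, rfl⟩ | ⟨i, hi, rfl⟩
      · exact ⟨x, hx, Or.inl ⟨y, hy, rfl⟩⟩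
      · exact ⟨x₀, hx₀, Or.inr ⟨i, hi, rfl⟩⟩
    have h1 := Finset.card_le_card hsub
    rw [Finset.card_disjSum, Finset.card_univ, Fintype.card_fin] at h1
    have h2 : (S \ S.biUnion up).card ≤ k := by
      refine hk _ fun x hx y hy hxy => (Finset.mem_sdiff.1 hy).2 ?_
      exact Finset.mem_biUnion.2 ⟨x, (Finset.mem_sdiff.1 hx).1, by simp [up, hxy]⟩
    have h3 := Finset.le_card_sdiff (S.biUnion up) S
    omega
  let step : α → α → Prop := fun x y => g x = Sum.inl y
  have hstep : ∀ x y, step x y → lt x y := by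
    intro x y h
    have := hgt x
    rw [show g x = Sum.inl y from h] at this
    simpa [t, up] using this
  have hreach : ∀ x y, Relation.ReflTransGen step x y → x = y ∨ lt x y := by
    intro x y h
    induction h with
    | refl => exact Or.inl rfl
    | tail _ h ih =>
      rcases ih with rfl | ih
      · exact Or.inr (hstep _ _ h)
      · exact Or.inr (htrans _ _ _ ih (hstep _ _ h))
  have hwf : WellFounded (fun x y => lt y x) := by
    have : Std.Irrefl (fun x y => lt y x) := ⟨hirr⟩
    have : IsTrans α (fun x y => lt y x) := ⟨fun x y z h h' => htrans _ _ _ h' h⟩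
    exact Finite.wellFounded_of_trans_of_irrefl _
  have hend : ∀ x, ∃ i : Fin k, ∃ z, Relation.ReflTransGen step x z ∧ g z = Sum.inr i := by
    intro x
    induction x using hwf.induction with
    | _ x ih =>
      rcases h : g x with y | i
      · obtain ⟨i, z, hz, hi⟩ := ih y (hstep x y h)
        exact ⟨i, z, .head h hz, hi⟩
      · exact ⟨i, x, .refl, h⟩
  choose c z hz hc using hend
  refine ⟨c, fun x y hxy hne => ?_⟩
  have hzz : z x = z y := hg (by rw [hc, hc, hxy])
  have hx := Relation.reflTransGen_swap.2 (hz x)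
  have hy := Relation.reflTransGen_swap.2 (hz y)
  rw [← hzz] at hy
  have huniq : Relator.RightUnique (Function.swap step) := fun a b b' h h' =>
    hg (Eq.trans (show g b = Sum.inl a from h) (show g b' = Sum.inl a from h').symm)
  rcases hx.total_of_right_unique huniq hy with h | h
  · rcases hreach _ _ (Relation.reflTransGen_swap.1 h) with h | h
    · exact absurd h.symm hne
    · exact Or.inr h
  · rcases hreach _ _ (Relation.reflTransGen_swap.1 h) with h | h
    · exact absurd h hne
    · exact Or.inl h

/-! ### Largest cliques of a staircase of cells -/

namespace Staircase

/-- The cells of a staircase: row `i` consists of the `d i` consecutive columns from `l i` on. -/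
def IsCell (l d : ℕ → ℕ) (e : ℕ × ℕ) : Prop := l e.1 ≤ e.2 ∧ e.2 < l e.1 + d e.1

/-- In the nonempty rows, both ends move to the right. -/
def IsMono (l d : ℕ → ℕ) : Prop :=
  ∀ a b, a < b → 0 < d a → 0 < d b → l a ≤ l b ∧ l a + d a ≤ l b + d b

/-- A clique of cells: of any two cells in distinct rows, the later one is in a column of the row
of the earlier one, or the earlier one is in a column of the row of the later one. -/
def IsClique (l d : ℕ → ℕ) (X : Finset (ℕ × ℕ)) : Prop :=
  (∀ e ∈ X, IsCell l d e) ∧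
    ∀ e ∈ X, ∀ f ∈ X, e.1 < f.1 → f.2 < l e.1 + d e.1 ∨ l f.1 ≤ e.2

/-- The number of nonempty rows before row `i` whose last column is `j`. -/
def endCount (l d : ℕ → ℕ) (i j : ℕ) : ℕ :=
  ((Finset.range i).filter fun a => 0 < d a ∧ l a + d a = j + 1).card

/-- One row of the dynamic program: the values at its columns `l + d - 1`, `l + d - 2`, …, where `F`
holds the values of the rows above and `c` the numbers `endCount`. -/
def rowVal (F c : ℕ → ℕ) (l d : ℕ) : ℕ → ℕ
  | 0 => F (l + d - 1) + d
  | k + 1 => max (F (l + d - 1 - (k + 1)) + (d - (k + 1)))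
      (rowVal F c l d k + c (l + d - 1 - (k + 1)) * (d - (k + 1)))

/-- The dynamic program: `val l d i j` is the number of cells of a largest clique that is built from
cells in rows before `i` that extend to column `j` or further. -/
def val (l d : ℕ → ℕ) : ℕ → ℕ → ℕ
  | 0, _ => 0
  | i + 1, j => if l i ≤ j ∧ j < l i + d i then
      rowVal (val l d i) (endCount l d i) (l i) (d i) (l i + d i - 1 - j) else val l d i j

variable {l d : ℕ → ℕ}

theorem rowVal_eq_max {F c : ℕ → ℕ} {l d j : ℕ} (hj : l ≤ j) (hj' : j + 1 < l + d) :
    rowVal F c l d (l + d - 1 - j) = max (F j + (j + 1 - l))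
      (rowVal F c l d (l + d - 1 - (j + 1)) + c j * (j + 1 - l)) := by
  obtain ⟨k, hk⟩ : ∃ k, l + d - 1 - j = k + 1 := ⟨l + d - 2 - j, by omega⟩
  rw [hk, rowVal, show l + d - 1 - (k + 1) = j by omega, show d - (k + 1) = j + 1 - l by omega,
    show l + d - 1 - (j + 1) = k by omega]

theorem rowVal_last {F c : ℕ → ℕ} {l d : ℕ} :
    rowVal F c l d (l + d - 1 - (l + d - 1)) = F (l + d - 1) + d := by
  rw [Nat.sub_self, rowVal]

theorem IsCell.pos {e : ℕ × ℕ} (h : IsCell l d e) : 0 < d e.1 := by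
  have := h.1; have := h.2; omega

/-- Extending a clique to the next row: the cells of row `i` up to column `j`. -/
theorem IsClique.add_row {X : Finset (ℕ × ℕ)} {i j : ℕ} (hX : IsClique l d X)
    (hX' : ∀ e ∈ X, e.1 < i ∧ j < l e.1 + d e.1) (hj : l i ≤ j) (hj' : j < l i + d i) :
    ∃ Y, IsClique l d Y ∧ (∀ e ∈ Y, e.1 < i + 1 ∧ j < l e.1 + d e.1) ∧
      Y.card = X.card + (j + 1 - l i) := by
  classical
  refine ⟨X ∪ {i} ×ˢ Finset.Icc (l i) j, ⟨?_, ?_⟩, ?_, ?_⟩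
  · intro e he
    rcases Finset.mem_union.1 he with he | he
    · exact hX.1 e he
    · simp only [Finset.mem_product, Finset.mem_singleton, Finset.mem_Icc] at he
      obtain ⟨rfl, h1, h2⟩ := he
      exact ⟨h1, by omega⟩
  · intro e he f hf hlt
    simp only [Finset.mem_union, Finset.mem_product, Finset.mem_singleton, Finset.mem_Icc] at he hf
    rcases he with he | he <;> rcases hf with hf | hf
    · exact hX.2 e he f hf hlt
    · have := (hX' e he).2; omega
    · have := (hX' f hf).1; omega
    · omega
  · intro e he
    simp only [Finset.mem_union, Finset.mem_product, Finset.mem_singleton, Finset.mem_Icc] at he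
    rcases he with he | ⟨he, h⟩
    · have := hX' e he; omega
    · rw [he]; omega
  · rw [Finset.card_union_of_disjoint, Finset.card_product]
    · simp
    · rw [Finset.disjoint_left]
      intro e he he'
      simp only [Finset.mem_product, Finset.mem_singleton] at he'
      have := hX' e he; omega

/-- Extending a clique to the previous column: the rows before `i` that end in column `j`. -/
theorem IsClique.add_column {X : Finset (ℕ × ℕ)} {i j : ℕ} (hm : IsMono l d) (hX : IsClique l d X)
    (hX' : ∀ e ∈ X, e.1 < i + 1 ∧ j + 1 < l e.1 + d e.1) (hj : l i ≤ j) (hj' : j + 1 < l i + d i) :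
    ∃ Y, IsClique l d Y ∧ (∀ e ∈ Y, e.1 < i + 1 ∧ j < l e.1 + d e.1) ∧
      Y.card = X.card + endCount l d i j * (j + 1 - l i) := by
  classical
  refine ⟨X ∪ ((Finset.range i).filter fun a => 0 < d a ∧ l a + d a = j + 1) ×ˢ
    Finset.Icc (l i) j, ⟨?_, ?_⟩, ?_, ?_⟩
  · intro e he
    rcases Finset.mem_union.1 he with he | he
    · exact hX.1 e he
    · simp only [Finset.mem_product, Finset.mem_filter, Finset.mem_range, Finset.mem_Icc] at he
      have := hm e.1 i (by omega) (by omega) (by omega)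
      exact ⟨by omega, by omega⟩
  · intro e he f hf hlt
    simp only [Finset.mem_union, Finset.mem_product, Finset.mem_filter, Finset.mem_range,
      Finset.mem_Icc] at he hf
    rcases he with he | he <;> rcases hf with hf | hf
    · exact hX.2 e he f hf hlt
    · have := hm e.1 f.1 hlt (hX.1 e he).pos (by omega)
      have := hX' e he
      omega
    · right
      have h1 := hX' f hf
      rcases Nat.lt_or_ge f.1 i with h | h
      · have := hm f.1 i h (hX.1 f hf).pos (by omega)
        omega
      · rw [show f.1 = i by omega]; omega
    · omega
  · intro e he
    simp only [Finset.mem_union, Finset.mem_product, Finset.mem_filter, Finset.mem_range,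
      Finset.mem_Icc] at he
    rcases he with he | he
    · have := hX' e he; omega
    · omega
  · rw [Finset.card_union_of_disjoint, Finset.card_product, endCount]
    · simp
    · rw [Finset.disjoint_left]
      intro e he he'
      simp only [Finset.mem_product, Finset.mem_filter] at he'
      have := hX' e he; omega

/-- Every value of the dynamic program is the size of a clique. -/
theorem exists_isClique_card_eq_val (hm : IsMono l d) (i j : ℕ) :
    ∃ X, IsClique l d X ∧ (∀ e ∈ X, e.1 < i ∧ j < l e.1 + d e.1) ∧ X.card = val l d i j := by
  induction i generalizing j with
  | zero => exact ⟨∅, ⟨by simp, by simp⟩, by simp, by simp [val]⟩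
  | succ i ih =>
    rw [val]
    split_ifs with hj
    · obtain ⟨k, hk, rfl⟩ : ∃ k < d i, j = l i + d i - 1 - k :=
        ⟨l i + d i - 1 - j, by omega, by omega⟩
      clear hj
      rw [show l i + d i - 1 - (l i + d i - 1 - k) = k by omega]
      induction k with
      | zero =>
        obtain ⟨X, hX, hX', hc⟩ := ih (l i + d i - 1)
        obtain ⟨Y, hY, hY', hc'⟩ := hX.add_row hX' (by omega) (by omega)
        exact ⟨Y, hY, by simpa using hY', by rw [hc', hc, rowVal]; omega⟩
      | succ k ihk =>
        rw [rowVal]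
        set j := l i + d i - 1 - (k + 1) with hj
        rcases le_total (rowVal (val l d i) (endCount l d i) (l i) (d i) k +
          endCount l d i j * (d i - (k + 1))) (val l d i j + (d i - (k + 1))) with h | h
        · rw [max_eq_left h]
          obtain ⟨X, hX, hX', hc⟩ := ih j
          obtain ⟨Y, hY, hY', hc'⟩ := hX.add_row hX' (by omega) (by omega)
          exact ⟨Y, hY, hY', by rw [hc', hc]; omega⟩
        · rw [max_eq_right h]
          obtain ⟨X, hX, hX', hc⟩ := ihk (by omega)
          obtain ⟨Y, hY, hY', hc'⟩ := hX.add_column (i := i) (j := j) hm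
            (fun e he => by have := hX' e he; omega) (by omega) (by omega)
          refine ⟨Y, hY, hY', ?_⟩
          rw [hc', hc, show d i - (k + 1) = j + 1 - l i by omega]
    · obtain ⟨X, hX, hX', hc⟩ := ih j
      exact ⟨X, hX, fun e he => ⟨by have := (hX' e he).1; omega, (hX' e he).2⟩, hc⟩

theorem IsClique.card_le {X : Finset (ℕ × ℕ)} {i : ℕ} (hX : IsClique l d X)
    (hi : ∀ e ∈ X, e.1 < i) : X.card ≤ ∑ a ∈ Finset.range i, d a := by
  classical
  have hsub : X ⊆ (Finset.range i).biUnion fun a => {a} ×ˢ Finset.Ico (l a) (l a + d a) := by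
    intro e he
    have := hX.1 e he
    simp only [Finset.mem_biUnion, Finset.mem_range, Finset.mem_product, Finset.mem_singleton,
      Finset.mem_Ico]
    exact ⟨e.1, hi e he, rfl, this.1, this.2⟩
  refine (Finset.card_le_card hsub).trans (Finset.card_biUnion_le.trans ?_)
  simp

theorem val_le (hm : IsMono l d) (i j : ℕ) : val l d i j ≤ ∑ a ∈ Finset.range i, d a := by
  obtain ⟨X, hX, hX', hc⟩ := exists_isClique_card_eq_val hm i j
  exact hc ▸ hX.card_le fun e he => (hX' e he).1

/-- The part of the clique `X` in rows before `i` that extend to column `j` is no larger than the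
value of the dynamic program, provided that no cell of `X` lies entirely before column `lam` in a
row that ends before column `j`; the columns to the left of `lam` no longer matter. -/
theorem IsClique.card_filter_le_val {X : Finset (ℕ × ℕ)} (hm : IsMono l d) (hX : IsClique l d X)
    (i lam j : ℕ) (hlam : ∀ a < i, 0 < d a → l a ≤ lam) (hj : lam ≤ j)
    (hfree : ∀ e ∈ X, e.1 < i → e.2 < lam → j < l e.1 + d e.1) :
    (X.filter fun e => e.1 < i ∧ j < l e.1 + d e.1).card ≤ val l d i j := by
  classical
  induction i generalizing lam j with
  | zero => simp
  | succ i ih =>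
    rcases Nat.eq_zero_or_pos (d i) with hd | hd
    · rw [val, if_neg (by omega)]
      refine le_trans (Finset.card_le_card ?_) (ih lam j (fun a ha => hlam a (by omega)) hj
        fun e he hi => hfree e he (by omega))
      intro e he
      simp only [Finset.mem_filter] at he ⊢
      have := (hX.1 e he.1).pos
      have : e.1 ≠ i := by rintro h; rw [h] at this; omega
      exact ⟨he.1, by omega, he.2.2⟩
    rcases Nat.lt_or_ge j (l i + d i) with hji | hji
    swap
    · rw [Finset.card_eq_zero.2]
      · exact Nat.zero_le _
      rw [Finset.filter_eq_empty_iff]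
      rintro e he ⟨h1, h2⟩
      rcases Nat.lt_or_ge e.1 i with h | h
      · have := hm e.1 i h (hX.1 e he).pos hd
        omega
      · rw [show e.1 = i by omega] at h2; omega
    have hlj : l i ≤ j := (hlam i (by omega) hd).trans hj
    have hfree' : ∀ e ∈ X, e.1 < i → e.2 < l i → j < l e.1 + d e.1 := fun e he h1 h2 =>
      hfree e he (by omega) (h2.trans_le (hlam i (by omega) hd))
    clear hfree hj hlam
    have hlami : ∀ a < i, 0 < d a → l a ≤ l i := fun a ha hda => (hm a i ha hda hd).1
    rw [val, if_pos ⟨hlj, hji⟩]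
    -- The cells of row `i` up to column `j` are added to those above.
    have hup : ∀ j, l i ≤ j → (∀ e ∈ X, e.1 < i → e.2 < l i → j < l e.1 + d e.1) →
        (∀ e ∈ X, e.1 = i → e.2 ≤ j) →
        (X.filter fun e => e.1 < i + 1 ∧ j < l e.1 + d e.1).card ≤
          val l d i j + (j + 1 - l i) := by
      intro j hlj hfr hle
      have hsub : (X.filter fun e => e.1 < i + 1 ∧ j < l e.1 + d e.1) ⊆
          (X.filter fun e => e.1 < i ∧ j < l e.1 + d e.1) ∪ {i} ×ˢ Finset.Icc (l i) j := by
        intro e he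
        simp only [Finset.mem_filter, Finset.mem_union, Finset.mem_product, Finset.mem_singleton,
          Finset.mem_Icc] at he ⊢
        rcases Nat.lt_or_ge e.1 i with h | h
        · exact Or.inl ⟨he.1, h, he.2.2⟩
        · have h' : e.1 = i := by omega
          have := (hX.1 e he.1).1
          rw [h'] at this
          exact Or.inr ⟨h', this, hle e he.1 h'⟩
      have h1 := (Finset.card_le_card hsub).trans (Finset.card_union_le _ _)
      have h2 := ih (l i) j hlami hlj hfr
      simp only [Finset.card_product, Finset.card_singleton, Nat.card_Icc, one_mul] at h1
      omega
    -- Downward induction on the column `j`.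
    obtain ⟨k, hk⟩ : ∃ k, l i + d i - 1 - j = k := ⟨_, rfl⟩
    induction k generalizing j with
    | zero =>
      obtain rfl : j = l i + d i - 1 := by omega
      rw [rowVal_last]
      refine (hup _ hlj hfree' fun e he hi => ?_).trans (by omega)
      have := (hX.1 e he).2
      rw [hi] at this
      omega
    | succ k ihk =>
      rw [rowVal_eq_max hlj (by omega)]
      by_cases hfr : ∀ e ∈ X, e.1 < i → e.2 < l i → j + 1 < l e.1 + d e.1
      · refine le_trans ?_ (le_max_right _ _)
        have h2 := ihk (j + 1) (by omega) (by omega) hfr (by omega)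
        have hsub : (X.filter fun e => e.1 < i + 1 ∧ j < l e.1 + d e.1) ⊆
            (X.filter fun e => e.1 < i + 1 ∧ j + 1 < l e.1 + d e.1) ∪
              ((Finset.range i).filter fun a => 0 < d a ∧ l a + d a = j + 1) ×ˢ
                Finset.Icc (l i) j := by
          intro e he
          simp only [Finset.mem_filter, Finset.mem_union, Finset.mem_product, Finset.mem_range,
            Finset.mem_Icc] at he ⊢
          rcases Nat.lt_or_ge (j + 1) (l e.1 + d e.1) with h | h
          · exact Or.inl ⟨he.1, he.2.1, h⟩
          · have hc := hX.1 e he.1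
            have hne : e.1 ≠ i := by rintro h'; rw [h'] at h; omega
            have hlt : e.1 < i := by omega
            refine Or.inr ⟨⟨hlt, hc.pos, by omega⟩, ?_, by have := hc.2; omega⟩
            by_contra hcon
            have := hfr e he.1 hlt (by omega)
            omega
        have h1 := (Finset.card_le_card hsub).trans (Finset.card_union_le _ _)
        rw [Finset.card_product, Nat.card_Icc] at h1
        rw [endCount]
        omega
      · refine le_trans (hup _ hlj hfree' fun e he hi => ?_) (le_max_left _ _)
        push Not at hfr
        obtain ⟨f, hf, hfi, hf2, hf3⟩ := hfr
        rcases hX.2 f hf e he (by omega) with h | h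
        · omega
        · rw [hi] at h; omega

/-- The result of the dynamic program after `n` rows: the largest value at the first column of a
row. -/
def best (l d : ℕ → ℕ) : ℕ → ℕ
  | 0 => 0
  | i + 1 => if d i = 0 then best l d i else max (best l d i) (val l d (i + 1) (l i))

theorem exists_isClique_card_eq_best (hm : IsMono l d) (n : ℕ) :
    ∃ X, IsClique l d X ∧ (∀ e ∈ X, e.1 < n) ∧ X.card = best l d n := by
  induction n with
  | zero => exact ⟨∅, ⟨by simp, by simp⟩, by simp, by simp [best]⟩
  | succ i ih =>
    obtain ⟨X, hX, hX', hc⟩ := ih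
    have hX'' : ∀ e ∈ X, e.1 < i + 1 := fun e he => (hX' e he).trans (by omega)
    rw [best]
    split_ifs with hd
    · exact ⟨X, hX, hX'', hc⟩
    rcases le_total (val l d (i + 1) (l i)) (best l d i) with h | h
    · exact ⟨X, hX, hX'', by rw [max_eq_left h, hc]⟩
    · obtain ⟨Y, hY, hY', hc'⟩ := exists_isClique_card_eq_val hm (i + 1) (l i)
      exact ⟨Y, hY, fun e he => (hY' e he).1, by rw [max_eq_right h, hc']⟩

theorem val_le_best {i n : ℕ} (hi : i < n) (hd : 0 < d i) :
    val l d (i + 1) (l i) ≤ best l d n := by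
  induction n with
  | zero => omega
  | succ n ih =>
    rw [best]
    rcases Nat.lt_or_ge i n with h | h
    · have := ih h
      split_ifs <;> omega
    · obtain rfl : i = n := by omega
      rw [if_neg (by omega)]
      exact le_max_right _ _

theorem IsClique.card_le_best {X : Finset (ℕ × ℕ)} (hm : IsMono l d) (hX : IsClique l d X) {n : ℕ}
    (hn : ∀ e ∈ X, e.1 < n) : X.card ≤ best l d n := by
  rcases X.eq_empty_or_nonempty with rfl | hne
  · simp
  obtain ⟨e, he, hmax⟩ := X.exists_max_image Prod.fst hne
  have hd := (hX.1 e he).pos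
  refine le_trans ?_ (val_le_best (hn e he) hd)
  have hfree : ∀ f ∈ X, l e.1 < l f.1 + d f.1 := by
    intro f hf
    have hfc := hX.1 f hf
    rcases Nat.lt_or_ge f.1 e.1 with h | h
    · have := (hX.1 e he).1
      have := hfc.2
      rcases hX.2 f hf e he h with h' | h' <;> omega
    · rw [show f.1 = e.1 from le_antisymm (hmax f hf) h]; omega
  have := hX.card_filter_le_val hm (e.1 + 1) (l e.1) (l e.1)
    (fun a ha hda => by
      rcases Nat.lt_or_ge a e.1 with h | h
      · exact (hm a e.1 h hda hd).1
      · rw [show a = e.1 by omega])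
    le_rfl (fun f hf _ _ => hfree f hf)
  rwa [Finset.filter_true_of_mem fun f hf => ⟨Nat.lt_succ_of_le (hmax f hf), hfree f hf⟩] at this

end Staircase

/-! ### Strong orderings of bipartite permutation graphs -/

section Ordering

variable {V : Type*} {G : SimpleGraph V} {col : V → Bool}

/-- `col` is a proper coloring with two colors. -/
def IsTwoColoring (G : SimpleGraph V) (col : V → Bool) : Prop := ∀ x y, G.Adj x y → col x ≠ col y

/-- `x` and `y` have the same neighbors. -/
def IsTwin (G : SimpleGraph V) (x y : V) : Prop := ∀ z, G.Adj x z ↔ G.Adj y z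

/-- The ordering of the vertices by `T` is a strong ordering: two edges that cross, with respect to
the orderings of the two color classes, lie on a cycle of length four. -/
def IsStrongOrdering {α : Type*} [LT α] (G : SimpleGraph V) (col : V → Bool) (T : V → α) : Prop :=
  ∀ a a' b b', col a = col a' → col b = col b' → T a < T a' → T b < T b' →
    G.Adj a b' → G.Adj a' b → G.Adj a b ∧ G.Adj a' b'

theorem IsStrongOrdering.neg {T : V → ℝ} (h : IsStrongOrdering G col T) :
    IsStrongOrdering G col fun x => -T x := by
  intro a a' b b' ha hb hT hT' h1 h2
  exact (h a' a b' b ha.symm hb.symm (neg_lt_neg_iff.1 hT) (neg_lt_neg_iff.1 hT') h2 h1).symm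

theorem diagramSegment_inter_nonempty {s t s' t' : ℝ} (hs : s < s') (ht : t ≠ t') :
    (diagramSegment s t ∩ diagramSegment s' t').Nonempty ↔ t' < t := by
  constructor
  · rintro ⟨x, ⟨a, b, ha, hb, hab, rfl⟩, ⟨c, e, hc, he, hce, hx⟩⟩
    simp only [Prod.smul_mk, smul_eq_mul, Prod.mk_add_mk, Prod.mk.injEq] at hx
    obtain ⟨h1, h2⟩ := hx
    obtain rfl : a = c := by linarith
    obtain rfl : b = e := by linarith
    by_contra hlt
    have hlt : t < t' := lt_of_le_of_ne (not_lt.1 hlt) ht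
    rcases ha.eq_or_lt with h | h
    · nlinarith
    · nlinarith
  · intro h
    have hpos : 0 < (s' - s) + (t - t') := by linarith
    have ha : 0 ≤ (t - t') / ((s' - s) + (t - t')) := by apply div_nonneg <;> linarith
    have hb : 0 ≤ (s' - s) / ((s' - s) + (t - t')) := by apply div_nonneg <;> linarith
    have hab : (t - t') / ((s' - s) + (t - t')) + (s' - s) / ((s' - s) + (t - t')) = 1 := by
      rw [← add_div, add_comm, div_self hpos.ne']
    refine ⟨_, ⟨_, _, ha, hb, hab, rfl⟩, ⟨_, _, ha, hb, hab, ?_⟩⟩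
    simp only [Prod.smul_mk, smul_eq_mul, Prod.mk_add_mk, Prod.mk.injEq, and_true]
    rw [div_mul_eq_mul_div, div_mul_eq_mul_div, div_mul_eq_mul_div, div_mul_eq_mul_div, ← add_div,
      ← add_div]
    congr 1
    ring

/-- The order of the end points on the upper line of a permutation diagram is a strong ordering,
for every two-coloring. -/
theorem IsPermutationGraph.exists_isStrongOrdering (h : IsPermutationGraph G)
    (hcol : IsTwoColoring G col) :
    ∃ T : V → ℝ, Function.Injective T ∧ IsStrongOrdering G col T := by
  obtain ⟨top, bot, htop, hbot, hadj⟩ := h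
  have key : ∀ x y, top x < top y → (G.Adj x y ↔ bot y < bot x) := by
    intro x y hxy
    have hne : x ≠ y := by rintro rfl; exact lt_irrefl _ hxy
    rw [hadj, diagramSegment_inter_nonempty hxy fun h => hne (hbot h)]
    exact and_iff_right hne
  have key' : ∀ x y, top y < top x → (G.Adj x y ↔ bot x < bot y) := by
    intro x y hxy
    rw [G.adj_comm, key y x hxy]
  have hsame : ∀ x y, col x = col y → top x < top y → bot x < bot y := by
    intro x y hc hxy
    have h1 : ¬ G.Adj x y := fun h => hcol x y h hc
    rw [key x y hxy, not_lt] at h1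
    refine lt_of_le_of_ne h1 fun h => ?_
    rw [hbot h] at hxy
    exact lt_irrefl _ hxy
  refine ⟨top, htop, fun a a' b b' ha hb hT hT' h1 h2 => ?_⟩
  have hba := hsame _ _ ha hT
  have hbb := hsame _ _ hb hT'
  have hne1 : top a ≠ top b' := fun h => h1.ne (htop h)
  have hne2 : top a' ≠ top b := fun h => h2.ne (htop h)
  rcases lt_or_gt_of_ne hne1 with h | h <;> rcases lt_or_gt_of_ne hne2 with h' | h'
  · rw [key _ _ h] at h1
    rw [key _ _ h'] at h2
    exact ⟨(key _ _ (by linarith)).2 (by linarith), (key _ _ (by linarith)).2 (by linarith)⟩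
  · rw [key _ _ h] at h1
    rw [key' _ _ h'] at h2
    linarith
  · linarith
  · rw [key' _ _ h] at h1
    rw [key' _ _ h'] at h2
    exact ⟨(key' _ _ (by linarith)).2 (by linarith), (key' _ _ (by linarith)).2 (by linarith)⟩

/-! ### Breadth-first sweeps -/

/-- The order in which a breadth-first search with restarts visits the vertices, where ties are
broken by the relation `rel`: at the time when `x` is visited, the earliest visited neighbor of `x`
is at least as early as that of any vertex `y` visited later, and if it is not earlier, then
`rel x y`. A vertex without visited neighbors comes last in this comparison. -/
structure IsSweep (G : SimpleGraph V) (rel : V → V → Prop) (pos : V → ℕ) : Prop where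
  injective : Function.Injective pos
  le : ∀ x y, pos x < pos y → ∀ z, pos z < pos x → G.Adj z y → ∃ z', pos z' ≤ pos z ∧ G.Adj z' x
  tie : ∀ x y, pos x < pos y →
    (∀ z, pos z < pos x → G.Adj z x → ∃ z', pos z' ≤ pos z ∧ G.Adj z' y) → rel x y

variable {rel rel' : V → V → Prop} {pos pos' : V → ℕ}

/-- When a new component is entered, the components entered earlier have been exhausted. -/
theorem IsSweep.pos_lt_of_reachable (h : IsSweep G rel pos) {x s t : V}
    (hx : ∀ z, pos z < pos x → ¬ G.Adj z x) (hs : pos s < pos x) (hst : G.Reachable s t) :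
    pos t < pos x := by
  obtain ⟨p⟩ := hst
  induction p with
  | nil => exact hs
  | @cons s r t hsr p ih =>
    refine ih ?_
    rcases lt_trichotomy (pos r) (pos x) with h' | h' | h'
    · exact h'
    · rw [h.injective h'] at hsr
      exact absurd hsr (hx s hs)
    · obtain ⟨z, hz, hz'⟩ := h.le x r h' s hs hsr
      exact absurd hz' (hx z (by omega))

theorem IsSweep.pos_le_of_reachable (h : IsSweep G rel pos) {x s : V}
    (hx : ∀ z, pos z < pos x → ¬ G.Adj z x) (hs : G.Reachable x s) : pos x ≤ pos s := by
  by_contra hlt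
  exact lt_irrefl _ (h.pos_lt_of_reachable hx (not_le.1 hlt) hs.symm)

/-- The first vertex of a component. -/
theorem IsSweep.exists_root (h : IsSweep G rel pos) (x : V) :
    ∃ u, G.Reachable u x ∧ (∀ z, pos z < pos u → ¬ G.Adj z u) ∧
      ∀ y, G.Reachable u y → (∀ z, pos z < pos y → ¬ G.Adj z y) → y = u := by
  obtain ⟨u, hu, hmin⟩ :=
    (InvImage.wf pos Nat.lt_wfRel.wf).has_min {u | G.Reachable u x} ⟨x, .refl x⟩
  have hroot : ∀ z, pos z < pos u → ¬ G.Adj z u := fun z hz hzu =>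
    hmin z (hzu.reachable.trans hu) hz
  refine ⟨u, hu, hroot, fun y hy hy' => h.injective (le_antisymm ?_ ?_)⟩
  · exact h.pos_le_of_reachable hy' hy.symm
  · exact h.pos_le_of_reachable hroot hy

theorem exists_adj_of_reachable {x y : V} (h : G.Reachable x y) (hne : x ≠ y) :
    ∃ z, G.Adj x z := by
  obtain ⟨p⟩ := h
  cases p with
  | nil => exact absurd rfl hne
  | cons h p => exact ⟨_, h⟩

/-- If every vertex precedes, among vertices with the same earliest neighbor, those of smaller
neighborhoods, then it precedes all vertices of smaller neighborhoods. -/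
theorem IsSweep.pos_lt_of_subset (h : IsSweep G rel pos)
    (hrel : ∀ x y, rel x y → (∀ z, G.Adj x z → G.Adj y z) → IsTwin G x y) {x y : V}
    (hxy : ∀ z, G.Adj x z → G.Adj y z) (hne : ¬ IsTwin G x y) : pos y < pos x := by
  rcases lt_trichotomy (pos x) (pos y) with h' | h' | h'
  · refine absurd (hrel x y (h.tie x y h' fun z _ hzx => ⟨z, le_rfl, ?_⟩) hxy) hne
    exact (hxy z hzx.symm).symm
  · rw [h.injective h'] at hne
    exact absurd (fun z => Iff.rfl) hne
  · exact h'

/-- If `u` is the last vertex of its component in a sweep, and the component was not entered to the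
right of `u`, then all vertices to the right of `u` on its side are twins of `u`. Otherwise, let `z`
be the first vertex visited to the right of `u`. It is on the side of `u` and is reached from a
neighbor `p` of `u` that is the earliest neighbor of both. If `z` has a neighbor to the right of all
neighbors of `u`, then this is visited after the vertex `u`, whose earliest neighbor is earlier. If
not, then `z` has a smaller neighborhood than `u`. -/
theorem IsSweep.isTwin_of_last {T : V → ℝ} (h : IsSweep G rel pos)
    (hrel : ∀ x y, rel x y → (∀ z, G.Adj x z → G.Adj y z) → IsTwin G x y)
    (hcol : IsTwoColoring G col) (hT : Function.Injective T) (hS : IsStrongOrdering G col T) {u : V}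
    (hu : ∀ y, G.Reachable u y → pos y ≤ pos u)
    (hroot : ∀ z, G.Reachable u z → (col z = col u → T u < T z) →
      (col z ≠ col u → ∀ s, G.Adj u s → T s < T z) → ∃ p, pos p < pos z ∧ G.Adj p z)
    {x : V} (hux : G.Reachable u x) (hcx : col x = col u) (hTx : T u < T x) : IsTwin G x u := by
  by_contra htw
  have hcol2 : ∀ {a b c : V}, col a ≠ col b → col c ≠ col b → col a = col c := by
    intro a b c
    cases col a <;> cases col b <;> cases col c <;> simp
  let Right : Set V := {z | G.Reachable u z ∧ (col z = col u → T u < T z ∧ ¬ IsTwin G z u) ∧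
    (col z ≠ col u → ∀ s, G.Adj u s → T s < T z)}
  obtain ⟨z, hz, hmin⟩ := (InvImage.wf pos Nat.lt_wfRel.wf).has_min Right
    ⟨x, hux, fun _ => ⟨hTx, htw⟩, fun h => absurd hcx h⟩
  obtain ⟨s₀, hs₀⟩ : ∃ s, G.Adj u s :=
    exists_adj_of_reachable hux (by rintro rfl; exact lt_irrefl _ hTx)
  have hmem : ∀ p, G.Reachable u p → pos p < pos z → p ∉ Right := fun p _ hp hp' => hmin p hp' hp
  -- Neighbors of vertices on the right of all neighbors of `u` are to the right of `u`.
  have hB : ∀ q ∈ Right, col q ≠ col u → ∀ p, G.Adj p q → p ∈ Right := by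
    intro q hq hcq p hpq
    have hpc : col p = col u := hcol2 (hcol p q hpq) (Ne.symm hcq)
    have hqs := hq.2.2 hcq
    have hnuq : ¬ G.Adj u q := fun hh => lt_irrefl _ (hqs q hh)
    refine ⟨hq.1.trans hpq.symm.reachable, fun _ => ⟨?_, fun htw => hnuq ((htw q).1 hpq)⟩,
      fun hh => absurd hpc hh⟩
    rcases lt_trichotomy (T u) (T p) with hlt | heq | hgt
    · exact hlt
    · rw [← hT heq] at hpq
      exact absurd hpq hnuq
    · refine absurd (hS p u s₀ q hpc ?_ hgt (hqs s₀ hs₀) hpq hs₀).2 hnuq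
      exact hcol2 (hcol u s₀ hs₀).symm hcq
  obtain ⟨p₁, hp₁, hp₁z⟩ := hroot z hz.1 (fun hc => (hz.2.1 hc).1) hz.2.2
  have hcz : col z = col u := by
    by_contra hcz
    exact hmem p₁ (hz.1.trans hp₁z.symm.reachable) hp₁ (hB z hz hcz p₁ hp₁z)
  obtain ⟨hTz, hztw⟩ := hz.2.1 hcz
  -- Neighbors of `z` that are not to the right of all neighbors of `u` are neighbors of `u`.
  have hN : ∀ q, G.Adj z q → q ∉ Right → G.Adj u q := by
    intro q hzq hq
    have hcq : col q ≠ col u := hcz ▸ (hcol z q hzq).symm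
    have : ∃ s, G.Adj u s ∧ T q ≤ T s := by
      by_contra hcon
      push Not at hcon
      exact hq ⟨hz.1.trans hzq.reachable, fun hh => absurd hh hcq, fun _ => hcon⟩
    obtain ⟨s, hus, hqs⟩ := this
    rcases hqs.eq_or_lt with heq | hlt
    · rwa [hT heq]
    · refine (hS u z q s hcz.symm ?_ hTz hlt hus hzq).1
      exact hcol2 hcq (hcol u s hus).symm
  have hzu : pos z < pos u := by
    refine lt_of_le_of_ne (hu z hz.1) fun heq => ?_
    rw [h.injective heq] at hTz
    exact lt_irrefl _ hTz
  by_cases hfull : ∃ q, G.Adj z q ∧ q ∈ Right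
  · obtain ⟨q, hzq, hq⟩ := hfull
    have hcq : col q ≠ col u := hcz ▸ (hcol z q hzq).symm
    have huq : pos q < pos u := by
      refine lt_of_le_of_ne (hu q hq.1) fun heq => hcq ?_
      rw [h.injective heq]
    have hup₁ : G.Adj u p₁ := hN p₁ hp₁z.symm (hmem p₁ (hz.1.trans hp₁z.symm.reachable) hp₁)
    have hzq' : pos z < pos q := by
      rcases lt_trichotomy (pos z) (pos q) with h1 | h1 | h1
      · exact h1
      · exact absurd hzq (by rw [h.injective h1]; exact G.loopless.irrefl q)
      · exact absurd hq (hmem q hq.1 h1)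
    obtain ⟨w, hw, hwq⟩ := h.le q u huq p₁ (by omega) hup₁.symm
    exact hmem w (hq.1.trans hwq.symm.reachable) (by omega) (hB q hq hcq w hwq)
  · push Not at hfull
    have := h.pos_lt_of_subset hrel (fun q hq => hN q hq (hfull q hq)) hztw
    omega

/-- The last vertex of a component in a sweep that prefers large neighborhoods is, up to twins, the
first or the last vertex of its side in a strong ordering of the component. -/
theorem IsSweep.isTwin_or_isTwin_of_last {T : V → ℝ} (h : IsSweep G rel pos)
    (hrel : ∀ x y, rel x y → (∀ z, G.Adj x z → G.Adj y z) → IsTwin G x y)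
    (hcol : IsTwoColoring G col) (hT : Function.Injective T) (hS : IsStrongOrdering G col T) {u : V}
    (hu : ∀ y, G.Reachable u y → pos y ≤ pos u) :
    (∀ x, G.Reachable u x → col x = col u → T u < T x → IsTwin G x u) ∨
      ∀ x, G.Reachable u x → col x = col u → T x < T u → IsTwin G x u := by
  obtain ⟨v, hvu, hv, hv'⟩ := h.exists_root u
  have hex : ∀ z, G.Reachable u z → z ≠ v → ∃ p, pos p < pos z ∧ G.Adj p z := by
    intro z hz hne
    by_contra hcon
    push Not at hcon
    exact hne (hv' z (hvu.trans hz) hcon)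
  by_cases hright : (col v = col u → T u < T v) ∧ (col v ≠ col u → ∀ s, G.Adj u s → T s < T v)
  · right
    intro x hux hcx hTx
    refine h.isTwin_of_last hrel hcol (neg_injective.comp hT) hS.neg hu ?_ hux hcx
      (neg_lt_neg hTx)
    intro z hz h1 h2
    refine hex z hz ?_
    rintro rfl
    by_cases hc : col z = col u
    · have h3 : -T u < -T z := h1 hc
      have := hright.1 hc
      linarith
    · obtain ⟨s, hs⟩ := exists_adj_of_reachable hux (by rintro rfl; exact lt_irrefl _ hTx)
      have h3 : -T s < -T z := h2 hc s hs
      have := hright.2 hc s hs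
      linarith
  · left
    intro x hux hcx hTx
    refine h.isTwin_of_last hrel hcol hT hS hu ?_ hux hcx hTx
    intro z hz h1 h2
    refine hex z hz ?_
    rintro rfl
    exact hright ⟨h1, h2⟩

/-- A sweep that starts a component at the first vertex `u` of a strong ordering, and that prefers
small neighborhoods, visits each side of the component in the strong ordering, up to twins. -/
theorem IsSweep.pos_lt_of_root {T : V → ℝ} (h : IsSweep G rel pos)
    (hrel : ∀ x y, rel x y → (∀ z, G.Adj y z → G.Adj x z) → IsTwin G x y)
    (hcol : IsTwoColoring G col) (hT : Function.Injective T) (hS : IsStrongOrdering G col T) {u : V}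
    (hroot : ∀ y, G.Reachable u y → (∀ z, pos z < pos y → ¬ G.Adj z y) → y = u)
    (hu : ∀ x, G.Reachable u x → col x = col u → T x < T u → IsTwin G x u) {x y : V}
    (hx : G.Reachable u x) (hy : G.Reachable u y) (hc : col x = col y) (hxy : T x < T y)
    (htw : ¬ IsTwin G x y) : pos x < pos y := by
  have hcol2 : ∀ {a b c : V}, col a ≠ col b → col c ≠ col b → col a = col c := by
    intro a b c
    cases col a <;> cases col b <;> cases col c <;> simp
  induction hn : pos y using Nat.strong_induction_on generalizing x y with
  | _ n ih =>
    subst hn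
    by_contra hlt
    have hlt : pos y < pos x := by
      refine lt_of_le_of_ne (not_lt.1 hlt) fun heq => ?_
      rw [h.injective heq] at hxy
      exact lt_irrefl _ hxy
    have hyu : y ≠ u := by
      rintro rfl
      exact htw (hu x hx hc hxy)
    -- The earliest neighbor of `y`.
    obtain ⟨p, ⟨hpy, hpadj⟩, hpmin⟩ :=
      (InvImage.wf pos Nat.lt_wfRel.wf).has_min {p | pos p < pos y ∧ G.Adj p y} (by
        by_contra hcon
        rw [Set.not_nonempty_iff_eq_empty, Set.eq_empty_iff_forall_notMem] at hcon
        exact hyu (hroot y hy fun z hz hzy => hcon z ⟨hz, hzy⟩))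
    have hpmin : ∀ z, G.Adj z y → pos p ≤ pos z := by
      intro z hz
      by_contra hlt'
      exact hpmin z ⟨by omega, hz⟩ (not_le.1 hlt')
    have hpu : G.Reachable u p := hy.trans hpadj.symm.reachable
    -- Neighbors of `x` before `p` in the strong ordering contradict the choice of `p`.
    have key : ∀ q, G.Adj q x → T q < T p → ¬ IsTwin G q p → False := by
      intro q hq hqp hqtw
      have hqc : col q = col p := hcol2 (hcol q x hq) (hc ▸ hcol p y hpadj)
      have hqpos := ih (pos p) hpy (hx.trans hq.symm.reachable) hpu hqc hqp hqtw rfl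
      obtain ⟨z, hz, hzy⟩ := h.le y x hlt q (by omega) hq
      have := hpmin z hzy
      omega
    by_cases hpx : G.Adj p x
    · have hsub : ∀ z, G.Adj x z → G.Adj y z := by
        intro q hxq
        by_contra hyq
        have hqc : col p = col q := hcol2 (hc ▸ hcol p y hpadj) (hcol x q hxq).symm
        rcases lt_trichotomy (T q) (T p) with h' | h' | h'
        · exact key q hxq.symm h' fun ht => hyq ((ht y).2 hpadj).symm
        · rw [hT h'] at hyq
          exact hyq hpadj.symm
        · exact hyq (hS x y p q hc hqc hxy h' hxq hpadj.symm).2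
      have hr := h.tie y x hlt fun z hz hzy => ⟨p, hpmin z hzy, hpx⟩
      exact htw fun z => (hrel y x hr hsub z).symm
    · obtain ⟨q, hxq⟩ := exists_adj_of_reachable (hx.symm.trans hy)
        (by rintro rfl; exact lt_irrefl _ hxy)
      have hqc : col p = col q := hcol2 (hc ▸ hcol p y hpadj) (hcol x q hxq).symm
      rcases lt_trichotomy (T q) (T p) with h' | h' | h'
      · exact key q hxq.symm h' fun ht => hpx ((ht x).1 hxq.symm)
      · rw [hT h'] at hxq
        exact hpx hxq.symm
      · exact hpx (hS x y p q hc hqc hxy h' hxq hpadj.symm).1.symm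

/-- Two sweeps, of which the first prefers large neighborhoods and the second breaks ties by the
reversed order of the first, produce a strong ordering. -/
theorem IsSweep.isStrongOrdering (hG : IsPermutationGraph G) (hcol : IsTwoColoring G col)
    (h : IsSweep G rel pos)
    (hrel : ∀ x y, rel x y → (∀ z, G.Adj x z → G.Adj y z) → IsTwin G x y)
    (h' : IsSweep G rel' pos') (hrel' : ∀ x y, rel' x y → pos y < pos x) :
    IsStrongOrdering G col pos' := by
  obtain ⟨T, hT, hS⟩ := hG.exists_isStrongOrdering hcol
  have hrel'' : ∀ x y, rel' x y → (∀ z, G.Adj y z → G.Adj x z) → IsTwin G x y := by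
    intro x y hxy hsub
    by_contra htw
    have := h.pos_lt_of_subset hrel hsub fun ht => htw fun z => (ht z).symm
    have := hrel' x y hxy
    omega
  intro a a' b b' hca hcb hpa hpb hab' ha'b
  by_cases hreach : G.Reachable a a'
  · obtain ⟨u, hua, hu, hu'⟩ := h'.exists_root a
    have hua' := hua.trans hreach
    have hub' := hua.trans hab'.reachable
    have hub := hua'.trans ha'b.reachable
    have hlast : ∀ y, G.Reachable u y → pos y ≤ pos u := by
      intro y hy
      rcases (h'.pos_le_of_reachable hu hy).eq_or_lt with heq | hlt
      · rw [h'.injective heq]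
      · exact (hrel' u y (h'.tie u y hlt fun z hz hzu => absurd hzu (hu z hz))).le
    -- Orient the strong ordering so that `u` comes first.
    obtain ⟨T, hT, hS, hfirst⟩ : ∃ T : V → ℝ, Function.Injective T ∧ IsStrongOrdering G col T ∧
        ∀ x, G.Reachable u x → col x = col u → T x < T u → IsTwin G x u := by
      rcases h.isTwin_or_isTwin_of_last hrel hcol hT hS hlast with hh | hh
      · exact ⟨fun x => -T x, neg_injective.comp hT, hS.neg,
          fun x hx hc hlt => hh x hx hc (neg_lt_neg_iff.1 hlt)⟩
      · exact ⟨T, hT, hS, hh⟩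
    have key : ∀ x y, G.Reachable u x → G.Reachable u y → col x = col y → pos' x < pos' y →
        T x < T y ∨ IsTwin G x y := by
      intro x y hx hy hc hxy
      by_contra hcon
      push Not at hcon
      have hlt : T y < T x := by
        refine lt_of_le_of_ne hcon.1 fun heq => ?_
        rw [hT heq] at hxy
        exact lt_irrefl _ hxy
      have := h'.pos_lt_of_root hrel'' hcol hT hS hu' hfirst hy hx hc.symm hlt
        fun ht => hcon.2 fun z => (ht z).symm
      omega
    rcases key a a' hua hua' hca hpa with h1 | h1
    · rcases key b b' hub hub' hcb hpb with h2 | h2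
      · exact hS a a' b b' hca hcb h1 h2 hab' ha'b
      · exact ⟨((h2 a).2 hab'.symm).symm, ((h2 a').1 ha'b.symm).symm⟩
    · exact ⟨(h1 b).2 ha'b, (h1 b').1 hab'⟩
  · exfalso
    obtain ⟨u, hua, hu, -⟩ := h'.exists_root a
    obtain ⟨u', hua', hu', -⟩ := h'.exists_root a'
    rcases lt_trichotomy (pos' u) (pos' u') with hlt | heq | hlt
    · have h1 := h'.pos_lt_of_reachable hu' hlt (hua.trans hab'.reachable)
      have h2 := h'.pos_le_of_reachable hu' (hua'.trans ha'b.reachable)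
      omega
    · rw [h'.injective heq] at hua
      exact hreach (hua.symm.trans hua')
    · have h1 := h'.pos_lt_of_reachable hu hlt hua'
      have h2 := h'.pos_le_of_reachable hu hua
      omega

end Ordering

/-! ### Strong edge colorings of strongly ordered bipartite graphs -/

section Layout

variable {V : Type*} {G : SimpleGraph V} {col : V → Bool} {pos : V → ℕ} {l d : ℕ → ℕ}

/-- The number of columns, that is, vertices of color `true`, before `w`. -/
noncomputable def columnRank (col : V → Bool) (pos : V → ℕ) (w : V) : ℕ :=
  {v | col v = true ∧ pos v < pos w}.ncard

/-- The staircase with rows `[l k, l k + d k)` describes the graph `G`: the row at position `k`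
belongs to the vertex of color `false` at position `k` of a strong ordering, `l k` is the rank of
its first neighbor, and `d k` is the number of its neighbors. Isolated vertices have color
`false`, so that every column contains a cell. -/
structure IsLayout (G : SimpleGraph V) (col : V → Bool) (pos : V → ℕ) (l d : ℕ → ℕ) : Prop where
  coloring : IsTwoColoring G col
  injective : Function.Injective pos
  strong : IsStrongOrdering G col pos
  exists_adj : ∀ v, col v = true → ∃ w, G.Adj v w
  length : ∀ v, col v = false → d (pos v) = (G.neighborSet v).ncard
  length_eq_zero : ∀ k, (∀ v, col v = false → pos v ≠ k) → d k = 0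
  left : ∀ v, col v = false → (G.neighborSet v).Nonempty →
    IsLeast (columnRank col pos '' G.neighborSet v) (l (pos v))

theorem IsLayout.col_eq_true (h : IsLayout G col pos l d) {a b : V} (ha : col a = false)
    (hab : G.Adj a b) : col b = true := by
  have := h.coloring a b hab
  rw [ha] at this
  simpa using this.symm

theorem IsLayout.exists_row (h : IsLayout G col pos l d) {k : ℕ} (hk : 0 < d k) :
    ∃ a, col a = false ∧ pos a = k := by
  by_contra hcon
  push Not at hcon
  have := h.length_eq_zero k hcon
  omega

/-- The neighborhood of a row is an interval of columns. -/
theorem IsLayout.adj_of_between (h : IsLayout G col pos l d) {a b b' b'' : V}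
    (ha : col a = false) (hb' : col b' = true)
    (h1 : pos b < pos b') (h2 : pos b' < pos b'') (hab : G.Adj a b) (hab'' : G.Adj a b'') :
    G.Adj a b' := by
  obtain ⟨a', ha'⟩ := h.exists_adj b' hb'
  have hca' : col a' = col a := by
    have := h.coloring b' a' ha'
    rw [hb'] at this
    rw [ha]
    simpa using this.symm
  have hb := h.col_eq_true ha hab
  have hb'' := h.col_eq_true ha hab''
  rcases lt_trichotomy (pos a') (pos a) with hlt | heq | hlt
  · exact (h.strong a' a b b' hca' (by rw [hb, hb']) hlt h1 ha'.symm hab).2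
  · rw [← h.injective heq]; exact ha'.symm
  · exact (h.strong a a' b' b'' hca'.symm (by rw [hb', hb'']) hlt h2 hab'' ha'.symm).1

variable [Finite V]

theorem columnRank_lt {w w' : V} (hw : col w = true) (h : pos w < pos w') :
    columnRank col pos w < columnRank col pos w' := by
  refine Set.ncard_lt_ncard ⟨fun v hv => ⟨hv.1, hv.2.trans h⟩, fun hsub => ?_⟩ (Set.toFinite _)
  exact lt_irrefl _ (hsub (show w ∈ _ from ⟨hw, h⟩)).2

theorem columnRank_lt_iff (hpos : Function.Injective pos) {w w' : V} (hw : col w = true)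
    (hw' : col w' = true) : columnRank col pos w < columnRank col pos w' ↔ pos w < pos w' := by
  refine ⟨fun h => ?_, columnRank_lt hw⟩
  rcases lt_trichotomy (pos w) (pos w') with h' | h' | h'
  · exact h'
  · rw [hpos h'] at h; exact absurd h (lt_irrefl _)
  · exact absurd (columnRank_lt hw' h') h.not_gt

theorem columnRank_injOn (hpos : Function.Injective pos) :
    Set.InjOn (columnRank col pos) {w | col w = true} := by
  intro w hw w' hw' h
  rcases lt_trichotomy (pos w) (pos w') with h' | h' | h'
  · exact absurd h (columnRank_lt hw h').ne
  · exact hpos h'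
  · exact absurd h (columnRank_lt hw' h').ne'

theorem exists_columnRank_eq (hpos : Function.Injective pos) {w : V} {j : ℕ}
    (hj : j ≤ columnRank col pos w) (hw : col w = true) : ∃ v, col v = true ∧
    columnRank col pos v = j := by
  have hsub : columnRank col pos '' {v | col v = true} ⊆ Set.Iio {v | col v = true}.ncard := by
    rintro _ ⟨v, hv, rfl⟩
    refine Set.ncard_lt_ncard ⟨fun v hv => hv.1, fun hsub => ?_⟩ (Set.toFinite _)
    exact lt_irrefl _ (hsub hv).2
  have heq := Set.eq_of_subset_of_ncard_le hsub (by
    rw [(columnRank_injOn hpos).ncard_image, ← Finset.coe_Iio, Set.ncard_coe_finset]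
    simp) (Set.finite_Iio _)
  have : j ∈ Set.Iio {v | col v = true}.ncard :=
    lt_of_le_of_lt hj (hsub ⟨w, hw, rfl⟩)
  rw [← heq] at this
  exact this

namespace IsLayout

variable (h : IsLayout G col pos l d)
include h

theorem image_columnRank {a : V} (ha : col a = false) :
    columnRank col pos '' G.neighborSet a = Set.Ico (l (pos a)) (l (pos a) + d (pos a)) := by
  rcases (G.neighborSet a).eq_empty_or_nonempty with he | hne
  · rw [h.length a ha, he]; simp
  set S := columnRank col pos '' G.neighborSet a with hS
  have hleast := h.left a ha hne
  obtain ⟨r, hr, hmax⟩ := Set.exists_max_image S id (Set.toFinite _) (hne.image _)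
  have hconv : S = Set.Icc (l (pos a)) r := by
    refine Set.Subset.antisymm (fun j hj => ⟨hleast.2 hj, hmax j hj⟩) fun j hj => ?_
    obtain ⟨b, hb, hbl⟩ := hleast.1
    obtain ⟨b'', hb'', hbr⟩ := hr
    obtain ⟨b', hb', rfl⟩ := exists_columnRank_eq h.injective (hj.2.trans hbr.ge)
      (h.col_eq_true ha hb'')
    rcases hj.1.eq_or_lt with heq | hlt
    · exact ⟨b, hb, hbl.trans heq⟩
    rcases hj.2.eq_or_lt with heq | hlt'
    · exact ⟨b'', hb'', hbr.trans heq.symm⟩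
    rw [← hbl, columnRank_lt_iff h.injective (h.col_eq_true ha hb) hb'] at hlt
    rw [← hbr, columnRank_lt_iff h.injective hb' (h.col_eq_true ha hb'')] at hlt'
    exact ⟨b', h.adj_of_between ha hb' hlt hlt' hb hb'', rfl⟩
  have hcard : S.ncard = d (pos a) := by
    rw [h.length a ha, hS]
    exact ((columnRank_injOn h.injective).mono fun b hb => h.col_eq_true ha hb).ncard_image
  have hlr : l (pos a) ≤ r := hmax _ hleast.1
  rw [hconv, ← Finset.coe_Icc, Set.ncard_coe_finset, Nat.card_Icc] at hcard
  rw [hconv]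
  ext j
  simp only [Set.mem_Icc, Set.mem_Ico]
  omega

theorem adj_iff {a b : V} (ha : col a = false) (hb : col b = true) :
    G.Adj a b ↔ l (pos a) ≤ columnRank col pos b ∧
      columnRank col pos b < l (pos a) + d (pos a) := by
  rw [← Set.mem_Ico, ← h.image_columnRank ha]
  refine ⟨fun hab => ⟨b, hab, rfl⟩, ?_⟩
  rintro ⟨b', hb', heq⟩
  rwa [← columnRank_injOn h.injective (h.col_eq_true ha hb') hb heq]

theorem exists_column {a : V} (ha : col a = false) {j : ℕ} (h1 : l (pos a) ≤ j)
    (h2 : j < l (pos a) + d (pos a)) :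
    ∃ b, col b = true ∧ G.Adj a b ∧ columnRank col pos b = j := by
  have : j ∈ Set.Ico (l (pos a)) (l (pos a) + d (pos a)) := ⟨h1, h2⟩
  rw [← h.image_columnRank ha] at this
  obtain ⟨b, hab, hj⟩ := this
  exact ⟨b, h.col_eq_true ha hab, hab, hj⟩

theorem isMono : Staircase.IsMono l d := by
  intro k k' hk hd hd'
  obtain ⟨a, ha, rfl⟩ := h.exists_row hd
  obtain ⟨a', ha', rfl⟩ := h.exists_row hd'
  have hcross : ∀ b b', col b = true → col b' = true →
      columnRank col pos b < columnRank col pos b' → G.Adj a b' → G.Adj a' b →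
      G.Adj a b ∧ G.Adj a' b' := by
    intro b b' hb hb' hlt h1 h2
    rw [columnRank_lt_iff h.injective hb hb'] at hlt
    exact h.strong a a' b b' (by rw [ha, ha']) (by rw [hb, hb']) hk hlt h1 h2
  constructor
  · by_contra hlt
    obtain ⟨b, hb, hab, hbl⟩ := h.exists_column ha le_rfl (by omega)
    obtain ⟨b', hb', hab', hbl'⟩ := h.exists_column ha' le_rfl (by omega)
    have := ((h.adj_iff ha hb').1 (hcross b' b hb' hb (by omega) hab hab').1).1
    omega
  · by_contra hlt
    obtain ⟨b, hb, hab, hbl⟩ := h.exists_column ha (j := l (pos a) + d (pos a) - 1) (by omega)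
      (by omega)
    obtain ⟨b', hb', hab', hbl'⟩ := h.exists_column ha' le_rfl (by omega)
    have := ((h.adj_iff ha' hb).1 (hcross b' b hb' hb (by omega) hab hab').2).2
    omega

/-- The strong chromatic index is the result of the dynamic program. Edges are the cells of the
staircase, and two edges may have the same color if and only if their cells are comparable in a
strict partial order, to which Dilworth's theorem applies. -/
theorem strongChromaticIndex_eq_best {n : ℕ} (hn : ∀ v, pos v < n) :
    strongChromaticIndex G = Staircase.best l d n := by
  classical
  have hmono := h.isMono
  have hedge : ∀ e : G.edgeSet, ∃ a b, col a = false ∧ col b = true ∧ G.Adj a b ∧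
      e.1 = s(a, b) := by
    rintro ⟨e, he⟩
    induction e using Sym2.ind with
    | _ x y =>
      have hxy : G.Adj x y := he
      rcases hx : col x with _ | _
      · exact ⟨x, y, hx, h.col_eq_true hx hxy, hxy, rfl⟩
      · have hy : col y = false := by
          have := h.coloring x y hxy
          rw [hx] at this
          simpa using this.symm
        exact ⟨y, x, hy, hx, hxy.symm, Sym2.eq_swap⟩
  choose a b ha hb hab heq using hedge
  set rk := columnRank col pos with hrk
  have hadj : ∀ {x y}, col x = false → col y = true →
      (G.Adj x y ↔ l (pos x) ≤ rk y ∧ rk y < l (pos x) + d (pos x)) := h.adj_iff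
  let cell : G.edgeSet → ℕ × ℕ := fun e => (pos (a e), rk (b e))
  have hcell : ∀ e, Staircase.IsCell l d (cell e) := fun e => (hadj (ha e) (hb e)).1 (hab e)
  have hinj : Function.Injective cell := by
    intro e f hef
    simp only [cell, Prod.mk.injEq] at hef
    apply Subtype.ext
    rw [heq e, heq f, h.injective hef.1, columnRank_injOn h.injective (hb e) (hb f) hef.2]
  have hsurj : ∀ c, Staircase.IsCell l d c → ∃ e, cell e = c := by
    rintro ⟨k, j⟩ hc
    obtain ⟨x, hx, hxk⟩ := h.exists_row hc.pos
    simp only at hxk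
    subst hxk
    obtain ⟨y, hy, hxy, rfl⟩ := h.exists_column hx hc.1 hc.2
    refine ⟨⟨s(x, y), hxy⟩, ?_⟩
    have := heq ⟨s(x, y), hxy⟩
    simp only [Sym2.eq_iff] at this
    rcases this with ⟨h1, h2⟩ | ⟨h1, h2⟩
    · simp only [cell]; rw [← h1, ← h2]
    · rw [h1, hb] at hx; cases hx
  -- The edge `e` may be followed by the edge `f` in a chain.
  let lt : G.edgeSet → G.edgeSet → Prop := fun e f =>
    pos (a e) < pos (a f) ∧ l (pos (a e)) + d (pos (a e)) ≤ rk (b f) ∧ rk (b e) < l (pos (a f))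
  have hcompat : ∀ e f, lt e f ∨ lt f e ↔
      ∀ x ∈ e.1, ∀ y ∈ f.1, x ≠ y ∧ ¬ G.Adj x y := by
    have hlt : ∀ e f, lt e f → ∀ x ∈ e.1, ∀ y ∈ f.1, x ≠ y ∧ ¬ G.Adj x y := by
      intro e f ⟨h1, h2, h3⟩ x hx y hy
      have hce := hcell e
      simp only [Staircase.IsCell, cell] at hce
      have hne : ∀ {x y : V}, col x = false → col y = true → x ≠ y := by
        rintro x y h4 h5 rfl
        rw [h4] at h5; cases h5
      have hsame : ∀ {x y : V}, col x = col y → ¬ G.Adj x y := fun h4 h5 => h.coloring _ _ h5 h4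
      have hab1 : ¬ G.Adj (a e) (b f) := by
        rw [hadj (ha e) (hb f)]; omega
      have hab2 : ¬ G.Adj (a f) (b e) := by
        rw [hadj (ha f) (hb e)]; omega
      rw [heq e, Sym2.mem_iff] at hx
      rw [heq f, Sym2.mem_iff] at hy
      rcases hx with rfl | rfl <;> rcases hy with rfl | rfl
      · exact ⟨fun hh => by rw [hh] at h1; exact lt_irrefl _ h1, hsame (by rw [ha, ha])⟩
      · exact ⟨hne (ha e) (hb f), hab1⟩
      · exact ⟨(hne (ha f) (hb e)).symm, fun hh => hab2 hh.symm⟩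
      · exact ⟨fun hh => by rw [← hh] at h2; omega, hsame (by rw [hb, hb])⟩
    have hgt : ∀ e f, pos (a e) < pos (a f) → ¬ G.Adj (a e) (b f) → ¬ G.Adj (a f) (b e) →
        lt e f := by
      intro e f h1 h2 h3
      have hce := hcell e
      have hcf := hcell f
      have := hmono _ _ h1 hce.pos hcf.pos
      simp only [Staircase.IsCell, cell] at hce hcf
      rw [hadj (ha e) (hb f)] at h2
      rw [hadj (ha f) (hb e)] at h3
      exact ⟨h1, by omega, by omega⟩
    intro e f
    constructor
    · rintro (hh | hh)
      · exact hlt e f hh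
      · exact fun x hx y hy => ⟨(hlt f e hh y hy x hx).1.symm,
          fun hxy => (hlt f e hh y hy x hx).2 hxy.symm⟩
    · intro hh
      have hae : a e ∈ e.1 := by rw [heq e]; simp
      have hbe : b e ∈ e.1 := by rw [heq e]; simp
      have haf : a f ∈ f.1 := by rw [heq f]; simp
      have hbf : b f ∈ f.1 := by rw [heq f]; simp
      have h1 := (hh _ hae _ hbf).2
      have h2 := (hh _ hbe _ haf).2
      rcases lt_trichotomy (pos (a e)) (pos (a f)) with h3 | h3 | h3
      · exact Or.inl (hgt e f h3 h1 fun h4 => h2 h4.symm)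
      · exact absurd (h.injective h3) (hh _ hae _ haf).1
      · exact Or.inr (hgt f e h3 (fun h4 => h2 h4.symm) h1)
  have hclique : ∀ X : Finset G.edgeSet, (∀ e ∈ X, ∀ f ∈ X, ¬ lt e f) →
      X.card ≤ Staircase.best l d n := by
    intro X hX
    rw [← Finset.card_image_of_injective X hinj]
    refine Staircase.IsClique.card_le_best hmono ⟨?_, ?_⟩ ?_
    · intro c hc
      obtain ⟨e, -, rfl⟩ := Finset.mem_image.1 hc
      exact hcell e
    · intro c hc c' hc' hlt
      obtain ⟨e, he, rfl⟩ := Finset.mem_image.1 hc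
      obtain ⟨f, hf, rfl⟩ := Finset.mem_image.1 hc'
      by_contra hcon
      push Not at hcon
      exact hX e he f hf ⟨hlt, hcon.1, hcon.2⟩
    · intro c hc
      obtain ⟨e, -, rfl⟩ := Finset.mem_image.1 hc
      exact hn _
  refine le_antisymm (Nat.sInf_le ?_) (le_csInf ?_ ?_)
  · obtain ⟨c, hc⟩ := exists_chain_coloring_of_antichain_card_le lt
      (fun e f g hef hfg => by
        have := (hcell f).1
        have := (hcell f).2
        simp only [cell, lt] at *
        have := hmono (pos (a e)) (pos (a f)) hef.1 (hcell e).pos (hcell f).pos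
        have := hmono (pos (a f)) (pos (a g)) hfg.1 (hcell f).pos (hcell g).pos
        exact ⟨by omega, by omega, by omega⟩)
      (fun e he => lt_irrefl _ he.1) (Staircase.best l d n) hclique
    refine ⟨c, fun i => ⟨?_, ?_⟩⟩
    · rintro _ ⟨e, -, rfl⟩
      exact e.2
    · rintro _ ⟨e, he, rfl⟩ _ ⟨f, hf, rfl⟩ hne
      exact (hcompat e f).1 (hc e f (he.trans hf.symm) fun hh => hne (by rw [hh]))
  · have := Fintype.ofFinite G.edgeSet
    refine ⟨_, Fintype.equivFin G.edgeSet, fun i => ⟨?_, ?_⟩⟩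
    · rintro _ ⟨e, -, rfl⟩
      exact e.2
    · rintro _ ⟨e, he, rfl⟩ _ ⟨f, hf, rfl⟩ hne
      exact absurd (by rw [(Fintype.equivFin G.edgeSet).injective (he.trans hf.symm)]) hne
  · rintro k ⟨c, hc⟩
    obtain ⟨X, hX, -, hcard⟩ := Staircase.exists_isClique_card_eq_best hmono n
    have hchoose : ∀ x : X, ∃ e, cell e = x.1 := fun x => hsurj x.1 (hX.1 x.1 x.2)
    choose g hg using hchoose
    have hginj : Function.Injective fun x => c (g x) := by
      intro x y hxy
      by_contra hne
      have hgne : g x ≠ g y := fun hh => hne (Subtype.ext (by rw [← hg x, ← hg y, hh]))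
      have := (hcompat (g x) (g y)).2 fun u hu v hv => (hc (c (g x))).2 _ ⟨g x, rfl, rfl⟩ _
        ⟨g y, hxy.symm, rfl⟩ (fun hh => hgne (Subtype.ext hh)) u hu v hv
      have key : ∀ x y : X, ¬ lt (g x) (g y) := by
        rintro x y ⟨h1, h2, h3⟩
        have := hX.2 x.1 x.2 y.1 y.2
        rw [← hg x, ← hg y] at this
        have := this h1
        simp only [cell] at this
        omega
      rcases this with hh | hh
      · exact key x y hh
      · exact key y x hh
    have := Fintype.card_le_of_injective _ hginj
    rwa [Fintype.card_coe, Fintype.card_fin, hcard] at this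

end IsLayout

end Layout

/-! ### The input and elementary loops -/

namespace Ram

attribute [simp] Expr.Ok Expr.eval Test.Ok Test.Holds Prog.NoVar Prog.NoArr

variable {n : ℕ} (adj : Fin n → List (Fin n))

/-- The length of the adjacency list of vertex `k`. -/
def listLen (k : ℕ) : ℕ := if h : k < n then (adj ⟨k, h⟩).length else 0

/-- The position of the adjacency list of vertex `k` in the input: the cell there contains the
length of the list, and the following cells contain the list. -/
def listStart (k : ℕ) : ℕ := 1 + ∑ i ∈ Finset.range k, (listLen adj i + 1)

variable {adj}

@[simp] theorem listLen_coe (v : Fin n) : listLen adj v = (adj v).length := by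
  simp [listLen]

theorem listStart_succ (k : ℕ) : listStart adj (k + 1) = listStart adj k + listLen adj k + 1 := by
  rw [listStart, listStart, Finset.sum_range_succ]; omega

theorem listStart_mono {j k : ℕ} (h : j ≤ k) : listStart adj j ≤ listStart adj k := by
  induction k, h using Nat.le_induction with
  | base => exact le_rfl
  | succ k _ ih => rw [listStart_succ]; omega

theorem listStart_pos (k : ℕ) : 0 < listStart adj k := by rw [listStart]; omega

theorem listStart_add_le (v : Fin n) :
    listStart adj v + (adj v).length + 1 ≤ listStart adj n := by
  have := listStart_mono (adj := adj) (show v.1 + 1 ≤ n from v.2)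
  rwa [listStart_succ, listLen_coe] at this

theorem eq_of_listStart_add_eq {v w : Fin n} {s t : ℕ} (hs : s ≤ (adj v).length)
    (ht : t ≤ (adj w).length) (h : listStart adj v + s = listStart adj w + t) : v = w := by
  have key : ∀ {v w : Fin n} {s t : ℕ}, s ≤ (adj v).length → t ≤ (adj w).length →
      listStart adj v + s = listStart adj w + t → v.1 < w.1 → False := by
    intro v w s t hs ht h hlt
    have := listStart_mono (adj := adj) (show v.1 + 1 ≤ w from hlt)
    rw [listStart_succ, listLen_coe] at this
    omega
  rcases lt_trichotomy v.1 w.1 with h' | h' | h'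
  · exact (key hs ht h h').elim
  · exact Fin.ext h'
  · exact (key ht hs h.symm h').elim

theorem encodeAdjacencyLists_eq_append (k : ℕ) (hk : k ≤ n) :
    ∃ pre : List ℕ, pre.length = listStart adj k ∧ encodeAdjacencyLists adj =
      pre ++ ((List.finRange n).drop k).flatMap
        fun v => (adj v).length :: (adj v).map (fun w : Fin n => (w : ℕ)) := by
  induction k with
  | zero => exact ⟨[n], by simp [listStart], by simp [encodeAdjacencyLists]⟩
  | succ k ih =>
    obtain ⟨pre, hpre, heq⟩ := ih (by omega)
    have hk' : k < (List.finRange n).length := by simpa using hk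
    rw [List.drop_eq_getElem_cons hk', List.flatMap_cons, ← List.append_assoc] at heq
    refine ⟨_, ?_, heq⟩
    rw [List.length_append, hpre, listStart_succ, listLen, dif_pos (by omega)]
    simp
    omega

theorem encodeAdjacencyLists_getD (v : Fin n) (t : ℕ) (ht : t ≤ (adj v).length) :
    (encodeAdjacencyLists adj).getD (listStart adj v + t) 0 =
      ((adj v).length :: (adj v).map (fun w : Fin n => (w : ℕ))).getD t 0 := by
  obtain ⟨pre, hpre, heq⟩ := encodeAdjacencyLists_eq_append (adj := adj) v v.2.le
  rw [heq, List.getD_append_right _ _ _ _ (by omega), hpre, Nat.add_sub_cancel_left,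
    List.drop_eq_getElem_cons (by simp), List.flatMap_cons, List.getD_append]
  · simp
  · simp; omega

/-- The cells `0, 1, …` of the array `a` contain the list `L`. -/
def Holds (σ : State) (a : ℕ) (L : List (Fin n)) : Prop :=
  ∀ i (h : i < L.length), σ.arr a i = (L[i] : ℕ)

variable (adj) in
/-- The state after reading the input: variable `1` contains the number of vertices, array `0` the
input, and array `1` the positions of the adjacency lists. -/
structure Env (σ : State) : Prop where
  size : σ.var 1 = n
  start : ∀ v : Fin n, σ.arr 1 v = listStart adj v
  length : ∀ v : Fin n, σ.arr 0 (listStart adj v) = (adj v).length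
  nbr : ∀ (v : Fin n) (t : ℕ) (h : t < (adj v).length),
    σ.arr 0 (listStart adj v + 1 + t) = ((adj v)[t] : ℕ)

theorem Env.of_same {p : Prog} {σ τ : State} (h : Env adj σ) (hs : Same p σ τ) (h1 : p.NoVar 1)
    (h2 : p.NoArr 0) (h3 : p.NoArr 1) : Env adj τ := by
  refine ⟨?_, ?_, ?_, ?_⟩
  · rw [hs.1 1 h1, h.size]
  · rw [hs.2 1 h3]; exact h.start
  · rw [hs.2 0 h2]; exact h.length
  · rw [hs.2 0 h2]; exact h.nbr

/-- Execute `body` with variable `7` going through the cells of array `a` at the positions of the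
adjacency list of the vertex in variable `x`. -/
def Prog.forBlock (a x : ℕ) (body : Prog) : Prog :=
  .seq (.assign 5 (.arr 1 (.var x)))
    (.seq (.assign 6 (.add (.var 5) (.arr 0 (.var 5))))
      (.while (.lt (.var 5) (.var 6))
        (.seq (.assign 5 (.add (.var 5) (.const 1))) (.seq (.assign 7 (.arr a (.var 5))) body))))

@[simp] theorem Prog.noVar_forBlock {a x z : ℕ} {body : Prog} :
    (Prog.forBlock a x body).NoVar z ↔ z ≠ 5 ∧ z ≠ 6 ∧ z ≠ 7 ∧ body.NoVar z := by
  simp only [Prog.forBlock, Prog.NoVar]; tauto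

@[simp] theorem Prog.noArr_forBlock {a x b : ℕ} {body : Prog} :
    (Prog.forBlock a x body).NoArr b ↔ body.NoArr b := by
  simp [Prog.forBlock, Prog.NoArr]

theorem forBlock_rule {V a x : ℕ} {body : Prog} {σ : State} (hE : Env adj σ)
    (hV : listStart adj n ≤ V) (v : Fin n) (hx : σ.var x = v) (L : List (Fin n))
    (hL : L.length = (adj v).length)
    (hread : ∀ t (h : t < L.length), σ.arr a (listStart adj v + 1 + t) = (L[t] : ℕ))
    (h5 : body.NoVar 5) (h6 : body.NoVar 6) (ha : body.NoArr a) (Inv : ℕ → State → Prop)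
    (h0 : Inv 0 σ)
    (hset : ∀ t σ' y z, y = 5 ∨ y = 6 ∨ y = 7 → Inv t σ' → Inv t (σ'.setVar y z))
    (hstep : ∀ t (h : t < L.length) σ', Inv t σ' → σ'.var 7 = (L[t] : ℕ) →
      Same (Prog.forBlock a x body) σ σ' → Tri V body σ' fun k τ => k = 0 ∧ Inv (t + 1) τ) :
    Tri V (Prog.forBlock a x body) σ fun k τ => k = L.length ∧ Inv L.length τ := by
  have hle := listStart_add_le (adj := adj) v
  simp only [Prog.forBlock, tri_seq, tri_assign, Expr.Ok, Expr.eval, State.setVar_arr,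
    State.setVar_var, hx, hE.start, hE.length, if_true, true_and]
  refine ⟨Or.inr (by omega), ?_⟩
  set σ₀ := (σ.setVar 5 (listStart adj v)).setVar 6 (listStart adj v + (adj v).length) with hσ₀
  have hs₀ : Same (Prog.forBlock a x body) σ σ₀ := by
    refine ⟨fun z hz => ?_, fun b hb => rfl⟩
    rw [Prog.noVar_forBlock] at hz
    simp [hσ₀, hz.1, hz.2.1]
  refine (while_rule (fun k τ => k ≤ L.length ∧ τ.var 5 = listStart adj v + k ∧
    τ.var 6 = listStart adj v + L.length ∧ Inv k τ ∧ Same (Prog.forBlock a x body) σ τ)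
    L.length ?_ (fun K σ' h => h.1) (fun K σ' h => by simp) ?_).mono ?_
  · refine ⟨Nat.zero_le _, by simp [hσ₀], by simp [hσ₀, hL], ?_, hs₀⟩
    exact hset _ _ _ _ (by simp) (hset _ _ _ _ (by simp) h0)
  · intro K σ' ⟨hK, hv5, hv6, hI, hs⟩ hb _
    simp only [Test.Holds, Expr.eval, hv5, hv6] at hb
    have hKL : K < L.length := by omega
    simp only [tri_seq, tri_assign, Expr.Ok, Expr.eval, State.setVar_var, State.setVar_arr, if_true,
      true_and, hv5]
    refine ⟨by simp, ?_⟩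
    have harr : σ'.arr a (listStart adj v + K + 1) = (L[K] : ℕ) := by
      rw [hs.2 a (by simpa using ha),
        show listStart adj v + K + 1 = listStart adj v + 1 + K by omega]
      exact hread K hKL
    rw [harr]
    set σ₁ := (σ'.setVar 5 (listStart adj v + K + 1)).setVar 7 (L[K] : ℕ) with hσ₁
    have hs₁ : Same (Prog.forBlock a x body) σ σ₁ := by
      refine hs.trans ⟨fun z hz => ?_, fun b hb => rfl⟩
      rw [Prog.noVar_forBlock] at hz
      simp [hσ₁, hz.1, hz.2.2.1]
    refine (hstep K hKL σ₁ (hset _ _ _ _ (by simp) (hset _ _ _ _ (by simp) hI)) (by simp [hσ₁])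
      hs₁).mono fun k τ hs' ⟨hk, hI'⟩ => ?_
    subst hk
    refine ⟨hKL, ?_, ?_, hI', hs₁.trans (hs'.of_imp (fun z hz => ?_) (fun b hb => ?_))⟩
    · rw [hs'.1 5 h5]; simp [hσ₁]; omega
    · rw [hs'.1 6 h6]; simp [hσ₁, hv6]
    · exact (Prog.noVar_forBlock.1 hz).2.2.2
    · exact Prog.noArr_forBlock.1 hb
  · intro k τ _ ⟨⟨hk, hv5, hv6, hI, _⟩, hb⟩
    simp only [Test.Holds, Expr.eval, hv5, hv6] at hb
    obtain rfl : k = L.length := by omega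
    simpa using hI

/-- Compute the positions of the adjacency lists. -/
def setup : Prog :=
  .seq (.assign 1 (.arr 0 (.const 0)))
    (.seq (.assign 2 (.const 1))
      (.forLoop 3 1 (.seq (.store 1 (.var 3) (.var 2))
        (.assign 2 (.add (.add (.var 2) (.arr 0 (.var 2))) (.const 1))))))

theorem setup_spec {V : ℕ} (hV : listStart adj n ≤ V) :
    Tri V setup (State.init (encodeAdjacencyLists adj)) fun k τ => k ≤ n ∧ Env adj τ := by
  set σ := State.init (encodeAdjacencyLists adj) with hσ
  have hn : σ.arr 0 0 = n := by simp [hσ, State.init, encodeAdjacencyLists]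
  have hin : ∀ (v : Fin n) (t : ℕ), t ≤ (adj v).length → σ.arr 0 (listStart adj v + t) =
      ((adj v).length :: (adj v).map (fun w : Fin n => (w : ℕ))).getD t 0 :=
    fun v t ht => by rw [← encodeAdjacencyLists_getD v t ht]; simp [hσ, State.init]
  have hlen : ∀ v : Fin n, σ.arr 0 (listStart adj v) = (adj v).length := fun v => by
    simpa using hin v 0 (Nat.zero_le _)
  simp only [setup, tri_seq, tri_assign, Expr.Ok, Expr.eval, zero_le, le_refl, true_and, hn]
  refine (for_rule (by decide) (by simp) (by simp) (n := n) (by simp)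
    (fun i K τ => K = i ∧ τ.var 2 = listStart adj i ∧ ∀ v : Fin n, v.1 < i →
      τ.arr 1 v = listStart adj v) ⟨rfl, by simp [listStart], by simp⟩ ?_).mono ?_
  · rintro i hi K σ' ⟨hK, h2, h1⟩ h3 hs
    have h0 : σ'.arr 0 = σ.arr 0 := by rw [hs.2 0 (by simp)]; rfl
    have hl := hlen ⟨i, hi⟩
    have hle := listStart_add_le (adj := adj) ⟨i, hi⟩
    simp only at hl hle
    simp only [tri_seq, tri_store, tri_assign, Expr.Ok, Expr.eval, State.setArr_var,
      State.setArr_arr, State.setVar_var, State.setVar_arr, h2, h3, h0, true_and]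
    simp only [show (0 : ℕ) ≠ 1 by decide, if_false, if_true, hl]
    refine ⟨by simp; omega, by omega, ?_, ?_⟩
    · simp [listStart_succ, listLen, hi]
    · intro v hv
      rw [Function.update_apply]
      split_ifs with hvi
      · rw [hvi]
      · exact h1 v (by omega)
  · rintro k τ hs ⟨hk, h2, h1⟩
    have h0 : τ.arr 0 = σ.arr 0 := by rw [hs.2 0 (by simp)]; rfl
    refine ⟨by omega, ?_, fun v => h1 v v.2, fun v => by rw [h0, hlen], fun v t ht => ?_⟩
    · rw [hs.1 1 (by simp)]; simp
    · rw [h0, add_assoc, hin v (1 + t) (by omega), add_comm 1 t]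
      simp [List.getD_eq_getElem?_getD, ht]

theorem Holds.append {σ τ : State} {a : ℕ} {L : List (Fin n)} (h : Holds σ a L) {v : Fin n}
    (hτ : τ.arr a = Function.update (σ.arr a) L.length v) : Holds τ a (L ++ [v]) := by
  intro i hi
  rw [hτ, Function.update_apply]
  split_ifs with h'
  · subst h'; simp
  · simp only [List.length_append, List.length_singleton] at hi
    rw [h i (by omega), List.getElem_append_left]

theorem Holds.of_eq {σ τ : State} {a : ℕ} {L : List (Fin n)} (h : Holds σ a L)
    (hτ : τ.arr a = σ.arr a) : Holds τ a L := by
  intro i hi; rw [hτ, h i hi]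

/-! ### Sorting by degree -/

/-- The linked list that starts with the node `p` and continues according to `nx` contains the
vertices in `L`. The node of the vertex `v` is `v + 1`, and `0` is the end of a list. -/
def Chain (nx : ℕ → ℕ) : ℕ → List (Fin n) → Prop
  | p, [] => p = 0
  | p, v :: L => p = v + 1 ∧ Chain nx (nx (v + 1)) L

theorem Chain.update {nx : ℕ → ℕ} {p : ℕ} {L : List (Fin n)} (h : Chain nx p L) {i q : ℕ}
    (hi : ∀ v ∈ L, v.1 ≠ i) : Chain (Function.update nx (i + 1) q) p L := by
  induction L generalizing p with
  | nil => exact h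
  | cons v L ih =>
    refine ⟨h.1, ?_⟩
    rw [Function.update_of_ne]
    · exact ih h.2 fun w hw => hi w (List.mem_cons_of_mem _ hw)
    · have := hi v List.mem_cons_self
      omega

/-- Bucket sort of the vertices by decreasing degree, into array `10`. -/
def sortByDegree : Prog :=
  .seq
    (.forLoop 3 1
      (.seq (.assign 4 (.arr 0 (.arr 1 (.var 3))))
        (.seq (.store 3 (.add (.var 3) (.const 1)) (.arr 2 (.var 4)))
          (.store 2 (.var 4) (.add (.var 3) (.const 1))))))
    (.seq (.assign 5 (.const 0))
      (.forLoop 3 1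
        (.seq (.assign 4 (.arr 2 (.sub (.sub (.var 1) (.const 1)) (.var 3))))
          (.while (.lt (.const 0) (.var 4))
            (.seq (.store 10 (.var 5) (.sub (.var 4) (.const 1)))
              (.seq (.assign 5 (.add (.var 5) (.const 1))) (.assign 4 (.arr 3 (.var 4)))))))))

theorem sortByDegree_buckets {V : ℕ} {σ : State} (hE : Env adj σ) (h2 : ∀ i, σ.arr 2 i = 0) :
    Tri V (.forLoop 3 1
      (.seq (.assign 4 (.arr 0 (.arr 1 (.var 3))))
        (.seq (.store 3 (.add (.var 3) (.const 1)) (.arr 2 (.var 4)))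
          (.store 2 (.var 4) (.add (.var 3) (.const 1)))))) σ fun k τ => k = n ∧
      ∃ B : ℕ → List (Fin n), ∀ d, Chain (τ.arr 3) (τ.arr 2 d) (B d) ∧ (B d).Nodup ∧
        ∀ v, v ∈ B d ↔ (adj v).length = d := by
  refine (for_rule (by decide) (by simp) (by simp) hE.size (fun i K τ => K = i ∧
    ∃ B : ℕ → List (Fin n), ∀ d, Chain (τ.arr 3) (τ.arr 2 d) (B d) ∧ (B d).Nodup ∧
      ∀ v, v ∈ B d ↔ v.1 < i ∧ (adj v).length = d) ?_ ?_).mono ?_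
  · exact ⟨rfl, fun _ => [], fun d => ⟨h2 d, List.nodup_nil, by simp⟩⟩
  · rintro i hi K σ' ⟨hK, B, hB⟩ h3 hs
    have hE' := hE.of_same hs (by simp) (by simp) (by simp)
    have hl : σ'.arr 0 (σ'.arr 1 i) = (adj ⟨i, hi⟩).length := by
      rw [hE'.start ⟨i, hi⟩, hE'.length]
    simp only [tri_seq, tri_assign, tri_store, Expr.Ok, Expr.eval, State.setVar_var,
      State.setVar_arr, State.setArr_var, State.setArr_arr, h3, hl, true_and]
    refine ⟨by simp, by simp, by omega, fun d => if (adj ⟨i, hi⟩).length = d then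
      ⟨i, hi⟩ :: B d else B d, fun d => ?_⟩
    obtain ⟨hc, hnd, hmem⟩ := hB d
    have hne : ∀ v ∈ B d, v.1 ≠ i := fun v hv => ((hmem v).1 hv).1.ne
    have hc' := hc.update hne (q := σ'.arr 2 (adj ⟨i, hi⟩).length)
    simp only [if_true, if_false, show (3 : ℕ) ≠ 2 by decide, show (2 : ℕ) ≠ 3 by decide,
      show (3 : ℕ) ≠ 4 by decide]
    split_ifs with hd
    · subst hd
      refine ⟨⟨by simp, by simpa using hc'⟩, List.nodup_cons.2 ⟨fun h => hne _ h rfl, hnd⟩,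
        fun v => ?_⟩
      simp only [List.mem_cons, hmem, Fin.ext_iff]
      constructor
      · rintro (h | h)
        · exact ⟨by omega, by congr 2; exact Fin.ext h⟩
        · exact ⟨by omega, h.2⟩
      · rintro ⟨h, h'⟩
        rcases Nat.lt_succ_iff_lt_or_eq.1 h with h | h
        · exact Or.inr ⟨h, h'⟩
        · exact Or.inl h
    · rw [Function.update_of_ne (Ne.symm hd)]
      refine ⟨hc', hnd, fun v => ?_⟩
      rw [hmem]
      refine and_congr_left fun h' => ?_
      have : v.1 ≠ i := by
        rintro rfl
        exact hd h'
      omega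
  · rintro k τ hs ⟨hk, B, hB⟩
    exact ⟨hk, B, fun d => ⟨(hB d).1, (hB d).2.1, fun v => by rw [(hB d).2.2]; simp⟩⟩

theorem sortByDegree_spec {V : ℕ} {σ : State} (hE : Env adj σ)
    (hlt : ∀ v, (adj v).length < n) (h2 : ∀ i, σ.arr 2 i = 0) :
    Tri V sortByDegree σ fun k τ => k ≤ 3 * n ∧ ∃ L : List (Fin n), L.Nodup ∧ (∀ v, v ∈ L) ∧
      L.Pairwise (fun v w => (adj w).length ≤ (adj v).length) ∧ Holds τ 10 L := by
  rw [sortByDegree, tri_seq]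
  refine (sortByDegree_buckets hE h2).mono fun k τ hs ⟨hk, B, hB⟩ => ?_
  have hn : τ.var 1 = n := (hs.1 1 (by simp)).trans hE.size
  simp only [tri_seq, tri_assign, Expr.Ok, Expr.eval, zero_le, true_and]
  refine (for_rule (by decide) (by simp) (by simp) (n := n) (by simpa using hn) (fun i K υ =>
    ∃ L : List (Fin n), K = i + L.length ∧ υ.var 5 = L.length ∧ L.Nodup ∧
      (∀ v, v ∈ L ↔ n - i ≤ (adj v).length) ∧
      L.Pairwise (fun v w => (adj w).length ≤ (adj v).length) ∧ Holds υ 10 L) ?_ ?_).mono ?_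
  · refine ⟨[], by simp, by simp, List.nodup_nil, fun v => ?_, List.Pairwise.nil,
      fun i hi => absurd hi (by simp)⟩
    have := hlt v
    simp; omega
  · rintro i hi K υ ⟨L, hK, h5, hnd, hmem, hpw, hL⟩ h3 hs'
    have h2' : υ.arr 2 = τ.arr 2 := by rw [hs'.2 2 (by simp)]; rfl
    have h3' : υ.arr 3 = τ.arr 3 := by rw [hs'.2 3 (by simp)]; rfl
    have h1' : υ.var 1 = n := by rw [hs'.1 1 (by simp)]; simpa using hn
    simp only [tri_seq, tri_assign, Expr.Ok, Expr.eval, h1', h2', h3, le_refl, true_and, and_true]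
    obtain ⟨hc, hndB, hmemB⟩ := hB (n - 1 - i)
    set Bd := B (n - 1 - i) with hBd
    refine (while_rule (fun K' ω => ∃ l r, Bd = l ++ r ∧ K' = l.length ∧
      Chain (τ.arr 3) (ω.var 4) r ∧ ω.var 5 = (L ++ l).length ∧ Holds ω 10 (L ++ l)) Bd.length
      ⟨[], Bd, by simp, rfl, by simpa using hc, by simpa using h5,
        by rw [List.append_nil]; exact hL.of_eq rfl⟩ ?_
      (fun K σ' _ => by simp) ?_).mono ?_
    · rintro K' ω ⟨l, r, hlr, hK', -⟩
      rw [hlr, List.length_append]; omega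
    · rintro K' ω ⟨l, r, hlr, hK', hch, hv5, hL'⟩ hb hsω
      have h3ω : ω.arr 3 = τ.arr 3 := by rw [hsω.2 3 (by simp)]; exact h3'
      simp only [Test.Holds, Expr.eval] at hb
      match r, hch with
      | [], hch => exact absurd hb (by rw [show ω.var 4 = 0 from hch]; simp)
      | v :: r, hch =>
        simp only [tri_seq, tri_assign, tri_store, Expr.Ok, Expr.eval, le_refl, State.setVar_var,
          State.setVar_arr, State.setArr_var, State.setArr_arr, true_and]
        refine ⟨by simp, l ++ [v], r, by simpa using hlr, by simp [hK'], ?_, ?_, ?_⟩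
        · have := hch.2
          simpa [h3ω, hch.1] using this
        · simp [hv5]; omega
        · rw [← List.append_assoc]
          refine hL'.append ?_
          simp [hv5, hch.1]
    · rintro K' ω hsω ⟨⟨l, r, hlr, hK', hch, hv5, hL'⟩, hb⟩
      simp only [Test.Holds, Expr.eval] at hb
      obtain rfl : r = [] := by
        match r, hch with
        | [], _ => rfl
        | v :: r, hch => exact absurd (show 0 < ω.var 4 by rw [hch.1]; omega) hb
      rw [List.append_nil] at hlr
      subst hlr
      refine ⟨L ++ Bd, ?_, by simpa using hv5, ?_, ?_, ?_, hL'.of_eq rfl⟩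
      · simp only [List.length_append]; omega
      · refine List.Nodup.append hnd hndB fun v hv hv' => ?_
        rw [hmem] at hv
        rw [hmemB] at hv'
        omega
      · intro v
        rw [List.mem_append, hmem, hmemB]
        omega
      · rw [List.pairwise_append]
        refine ⟨hpw, ?_, fun v hv w hw => ?_⟩
        · refine List.pairwise_of_forall_mem_list fun v hv w hw => ?_
          rw [(hmemB v).1 hv, (hmemB w).1 hw]
        · rw [hmem] at hv
          rw [hmemB] at hw
          omega
  · rintro k' υ hs' ⟨L, hK, h5, hnd, hmem, hpw, hL⟩
    have : L.length ≤ n := by simpa using hnd.length_le_card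
    exact ⟨by omega, L, hnd, fun v => (hmem v).2 (by simp), hpw, hL⟩

variable {G : SimpleGraph (Fin n)} {L : List (Fin n)}

/-! ### Sorting the adjacency lists -/

variable (adj) in
/-- The neighbors of `w` in the order of the list `L`. -/
def sortedNbrs (L : List (Fin n)) (w : Fin n) : List (Fin n) := L.filter fun v => w ∈ adj v

theorem mem_sortedNbrs (hadj : IsAdjacencyLists G adj) (hL : ∀ v, v ∈ L) {v w : Fin n} :
    v ∈ sortedNbrs adj L w ↔ G.Adj w v := by
  simp [sortedNbrs, hL, (hadj v).2, G.adj_comm]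

theorem length_sortedNbrs (hadj : IsAdjacencyLists G adj) (hnd : L.Nodup) (hL : ∀ v, v ∈ L)
    (w : Fin n) : (sortedNbrs adj L w).length = (adj w).length := by
  refine ((List.perm_ext_iff_of_nodup (hnd.filter _) (hadj w).1).2 fun v => ?_).length_eq
  rw [(hadj w).2]
  exact mem_sortedNbrs hadj hL

theorem sum_listLen_le {A : List (Fin n)} (hA : A.Nodup) :
    (A.map fun v => (adj v).length + 1).sum + 1 ≤ listStart adj n := by
  have h1 : (A.map fun v => (adj v).length + 1).sum =
      ∑ v ∈ A.toFinset, ((adj v).length + 1) := by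
    rw [List.sum_toFinset _ hA]
  have h2 : ∑ v ∈ A.toFinset, ((adj v).length + 1) ≤ ∑ v : Fin n, ((adj v).length + 1) :=
    Finset.sum_le_sum_of_subset (Finset.subset_univ _)
  have h3 : ∑ v : Fin n, ((adj v).length + 1) = ∑ i ∈ Finset.range n, (listLen adj i + 1) := by
    rw [Finset.sum_range]
    simp
  rw [listStart]
  omega

/-- Array `b + 11` contains the lengths of the lists `S w`, and array `b + 12` contains these lists,
each one at the position of the adjacency list of `w`. -/
def Table (adj : Fin n → List (Fin n)) (b : ℕ) (σ : State) (S : Fin n → List (Fin n)) : Prop :=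
  ∀ w : Fin n, σ.arr (b + 11) w = (S w).length ∧
    ∀ t (h : t < (S w).length), σ.arr (b + 12) (listStart adj w + 1 + t) = ((S w)[t] : ℕ)

theorem Table.push {b : ℕ} {σ τ : State} {S : Fin n → List (Fin n)} (h : Table adj b σ S)
    {v w : Fin n} (hS : ∀ u, (S u).length ≤ (adj u).length) (hw : (S w).length < (adj w).length)
    (h1 : τ.arr (b + 11) = Function.update (σ.arr (b + 11)) w ((S w).length + 1))
    (h2 : τ.arr (b + 12) =
      Function.update (σ.arr (b + 12)) (listStart adj w + 1 + (S w).length) v) :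
    Table adj b τ (Function.update S w (S w ++ [v])) := by
  intro u
  rw [h1, h2]
  by_cases huw : u = w
  · subst huw
    simp only [Function.update_self, List.length_append, List.length_singleton, true_and]
    intro t ht
    rw [Function.update_apply]
    split_ifs with heq
    · obtain rfl : t = (S u).length := by omega
      simp
    · rw [(h u).2 t (by omega), List.getElem_append_left]
  · rw [Function.update_of_ne (fun hh => huw (Fin.ext hh)), Function.update_of_ne huw]
    refine ⟨(h u).1, fun t ht => ?_⟩
    rw [Function.update_of_ne, (h u).2 t ht]
    intro heq
    have := hS u
    exact huw (eq_of_listStart_add_eq (adj := adj) (s := 1 + t) (t := 1 + (S w).length) (by omega)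
      (by omega) (by omega))

/-- Write the adjacency lists, sorted by the order of the vertices in array `b + 10`, into array
`b + 12`: each vertex is appended to the lists of its neighbors. -/
def sortLists (b : ℕ) : Prog :=
  .forLoop 3 1
    (.seq (.assign 4 (.arr (b + 10) (.var 3)))
      (.forBlock 0 4
        (.seq (.store (b + 12)
            (.add (.add (.arr 1 (.var 7)) (.arr (b + 11) (.var 7))) (.const 1)) (.var 4))
          (.store (b + 11) (.var 7) (.add (.arr (b + 11) (.var 7)) (.const 1))))))

theorem sortLists_spec {V b : ℕ} {σ : State} (hadj : IsAdjacencyLists G adj) (hE : Env adj σ)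
    (hV : listStart adj n ≤ V) (hnd : L.Nodup) (hL : ∀ v, v ∈ L) (hLn : L.length = n)
    (hQ : Holds σ (b + 10) L) (h0 : ∀ i, σ.arr (b + 11) i = 0) :
    Tri V (sortLists b) σ fun k τ => k ≤ listStart adj n ∧
      ∀ w t (h : t < (sortedNbrs adj L w).length),
        τ.arr (b + 12) (listStart adj w + 1 + t) = ((sortedNbrs adj L w)[t] : ℕ) := by
  refine (for_rule (by decide) (by simp) (by simp) hE.size (fun i K τ =>
    K = ((L.take i).map fun v => (adj v).length + 1).sum ∧
      Table adj b τ (sortedNbrs adj (L.take i))) ?_ ?_).mono ?_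
  · exact ⟨by simp, fun w => ⟨by simp [h0, sortedNbrs], fun t ht => by simp [sortedNbrs] at ht⟩⟩
  · rintro i hi K σ' ⟨hK, hT⟩ h3 hs
    have hiL : i < L.length := by omega
    set v := L[i] with hv
    have hE' := hE.of_same hs (by simp) (by simp) (by simp)
    have hq : σ'.arr (b + 10) i = v := by rw [hs.2 (b + 10) (by simp)]; exact hQ i hiL
    have htake : L.take (i + 1) = L.take i ++ [v] := by
      rw [List.take_succ_eq_append_getElem hiL]
    have hsucc : ∀ w, sortedNbrs adj (L.take (i + 1)) w =
        if w ∈ adj v then sortedNbrs adj (L.take i) w ++ [v] else sortedNbrs adj (L.take i) w := by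
      intro w
      rw [sortedNbrs, htake, List.filter_append]
      split_ifs with hw <;> simp [hw, sortedNbrs]
    have hlen : ∀ i w, (sortedNbrs adj (L.take i) w).length ≤ (adj w).length := by
      intro i w
      rw [← length_sortedNbrs hadj hnd hL w]
      exact ((List.take_sublist i L).filter _).length_le
    simp only [tri_seq, tri_assign, Expr.Ok, Expr.eval, h3, hq, true_and]
    have hE'' : Env adj (σ'.setVar 4 v) := ⟨by simpa using hE'.size, hE'.start, hE'.length, hE'.nbr⟩
    refine (forBlock_rule hE'' hV v (by simp) (adj v) rfl (hE''.nbr v) (by simp) (by simp)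
      (by simp) (fun t τ => Table adj b τ fun w => if w ∈ (adj v).take t then
        sortedNbrs adj (L.take i) w ++ [v] else sortedNbrs adj (L.take i) w) ?_
      (fun t τ y z _ h => h) ?_).mono ?_
    · simp only [List.take_zero, List.not_mem_nil, if_false]
      exact hT
    · intro t ht τ hτ h7 hsτ
      have hEτ := hE''.of_same hsτ (by simp) (by simp) (by simp)
      have h4 : τ.var 4 = v := by rw [hsτ.1 4 (by simp)]; simp
      set w := (adj v)[t] with hw
      have hwt : w ∉ (adj v).take t := by
        intro hmem
        obtain ⟨s, hs, heq⟩ := List.getElem_of_mem hmem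
        simp only [List.length_take] at hs
        rw [List.getElem_take] at heq
        have := (hadj v).1.getElem_inj_iff.1 heq
        omega
      have hwv : w ∈ adj v := List.getElem_mem ht
      have hc := (hτ w).1
      simp only [if_neg hwt] at hc
      have hlt : (sortedNbrs adj (L.take i) w).length < (adj w).length := by
        have := hlen (i + 1) w
        rw [hsucc, if_pos hwv] at this
        simpa using this
      have hle := listStart_add_le (adj := adj) w
      simp only [tri_seq, tri_store, Expr.Ok, Expr.eval, State.setArr_arr, State.setArr_var,
        h7, h4, hEτ.start, hc, true_and]
      refine ⟨⟨Or.inr (by omega), by simp⟩, by simp, ?_⟩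
      have hpush := hτ.push (v := v) (w := w)
        (τ := (τ.setArr (b + 12) (listStart adj w + (sortedNbrs adj (L.take i) w).length + 1)
          v).setArr (b + 11) w ((sortedNbrs adj (L.take i) w).length + 1))
        (fun u => by
          split_ifs with hu
          · have := hlen (i + 1) u
            rwa [hsucc, if_pos (List.mem_of_mem_take hu)] at this
          · exact hlen i u)
        (by simpa only [if_neg hwt] using hlt) (by simp [hwt])
        (by simp [hwt, add_right_comm])
      have hfun : ∀ u, Function.update (fun w => if w ∈ (adj v).take t then
          sortedNbrs adj (L.take i) w ++ [v] else sortedNbrs adj (L.take i) w) w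
          ((if w ∈ (adj v).take t then
            sortedNbrs adj (L.take i) w ++ [v] else sortedNbrs adj (L.take i) w) ++ [v]) u =
          if u ∈ (adj v).take (t + 1) then
            sortedNbrs adj (L.take i) u ++ [v] else sortedNbrs adj (L.take i) u := by
        intro u
        rw [List.take_succ_eq_append_getElem ht]
        by_cases hu : u = w
        · subst hu
          rw [Function.update_self, if_neg hwt,
            if_pos (List.mem_append_right _ (List.mem_singleton.2 rfl))]
        · rw [Function.update_of_ne hu]
          have : u ≠ (adj v)[t] := hu
          simp only [List.mem_append, List.mem_singleton, this, or_false]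
      rw [funext hfun] at hpush
      simpa [hc] using hpush
    · rintro k τ hsτ ⟨hk, hT'⟩
      refine ⟨?_, ?_⟩
      · rw [htake, hK, hk]; simp; omega
      · rw [List.take_length] at hT'
        rw [funext hsucc]
        exact hT'
  · rintro k τ hs ⟨hk, hT⟩
    rw [List.take_of_length_le hLn.le] at hk hT
    have := sum_listLen_le (adj := adj) hnd
    exact ⟨by omega, fun w => (hT w).2⟩

/-! ### Breadth-first search -/

/-- The vertex `w` may be visited next by a breadth-first search with restarts that has visited the
vertices of the list `Q` in this order, where ties are broken by the order of the list `L`. -/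
def IsNext (G : SimpleGraph (Fin n)) (L Q : List (Fin n)) (w : Fin n) : Prop :=
  w ∉ Q ∧ ∀ y, y ∉ Q → y ≠ w →
    (∀ z ∈ Q, G.Adj z y → ∃ z' ∈ Q, Q.idxOf z' ≤ Q.idxOf z ∧ G.Adj z' w) ∧
    ((∀ z ∈ Q, G.Adj z w → ∃ z' ∈ Q, Q.idxOf z' ≤ Q.idxOf z ∧ G.Adj z' y) →
      L.idxOf w < L.idxOf y)

/-- The lists in which every vertex may be visited after those that precede it. -/
inductive IsSweepList (G : SimpleGraph (Fin n)) (L : List (Fin n)) : List (Fin n) → Prop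
  | nil : IsSweepList G L []
  | append {Q : List (Fin n)} {w : Fin n} (hQ : IsSweepList G L Q) (hw : IsNext G L Q w) :
      IsSweepList G L (Q ++ [w])

theorem IsSweepList.nodup {Q : List (Fin n)} (h : IsSweepList G L Q) : Q.Nodup := by
  induction h with
  | nil => exact List.nodup_nil
  | append _ hw ih =>
    refine ih.append (List.nodup_singleton _) ?_
    rw [List.disjoint_singleton]
    exact hw.1

theorem IsSweepList.isNext {Q A B : List (Fin n)} {x : Fin n} (h : IsSweepList G L Q)
    (hQ : Q = A ++ x :: B) : IsNext G L A x := by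
  induction h generalizing B with
  | nil => simp at hQ
  | @append Q w _ hw ih =>
    rcases List.eq_nil_or_concat B with rfl | ⟨B', y, rfl⟩
    · obtain ⟨rfl, h2⟩ := List.append_inj' hQ rfl
      rw [List.singleton_inj] at h2
      exact h2 ▸ hw
    · rw [List.concat_eq_append, ← List.cons_append, ← List.append_assoc] at hQ
      exact ih (List.append_inj' hQ rfl).1

theorem IsSweepList.isSweep {Q : List (Fin n)} (h : IsSweepList G L Q) (hQ : ∀ v, v ∈ Q) :
    IsSweep G (fun x y => L.idxOf x < L.idxOf y) fun v => Q.idxOf v := by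
  have hnd := h.nodup
  have key : ∀ x, ∃ A, IsNext G L A x ∧ (∀ z, z ∈ A ↔ Q.idxOf z < Q.idxOf x) ∧
      ∀ z ∈ A, A.idxOf z = Q.idxOf z := by
    intro x
    obtain ⟨A, B, hAB⟩ := List.append_of_mem (hQ x)
    have hn := h.isNext hAB
    have hx : Q.idxOf x = A.length := by
      rw [hAB, List.idxOf_append_of_notMem hn.1]; simp
    refine ⟨A, hn, fun z => ?_, fun z hz => by rw [hAB, List.idxOf_append_of_mem hz]⟩
    rw [hx, hAB]
    constructor
    · intro hz
      rw [List.idxOf_append_of_mem hz]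
      exact List.idxOf_lt_length_of_mem hz
    · intro hz
      by_contra hzA
      rw [List.idxOf_append_of_notMem hzA] at hz
      omega
  have hinj : Function.Injective fun v => Q.idxOf v :=
    fun x y hxy => (List.idxOf_inj (hQ x)).1 hxy
  refine ⟨hinj, fun x y hxy z hz hzy => ?_, fun x y hxy hyp => ?_⟩
  all_goals
    obtain ⟨A, hn, hA, hidx⟩ := key x
    have hyA : y ∉ A := by rw [hA]; exact hxy.not_gt
    have hyx : y ≠ x := by rintro rfl; exact lt_irrefl _ hxy
    obtain ⟨h1, h2⟩ := hn.2 y hyA hyx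
  · obtain ⟨z', hz', hle, hadj⟩ := h1 z ((hA z).2 hz) hzy
    rw [hidx z' hz', hidx z ((hA z).2 hz)] at hle
    exact ⟨z', hle, hadj⟩
  · refine h2 fun z hz hzx => ?_
    obtain ⟨z', hle, hadj⟩ := hyp z ((hA z).1 hz) hzx
    have hz' : z' ∈ A := (hA z').2 (lt_of_le_of_lt hle ((hA z).1 hz))
    exact ⟨z', hz', by rw [hidx z' hz', hidx z hz]; exact hle, hadj⟩

theorem mem_of_reachable {Q : List (Fin n)} (hQ : ∀ z ∈ Q, ∀ y, G.Adj z y → y ∈ Q) {x y : Fin n}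
    (hx : x ∈ Q) (h : G.Reachable x y) : y ∈ Q := by
  obtain ⟨p⟩ := h
  induction p with
  | nil => exact hx
  | cons hadj _ ih => exact ih (hQ _ hx _ hadj)

/-- A vertex that is not visited may be visited next when all neighbors of visited vertices have
been visited and it is the first such vertex in the list `L`. -/
theorem isNext_of_closed {Q : List (Fin n)} (hQ : ∀ z ∈ Q, ∀ y, G.Adj z y → y ∈ Q) {i : ℕ}
    (hi : i < L.length) (htake : ∀ v ∈ L.take i, v ∈ Q) (hw : L[i] ∉ Q) (hnd : L.Nodup)
    (hL : ∀ v, v ∈ L) : IsNext G L Q L[i] := by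
  refine ⟨hw, fun y hy hne => ⟨fun z hz hzy => absurd (hQ z hz y hzy) hy, fun _ => ?_⟩⟩
  rw [hnd.idxOf_getElem]
  have hyL := List.idxOf_lt_length_of_mem (hL y)
  have hyi : L[L.idxOf y] = y := List.getElem_idxOf hyL
  rcases lt_trichotomy i (L.idxOf y) with h | h | h
  · exact h
  · exact absurd (by simp only [h, hyi]) hne
  · refine absurd (htake y ?_) hy
    rw [List.mem_take_iff_getElem]
    exact ⟨L.idxOf y, by omega, hyi⟩

/-- The first vertex in the sorted list of neighbors of `x` that is not visited may be visited next,
if all neighbors of vertices visited before `x` have been visited. -/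
theorem isNext_of_sortedNbrs (hadj : IsAdjacencyLists G adj) (hnd : L.Nodup) (hL : ∀ v, v ∈ L)
    {A B : List (Fin n)} {x : Fin n} (hx : x ∉ A)
    (hA : ∀ z ∈ A, ∀ y, G.Adj z y → y ∈ A ++ x :: B) {t : ℕ}
    (ht : t < (sortedNbrs adj L x).length)
    (htake : ∀ v ∈ (sortedNbrs adj L x).take t, v ∈ A ++ x :: B)
    (hw : (sortedNbrs adj L x)[t] ∉ A ++ x :: B) :
    IsNext G L (A ++ x :: B) (sortedNbrs adj L x)[t] := by
  have hxw : G.Adj x (sortedNbrs adj L x)[t] :=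
    (mem_sortedNbrs hadj hL).1 (List.getElem_mem ht)
  have hidx : (A ++ x :: B).idxOf x = A.length := by
    rw [List.idxOf_append_of_notMem hx]; simp
  have hmem : x ∈ A ++ x :: B := by simp
  have hge : ∀ y, y ∉ A ++ x :: B → ∀ z, G.Adj z y → A.length ≤ (A ++ x :: B).idxOf z := by
    intro y hy z hzy
    by_cases hz : z ∈ A
    · exact absurd (hA z hz y hzy) hy
    · rw [List.idxOf_append_of_notMem hz]; omega
  refine ⟨hw, fun y hy hne => ⟨fun z hz hzy => ⟨x, hmem, by rw [hidx]; exact hge y hy z hzy, hxw⟩,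
    fun hyp => ?_⟩⟩
  obtain ⟨z, hz, hle, hzy⟩ := hyp x hmem hxw
  have hzx : z = x := by
    have := hge y hy z hzy
    rw [hidx] at hle
    refine (List.idxOf_inj hz).1 ?_
    rw [hidx]; omega
  rw [hzx] at hzy
  obtain ⟨s, hs, hsy⟩ := List.getElem_of_mem ((mem_sortedNbrs hadj hL).2 hzy)
  have hts : t < s := by
    rcases lt_trichotomy t s with h | h | h
    · exact h
    · subst h; exact absurd hsy.symm hne
    · refine absurd (htake y ?_) hy
      rw [List.mem_take_iff_getElem]
      exact ⟨s, by omega, hsy⟩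
  have hpw : L.Pairwise fun v w => L.idxOf v < L.idxOf w := by
    rw [List.pairwise_iff_getElem]
    intro i j hi hj hij
    rwa [hnd.idxOf_getElem, hnd.idxOf_getElem]
  have := List.pairwise_iff_getElem.1 (hpw.filter fun v => decide (x ∈ adj v)) t s ht hs hts
  rw [← hsy]
  exact this

/-- The state of a breadth-first search that has visited the vertices of the list `Q`: array
`b + 13` marks the visited vertices, array `b + 14` contains the list `Q`, variable `8` its length,
and array `b + 15` contains colors `0` and `1`, which in each component agree with the two-coloring
`κ` or with its complement. -/
structure BfsState (G : SimpleGraph (Fin n)) (L : List (Fin n)) (b : ℕ) (κ : Fin n → Bool)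
    (Q : List (Fin n)) (σ : State) : Prop where
  sweep : IsSweepList G L Q
  queue : Holds σ (b + 14) Q
  tail : σ.var 8 = Q.length
  visited : ∀ v : Fin n, σ.arr (b + 13) v = 0 ↔ v ∉ Q
  color_le : ∀ v : Fin n, σ.arr (b + 15) v ≤ 1
  color_new : ∀ v : Fin n, v ∉ Q → σ.arr (b + 15) v = 0
  color_iff : ∀ x ∈ Q, ∀ y ∈ Q, G.Reachable x y →
    (σ.arr (b + 15) x = σ.arr (b + 15) y ↔ κ x = κ y)
  color_adj : ∀ v : Fin n, σ.arr (b + 15) v = 1 → ∃ w, G.Adj v w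

theorem BfsState.push {b : ℕ} {κ : Fin n → Bool} {Q : List (Fin n)} {σ τ : State}
    (h : BfsState G L b κ Q σ) {w : Fin n} (hw : IsNext G L Q w) {c : ℕ} (hc : c ≤ 1)
    (h8 : τ.var 8 = Q.length + 1)
    (h13 : τ.arr (b + 13) = Function.update (σ.arr (b + 13)) w 1)
    (h14 : τ.arr (b + 14) = Function.update (σ.arr (b + 14)) Q.length w)
    (h15 : τ.arr (b + 15) = Function.update (σ.arr (b + 15)) w c)
    (hcol : ∀ y ∈ Q, G.Reachable w y → (c = σ.arr (b + 15) y ↔ κ w = κ y))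
    (hadj : c = 1 → ∃ y, G.Adj w y) : BfsState G L b κ (Q ++ [w]) τ := by
  have happ : ∀ v : Fin n, τ.arr (b + 15) v = if v = w then c else σ.arr (b + 15) v := by
    intro v
    rw [h15, Function.update_apply]
    simp only [Fin.ext_iff]
  refine ⟨h.sweep.append hw, h.queue.append h14, by simp [h8], fun v => ?_, fun v => ?_,
    fun v hv => ?_, fun x hx y hy hxy => ?_, fun v hv => ?_⟩
  · rw [h13, Function.update_apply]
    simp only [← Fin.ext_iff, List.mem_append, List.mem_singleton, not_or]
    split_ifs with hvw
    · simp [hvw]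
    · rw [h.visited]; simp [hvw]
  · rw [happ]
    split_ifs
    exacts [hc, h.color_le v]
  · simp only [List.mem_append, List.mem_singleton, not_or] at hv
    rw [happ, if_neg hv.2, h.color_new v hv.1]
  · simp only [List.mem_append, List.mem_singleton] at hx hy
    rw [happ, happ]
    split_ifs with h1 h2 h2
    · simp [h1, h2]
    · subst h1
      exact hcol y (hy.resolve_right h2) hxy
    · subst h2
      rw [eq_comm, hcol x (hx.resolve_right h1) hxy.symm, eq_comm]
    · exact h.color_iff x (hx.resolve_right h1) y (hy.resolve_right h2) hxy
  · rw [happ] at hv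
    split_ifs at hv with hvw
    · exact hvw ▸ hadj hv
    · exact h.color_adj v hv

theorem BfsState.of_eq {b : ℕ} {κ : Fin n → Bool} {Q : List (Fin n)} {σ τ : State}
    (h : BfsState G L b κ Q σ) (h8 : τ.var 8 = σ.var 8) (ha : τ.arr = σ.arr) :
    BfsState G L b κ Q τ := by
  obtain ⟨h1, h2, h3, h4, h5, h6, h7, h9⟩ := h
  refine ⟨h1, h2.of_eq (by rw [ha]), by rw [h8, h3], ?_, ?_, ?_, ?_, ?_⟩ <;> rw [ha] <;> assumption

/-- The body of the loop over the neighbors of a vertex in a breadth-first search. -/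
def visitNeighbor (b : ℕ) : Prog :=
  .ite (.eq (.arr (b + 13) (.var 7)) (.const 0))
    (.seq (.store (b + 13) (.var 7) (.const 1))
      (.seq (.store (b + 14) (.var 8) (.var 7))
        (.seq (.store (b + 15) (.var 7) (.sub (.const 1) (.arr (b + 15) (.var 9))))
          (.assign 8 (.add (.var 8) (.const 1))))))
    .skip

/-- The loop of a breadth-first search, until the queue is empty; variable `2` contains the head of
the queue. -/
def exhaustQueue (b : ℕ) : Prog :=
  .while (.lt (.var 2) (.var 8))
    (.seq (.assign 9 (.arr (b + 14) (.var 2)))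
      (.seq (.forBlock (b + 12) 9 (visitNeighbor b)) (.assign 2 (.add (.var 2) (.const 1)))))

/-- Breadth-first search with restarts, in the order of array `b + 10`. -/
def bfs (b : ℕ) : Prog :=
  .seq (.assign 2 (.const 0))
    (.seq (.assign 8 (.const 0))
      (.forLoop 3 1
        (.seq (.assign 4 (.arr (b + 10) (.var 3)))
          (.seq
            (.ite (.eq (.arr (b + 13) (.var 4)) (.const 0))
              (.seq (.store (b + 13) (.var 4) (.const 1))
                (.seq (.store (b + 14) (.var 8) (.var 4))
                  (.assign 8 (.add (.var 8) (.const 1)))))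
              .skip)
            (exhaustQueue b)))))

theorem visitNeighbor_spec {V b : ℕ} {κ : Fin n → Bool} {σ : State}
    (hadj : IsAdjacencyLists G adj) (hκ : IsTwoColoring G κ) (hnd : L.Nodup) (hL : ∀ v, v ∈ L)
    {A B : List (Fin n)} {x : Fin n} (h : BfsState G L b κ (A ++ x :: B) σ)
    (hA : ∀ z ∈ A, ∀ y, G.Adj z y → y ∈ A ++ x :: B) {t : ℕ}
    (ht : t < (sortedNbrs adj L x).length)
    (htake : ∀ v ∈ (sortedNbrs adj L x).take t, v ∈ A ++ x :: B)
    (h7 : σ.var 7 = ((sortedNbrs adj L x)[t] : ℕ)) (h9 : σ.var 9 = x) :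
    Tri V (visitNeighbor b) σ fun k τ => k = 0 ∧ ∃ B', (∀ v ∈ A ++ x :: B, v ∈ A ++ x :: B') ∧
      BfsState G L b κ (A ++ x :: B') τ ∧
      ∀ v ∈ (sortedNbrs adj L x).take (t + 1), v ∈ A ++ x :: B' := by
  have hx : x ∉ A := fun hx => by
    have := h.sweep.nodup
    rw [List.nodup_append] at this
    exact this.2.2 x hx x (by simp) rfl
  have hxw : G.Adj x (sortedNbrs adj L x)[t] :=
    (mem_sortedNbrs hadj hL).1 (List.getElem_mem ht)
  rw [visitNeighbor, tri_ite]
  refine ⟨by simp, fun hb => ?_, fun hb => ?_⟩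
  · simp only [Test.Holds, Expr.eval, h7] at hb
    have hw := (h.visited _).1 hb
    have hnext := isNext_of_sortedNbrs hadj hnd hL hx hA ht htake hw
    set w := (sortedNbrs adj L x)[t] with hw'
    simp only [tri_seq, tri_store, tri_assign, Expr.Ok, Expr.eval, State.setArr_var, h7, h9, h.tail,
      le_refl, true_and]
    refine ⟨by simp, B ++ [w], fun v hv => ?_, ?_, fun v hv => ?_⟩
    · rw [← List.cons_append, ← List.append_assoc]
      exact List.mem_append_left _ hv
    · rw [← List.cons_append, ← List.append_assoc]
      have hx1 := h.color_le x
      refine h.push hnext (c := 1 - σ.arr (b + 15) x) (by omega) (by simp) (by simp) (by simp)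
        (by simp) (fun y hy hwy => ?_) fun _ => ⟨x, hxw.symm⟩
      have hy1 := h.color_le y
      have hxy := h.color_iff x (by simp) y hy (hxw.reachable.trans hwy)
      have hne := hκ x w hxw
      have hiff : κ w = κ y ↔ ¬ κ x = κ y := by
        revert hne
        cases κ x <;> cases κ w <;> cases κ y <;> simp
      rw [hiff, ← hxy]
      omega
    · rw [List.take_succ_eq_append_getElem ht, List.mem_append, List.mem_singleton] at hv
      rw [← List.cons_append, ← List.append_assoc]
      rcases hv with hv | hv
      · exact List.mem_append_left _ (htake v hv)
      · exact List.mem_append_right _ (by simp [hv, hw'])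
  · simp only [Test.Holds, Expr.eval, h7] at hb
    rw [h.visited, not_not] at hb
    rw [tri_skip]
    refine ⟨rfl, B, fun v hv => hv, h, fun v hv => ?_⟩
    rw [List.take_succ_eq_append_getElem ht, List.mem_append, List.mem_singleton] at hv
    rcases hv with hv | hv
    · exact htake v hv
    · rw [hv]; exact hb

theorem exhaustQueue_spec {V b : ℕ} {κ : Fin n → Bool} {σ : State}
    (hadj : IsAdjacencyLists G adj) (hκ : IsTwoColoring G κ) (hnd : L.Nodup) (hL : ∀ v, v ∈ L)
    (hE : Env adj σ) (hV : listStart adj n ≤ V)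
    (htab : ∀ w t (h : t < (sortedNbrs adj L w).length),
        σ.arr (b + 12) (listStart adj w + 1 + t) = ((sortedNbrs adj L w)[t] : ℕ))
    {A B : List (Fin n)} (h : BfsState G L b κ (A ++ B) σ) (h2 : σ.var 2 = A.length)
    (hA : ∀ z ∈ A, ∀ y, G.Adj z y → y ∈ A ++ B) :
    Tri V (exhaustQueue b) σ fun k τ => ∃ Q, (∀ v ∈ A ++ B, v ∈ Q) ∧
      BfsState G L b κ Q τ ∧ τ.var 2 = Q.length ∧ (∀ z ∈ Q, ∀ y, G.Adj z y → y ∈ Q) ∧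
      k + (A.map fun v => (adj v).length + 1).sum ≤
        (Q.map fun v => (adj v).length + 1).sum := by
  rw [exhaustQueue]
  refine (while_rule (fun K τ => ∃ A' B', (∀ v ∈ A ++ B, v ∈ A' ++ B') ∧
    BfsState G L b κ (A' ++ B') τ ∧ τ.var 2 = A'.length ∧
    (∀ z ∈ A', ∀ y, G.Adj z y → y ∈ A' ++ B') ∧ K + (A.map fun v => (adj v).length + 1).sum ≤
      (A'.map fun v => (adj v).length + 1).sum) (listStart adj n)
    ⟨A, B, fun v hv => hv, h, h2, hA, by omega⟩ ?_ (fun K σ' _ => by simp) ?_).mono ?_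
  · rintro K τ ⟨A', B', -, h', -, -, hK⟩
    have := sum_listLen_le (adj := adj) (List.nodup_append.1 h'.sweep.nodup).1
    omega
  · rintro K τ ⟨A', B', hsub, h', h2', hA', hK⟩ hb hs
    simp only [Test.Holds, Expr.eval, h2', h'.tail, List.length_append] at hb
    obtain ⟨x, B', rfl⟩ : ∃ x B'', B' = x :: B'' := List.exists_cons_of_length_pos (by omega)
    have hE' := hE.of_same hs (by simp [visitNeighbor]) (by simp [visitNeighbor])
      (by simp [visitNeighbor])
    have hx : τ.arr (b + 14) A'.length = x := by
      rw [h'.queue A'.length (by simp)]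
      simp
    simp only [tri_seq, tri_assign, Expr.Ok, Expr.eval, h2', hx, true_and]
    have hE'' : Env adj (τ.setVar 9 x) := ⟨by simpa using hE'.size, hE'.start, hE'.length, hE'.nbr⟩
    refine (forBlock_rule hE'' hV x (by simp) (sortedNbrs adj L x)
      (length_sortedNbrs hadj hnd hL x) ?_ (by simp [visitNeighbor]) (by simp [visitNeighbor])
      (by simp [visitNeighbor]) (fun t υ => ∃ B'', (∀ v ∈ A' ++ x :: B', v ∈ A' ++ x :: B'') ∧
        BfsState G L b κ (A' ++ x :: B'') υ ∧
        ∀ v ∈ (sortedNbrs adj L x).take t, v ∈ A' ++ x :: B'') ?_ ?_ ?_).mono ?_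
    · intro t ht
      rw [← htab x t ht, State.setVar_arr, hs.2 (b + 12) (by simp [visitNeighbor])]
    · exact ⟨B', fun v hv => hv, h'.of_eq (by simp) rfl, by simp⟩
    · rintro t υ y z hy ⟨B'', h1, h2, h3⟩
      exact ⟨B'', h1, h2.of_eq (by rcases hy with rfl | rfl | rfl <;> simp) rfl, h3⟩
    · rintro t ht υ ⟨B'', h1, h2, h3⟩ h7 hsυ
      have h9 : υ.var 9 = x := by
        rw [hsυ.1 9 (by simp [visitNeighbor])]; simp
      refine (visitNeighbor_spec hadj hκ hnd hL h2
        (fun z hz y hzy => h1 y (hA' z hz y hzy)) ht h3 h7 h9).mono ?_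
      rintro k ω - ⟨hk, C, hC1, hC2, hC3⟩
      exact ⟨hk, C, fun v hv => hC1 v (h1 v hv), hC2, hC3⟩
    · rintro k υ hsυ ⟨hk, B'', h1, h2, h3⟩
      have h2υ : υ.var 2 = A'.length := by
        rw [hsυ.1 2 (by simp [visitNeighbor])]; simpa using h2'
      rw [List.take_length] at h3
      refine ⟨by simp, A' ++ [x], B'', fun v hv => ?_, ?_, by simp [h2υ], fun z hz y hzy => ?_, ?_⟩
      · simpa using h1 v (hsub v hv)
      · rw [List.append_assoc, List.singleton_append]
        exact h2.of_eq (by simp) rfl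
      · rw [List.append_assoc, List.singleton_append]
        rw [List.mem_append, List.mem_singleton] at hz
        rcases hz with hz | rfl
        · exact h1 y (hA' z hz y hzy)
        · exact h3 y ((mem_sortedNbrs hadj hL).2 hzy)
      · rw [hk, length_sortedNbrs hadj hnd hL x, List.map_append, List.sum_append,
          List.map_singleton, List.sum_singleton]
        omega
  · rintro k τ - ⟨⟨A', B', hsub, h', h2', hA', hK⟩, hb⟩
    simp only [Test.Holds, Expr.eval, h2', h'.tail, List.length_append] at hb
    obtain rfl : B' = [] := List.eq_nil_of_length_eq_zero (by omega)
    rw [List.append_nil] at *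
    exact ⟨A', hsub, h', h2', hA', hK⟩

theorem bfs_spec {V b : ℕ} {κ : Fin n → Bool} {σ : State}
    (hadj : IsAdjacencyLists G adj) (hκ : IsTwoColoring G κ) (hnd : L.Nodup) (hL : ∀ v, v ∈ L)
    (hLn : L.length = n) (hE : Env adj σ) (hV : listStart adj n ≤ V) (hQ : Holds σ (b + 10) L)
    (htab : ∀ w t (h : t < (sortedNbrs adj L w).length),
        σ.arr (b + 12) (listStart adj w + 1 + t) = ((sortedNbrs adj L w)[t] : ℕ))
    (h13 : ∀ i, σ.arr (b + 13) i = 0) (h15 : ∀ i, σ.arr (b + 15) i = 0) :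
    Tri V (bfs b) σ fun k τ => k ≤ n + listStart adj n ∧
      ∃ Q, (∀ v, v ∈ Q) ∧ BfsState G L b κ Q τ := by
  simp only [bfs, tri_seq, tri_assign, Expr.Ok, Expr.eval, zero_le, true_and]
  refine (for_rule (by decide) (by simp [exhaustQueue, visitNeighbor])
    (by simp [exhaustQueue, visitNeighbor]) (n := n) (by simpa using hE.size)
    (fun i K τ => ∃ Q, BfsState G L b κ Q τ ∧ τ.var 2 = Q.length ∧
      (∀ z ∈ Q, ∀ y, G.Adj z y → y ∈ Q) ∧ (∀ v ∈ L.take i, v ∈ Q) ∧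
      K ≤ i + (Q.map fun v => (adj v).length + 1).sum) ?_ ?_).mono ?_
  · refine ⟨[], ⟨.nil, fun i hi => absurd hi (by simp), by simp, by simp [h13], by simp [h15],
      by simp [h15], by simp, by simp [h15]⟩, by simp, by simp, by simp, by simp⟩
  · rintro i hi K τ ⟨Q, hB, h2, hcl, htake, hK⟩ h3 hs
    have hiL : i < L.length := by omega
    have hE0 : Env adj ((σ.setVar 2 0).setVar 8 0) :=
      ⟨by simpa using hE.size, hE.start, hE.length, hE.nbr⟩
    have hE' := hE0.of_same hs (by simp [exhaustQueue, visitNeighbor])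
      (by simp [exhaustQueue, visitNeighbor]) (by simp [exhaustQueue, visitNeighbor])
    have hq : τ.arr (b + 10) i = (L[i] : ℕ) := by
      rw [hs.2 (b + 10) (by simp [exhaustQueue, visitNeighbor])]
      exact hQ i hiL
    have htab' : ∀ w t (h : t < (sortedNbrs adj L w).length),
        τ.arr (b + 12) (listStart adj w + 1 + t) = ((sortedNbrs adj L w)[t] : ℕ) := by
      rw [hs.2 (b + 12) (by simp [exhaustQueue, visitNeighbor])]
      exact htab
    -- What remains to be shown once the root has been entered into the queue.
    have key : ∀ (υ : State) (B : List (Fin n)), BfsState G L b κ (Q ++ B) υ →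
        υ.var 2 = Q.length → Env adj υ → υ.arr (b + 12) = τ.arr (b + 12) → L[i] ∈ Q ++ B →
        Tri V (exhaustQueue b) υ fun k ω => ∃ Q', BfsState G L b κ Q' (ω.setVar 3 (i + 1)) ∧
          (ω.setVar 3 (i + 1)).var 2 = Q'.length ∧ (∀ z ∈ Q', ∀ y, G.Adj z y → y ∈ Q') ∧
          (∀ v ∈ L.take (i + 1), v ∈ Q') ∧
          K + (0 + (0 + k)) + 1 ≤ i + 1 + (Q'.map fun v => (adj v).length + 1).sum := by
      intro υ B hυ hυ2 hυE hυa hmem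
      refine (exhaustQueue_spec hadj hκ hnd hL hυE hV (by rw [hυa]; exact htab') hυ hυ2
        fun z hz y hzy => List.mem_append_left _ (hcl z hz y hzy)).mono ?_
      rintro k ω - ⟨Q', hsub, hB', h2', hcl', hK'⟩
      refine ⟨Q', hB'.of_eq (by simp) rfl, by simpa using h2', hcl', fun v hv => ?_, by omega⟩
      rw [List.take_succ_eq_append_getElem hiL, List.mem_append, List.mem_singleton] at hv
      rcases hv with hv | rfl
      · exact hsub v (List.mem_append_left _ (htake v hv))
      · exact hsub _ hmem
    simp only [tri_seq, tri_assign, tri_ite, tri_store, tri_skip, Expr.Ok, Expr.eval, Test.Ok,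
      Test.Holds, State.setVar_var, State.setVar_arr, State.setArr_var, h3, hq, hB.tail, true_and,
      zero_le, le_refl, if_true]
    refine ⟨fun hb => ⟨by simp, ?_⟩, fun hb => ?_⟩
    · have hw := (hB.visited _).1 hb
      have hnext := isNext_of_closed hcl hiL htake hw hnd hL
      refine key _ [L[i]] ?_ (by simpa using h2) ?_ (by simp) (by simp)
      · refine hB.push hnext (c := 0) (by omega) (by simp) (by simp) (by simp) ?_
          (fun y hy hreach => ?_) (by simp)
        · simp only [State.setVar_arr, State.setArr_arr]
          rw [if_neg (by omega), if_neg (by omega), eq_comm, Function.update_eq_self_iff,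
            hB.color_new _ hw]
        · -- No visited vertex is reachable from the root.
          exact absurd (mem_of_reachable hcl hy hreach.symm) hw
      · exact ⟨by simpa using hE'.size, by simpa using hE'.start, by simpa using hE'.length,
          by simpa using hE'.nbr⟩
    · have hw := (hB.visited _).not_left.1 (by simpa using hb)
      refine key _ [] ?_ (by simpa using h2) ?_ (by simp) (by simpa using hw)
      · rw [List.append_nil]
        exact hB.of_eq (by simp) rfl
      · exact ⟨by simpa using hE'.size, by simpa using hE'.start, by simpa using hE'.length,
          by simpa using hE'.nbr⟩
  · rintro k τ - ⟨Q, hB, -, -, htake, hK⟩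
    have := sum_listLen_le (adj := adj) hB.sweep.nodup
    refine ⟨by omega, Q, fun v => htake v ?_, hB⟩
    rw [List.take_of_length_le hLn.le]
    exact hL v

/-! ### The ordering of the vertices -/

/-- Write the vertices of array `14` in reversed order into array `20`. -/
def reverseOrder : Prog :=
  .forLoop 3 1
    (.store 20 (.var 3) (.arr 14 (.sub (.sub (.var 1) (.const 1)) (.var 3))))

theorem reverseOrder_spec {V : ℕ} {σ : State} {Q : List (Fin n)} (hE : Env adj σ)
    (hQ : Holds σ 14 Q) (hQn : Q.length = n) :
    Tri V reverseOrder σ fun k τ => k = n ∧ Holds τ 20 Q.reverse := by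
  refine (for_rule (by decide) (by simp) (by simp) hE.size (fun i K τ => K = i ∧
    Holds τ 20 (Q.reverse.take i)) ⟨rfl, fun i hi => by simp at hi⟩ ?_).mono ?_
  · rintro i hi K τ ⟨hK, hR⟩ h3 hs
    have hiR : i < Q.reverse.length := by simp; omega
    have h1 : τ.var 1 = n := by rw [hs.1 1 (by simp)]; exact hE.size
    have h14 : τ.arr 14 (n - 1 - i) = (Q.reverse[i] : ℕ) := by
      rw [hs.2 14 (by simp), hQ _ (by omega), List.getElem_reverse]
      simp [hQn]
    simp only [tri_store, Expr.Ok, Expr.eval, h1, h3, h14, le_refl, and_self, true_and]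
    refine ⟨by omega, ?_⟩
    rw [List.take_succ_eq_append_getElem hiR]
    refine hR.append ?_
    have : (Q.reverse.take i).length = i := by rw [List.length_take]; omega
    simp [this]
  · rintro k τ - ⟨hk, hR⟩
    rw [List.take_of_length_le (by simp; omega)] at hR
    exact ⟨hk, hR⟩

/-- Two breadth-first searches: the first starts from and prefers vertices of large degree, the
second breaks ties by the reversed order of the first. The order is in array `24`, and a coloring
in array `25`. -/
def orderVertices : Prog :=
  .seq setup (.seq sortByDegree (.seq (sortLists 0) (.seq (bfs 0) (.seq reverseOrder
    (.seq (sortLists 10) (bfs 10))))))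

theorem idxOf_reverse_of_nodup {α : Type*} [BEq α] [LawfulBEq α] {Q : List α} (hQ : Q.Nodup) {x : α}
    (hx : x ∈ Q) : Q.reverse.idxOf x = Q.length - 1 - Q.idxOf x := by
  have hi := List.idxOf_lt_length_of_mem hx
  have hlt : Q.length - 1 - Q.idxOf x < Q.reverse.length := by simp; omega
  have : Q.reverse[Q.length - 1 - Q.idxOf x] = x := by
    rw [List.getElem_reverse]
    simp only [show Q.length - 1 - (Q.length - 1 - Q.idxOf x) = Q.idxOf x by omega]
    exact List.getElem_idxOf hi
  conv_lhs => rw [← this]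
  exact (List.nodup_reverse.2 hQ).idxOf_getElem _ hlt

theorem length_eq_of_nodup {Q : List (Fin n)} (hQ : Q.Nodup) (hmem : ∀ v, v ∈ Q) :
    Q.length = n := by
  rw [← List.toFinset_card_of_nodup hQ, show Q.toFinset = Finset.univ by ext v; simp [hmem]]
  simp

theorem isTwin_of_length_le (hadj : IsAdjacencyLists G adj) {x y : Fin n}
    (hle : (adj y).length ≤ (adj x).length) (h : ∀ z, G.Adj x z → G.Adj y z) : IsTwin G x y := by
  have hsub : (adj x).toFinset ⊆ (adj y).toFinset := by
    intro z
    simp only [List.mem_toFinset, (hadj x).2, (hadj y).2]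
    exact h z
  have heq := Finset.eq_of_subset_of_card_le hsub (by
    rwa [List.toFinset_card_of_nodup (hadj x).1, List.toFinset_card_of_nodup (hadj y).1])
  intro z
  rw [← (hadj x).2, ← (hadj y).2, ← List.mem_toFinset, heq, List.mem_toFinset]

/-- The coloring that is stored in array `25`. -/
def storedColor (σ : State) (v : Fin n) : Bool := decide (σ.arr 25 v = 1)

variable (G) in
/-- Array `24` contains the vertices in the order of the list `Q`, which is a strong ordering for
the coloring in array `25`. -/
structure IsOrdered (Q : List (Fin n)) (σ : State) : Prop where
  nodup : Q.Nodup
  mem : ∀ v, v ∈ Q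
  holds : Holds σ 24 Q
  coloring : IsTwoColoring G (storedColor σ)
  strong : IsStrongOrdering G (storedColor σ) fun v => Q.idxOf v
  exists_adj : ∀ v, storedColor σ v = true → ∃ w, G.Adj v w

theorem orderVertices_spec {V : ℕ} (hadj : IsAdjacencyLists G adj) (hG : IsPermutationGraph G)
    (hbip : G.IsBipartite) (hV : listStart adj n ≤ V) :
    Tri V orderVertices (State.init (encodeAdjacencyLists adj)) fun k τ =>
      k ≤ 7 * n + 4 * listStart adj n ∧ Env adj τ ∧ ∃ Q, IsOrdered G Q τ := by
  obtain ⟨κ, hκ⟩ : ∃ κ : Fin n → Bool, IsTwoColoring G κ := by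
    obtain ⟨C⟩ := hbip
    refine ⟨fun v => C v = 0, fun x y hxy => ?_⟩
    have := C.valid hxy
    simp only [ne_eq, decide_eq_decide]
    omega
  have hlt : ∀ v, (adj v).length < n := by
    intro v
    have hsub : (adj v).toFinset ⊆ Finset.univ.erase v := by
      intro z
      simp only [List.mem_toFinset, (hadj v).2, Finset.mem_erase, Finset.mem_univ, and_true]
      exact fun h => h.ne'
    have := Finset.card_le_card hsub
    rw [List.toFinset_card_of_nodup (hadj v).1, Finset.card_erase_of_mem (Finset.mem_univ v),
      Finset.card_fin] at this
    have := v.2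
    omega
  have hinit : ∀ a i, a ≠ 0 → (State.init (encodeAdjacencyLists adj)).arr a i = 0 := by
    intro a i ha; simp [State.init, ha]
  rw [orderVertices, tri_seq]
  refine (setup_spec hV).mono ?_
  rintro k₁ σ₁ hs₁ ⟨hk₁, hE₁⟩
  rw [tri_seq]
  refine (sortByDegree_spec hE₁ hlt fun i => ?_).mono ?_
  · rw [hs₁.2 2 (by simp [setup]), hinit _ _ (by decide)]
  rintro k₂ σ₂ hs₂ ⟨hk₂, L, hLnd, hLmem, hLdeg, hL₂⟩
  have hE₂ := hE₁.of_same hs₂ (by simp [sortByDegree]) (by simp [sortByDegree])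
    (by simp [sortByDegree])
  have hLn := length_eq_of_nodup hLnd hLmem
  rw [tri_seq]
  refine (sortLists_spec (b := 0) hadj hE₂ hV hLnd hLmem hLn hL₂ fun i => ?_).mono ?_
  · rw [hs₂.2 11 (by simp [sortByDegree]), hs₁.2 11 (by simp [setup]), hinit _ _ (by decide)]
  rintro k₃ σ₃ hs₃ ⟨hk₃, ht₃⟩
  have hE₃ := hE₂.of_same hs₃ (by simp [sortLists]) (by simp [sortLists]) (by simp [sortLists])
  have hL₃ : Holds σ₃ 10 L := hL₂.of_eq (hs₃.2 10 (by simp [sortLists]))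
  have h₃ : ∀ a i, a ≠ 0 → a ≠ 1 → a ≠ 2 → a ≠ 3 → a ≠ 10 → a ≠ 11 → a ≠ 12 →
      σ₃.arr a i = 0 := by
    intro a i h0 h1 h2 h3 h4 h5 h6
    rw [hs₃.2 a (by simp [sortLists, *]), hs₂.2 a (by simp [sortByDegree, *]),
      hs₁.2 a (by simp [setup, *]), hinit _ _ h0]
  rw [tri_seq]
  refine (bfs_spec (b := 0) hadj hκ hLnd hLmem hLn hE₃ hV hL₃ ht₃ (fun i => h₃ _ i (by decide)
    (by decide) (by decide) (by decide) (by decide) (by decide) (by decide)) (fun i => h₃ _ i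
    (by decide) (by decide) (by decide) (by decide) (by decide) (by decide) (by decide))).mono ?_
  rintro k₄ σ₄ hs₄ ⟨hk₄, Q₁, hQ₁mem, hB₁⟩
  have hE₄ := hE₃.of_same hs₄ (by simp [bfs, exhaustQueue, visitNeighbor])
    (by simp [bfs, exhaustQueue, visitNeighbor]) (by simp [bfs, exhaustQueue, visitNeighbor])
  have hQ₁nd := hB₁.sweep.nodup
  have hQ₁n := length_eq_of_nodup hQ₁nd hQ₁mem
  rw [tri_seq]
  refine (reverseOrder_spec hE₄ hB₁.queue hQ₁n).mono ?_
  rintro k₅ σ₅ hs₅ ⟨hk₅, hR₅⟩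
  have hE₅ := hE₄.of_same hs₅ (by simp [reverseOrder]) (by simp [reverseOrder])
    (by simp [reverseOrder])
  have h₅ : ∀ a i, 21 ≤ a → σ₅.arr a i = 0 := by
    intro a i ha
    rw [hs₅.2 a (by simp [reverseOrder]; omega), hs₄.2 a (by
      simp [bfs, exhaustQueue, visitNeighbor]; omega), h₃] <;> omega
  have hRnd : Q₁.reverse.Nodup := List.nodup_reverse.2 hQ₁nd
  have hRmem : ∀ v, v ∈ Q₁.reverse := fun v => List.mem_reverse.2 (hQ₁mem v)
  have hRn : Q₁.reverse.length = n := by simpa using hQ₁n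
  rw [tri_seq]
  refine (sortLists_spec (b := 10) hadj hE₅ hV hRnd hRmem hRn hR₅ fun i =>
    h₅ _ i (by decide)).mono ?_
  rintro k₆ σ₆ hs₆ ⟨hk₆, ht₆⟩
  have hE₆ := hE₅.of_same hs₆ (by simp [sortLists]) (by simp [sortLists]) (by simp [sortLists])
  have hR₆ : Holds σ₆ 20 Q₁.reverse := hR₅.of_eq (hs₆.2 20 (by simp [sortLists]))
  refine (bfs_spec (b := 10) hadj hκ hRnd hRmem hRn hE₆ hV hR₆ ht₆ (fun i => ?_)
    (fun i => ?_)).mono ?_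
  · rw [hs₆.2 _ (by simp [sortLists]), h₅ _ _ (by decide)]
  · rw [hs₆.2 _ (by simp [sortLists]), h₅ _ _ (by decide)]
  rintro k₇ σ₇ hs₇ ⟨hk₇, Q, hQmem, hB⟩
  have hE₇ := hE₆.of_same hs₇ (by simp [bfs, exhaustQueue, visitNeighbor])
    (by simp [bfs, exhaustQueue, visitNeighbor]) (by simp [bfs, exhaustQueue, visitNeighbor])
  have hcol : IsTwoColoring G (storedColor σ₇) := by
    intro x y hxy heq
    refine hκ x y hxy ((hB.color_iff x (hQmem x) y (hQmem y) hxy.reachable).1 ?_)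
    have hx := hB.color_le x
    have hy := hB.color_le y
    simp only [storedColor, decide_eq_decide] at heq
    change σ₇.arr 25 x = σ₇.arr 25 y
    change σ₇.arr 25 x ≤ 1 at hx
    change σ₇.arr 25 y ≤ 1 at hy
    omega
  refine ⟨by omega, hE₇, Q, hB.sweep.nodup, hQmem, hB.queue, hcol, ?_, fun v hv => ?_⟩
  · refine (hB₁.sweep.isSweep hQ₁mem).isStrongOrdering hG hcol (fun x y hxy hsub => ?_)
      (hB.sweep.isSweep hQmem) fun x y hxy => ?_
    · refine isTwin_of_length_le hadj ?_ hsub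
      have hx := List.idxOf_lt_length_of_mem (hLmem x)
      have hy := List.idxOf_lt_length_of_mem (hLmem y)
      have := List.pairwise_iff_getElem.1 hLdeg _ _ hx hy hxy
      rwa [List.getElem_idxOf, List.getElem_idxOf] at this
    · have hx := List.idxOf_lt_length_of_mem (hQ₁mem x)
      have hy := List.idxOf_lt_length_of_mem (hQ₁mem y)
      rw [idxOf_reverse_of_nodup hQ₁nd (hQ₁mem x), idxOf_reverse_of_nodup hQ₁nd (hQ₁mem y)] at hxy
      omega
  · exact hB.color_adj v (by simpa [storedColor] using hv)

/-! ### The ranks of the columns -/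

/-- Number the vertices of color `1` in the order of array `24`; the numbers are in array `30`. -/
def rankColumns : Prog :=
  .seq (.assign 2 (.const 0))
    (.forLoop 3 1 (.seq (.assign 4 (.arr 24 (.var 3)))
      (.ite (.eq (.arr 25 (.var 4)) (.const 1))
        (.seq (.store 30 (.var 4) (.var 2)) (.assign 2 (.add (.var 2) (.const 1))))
        .skip)))

theorem columnRank_idxOf {col : Fin n → Bool} {Q : List (Fin n)} (hQ : Q.Nodup)
    (hmem : ∀ v, v ∈ Q) {i : ℕ} (hi : i < Q.length) :
    columnRank col (fun v => Q.idxOf v) Q[i] = ((Q.take i).filter col).length := by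
  rw [columnRank, ← List.toFinset_card_of_nodup ((hQ.sublist (List.take_sublist i Q)).filter col),
    ← Set.ncard_coe_finset]
  congr 1
  ext v
  have hv := List.idxOf_lt_length_of_mem (hmem v)
  simp only [hQ.idxOf_getElem, Set.mem_ofPred_eq, Finset.mem_coe, List.mem_toFinset,
    List.mem_filter, List.mem_take_iff_getElem]
  rw [and_comm]
  refine and_congr_left fun _ => ⟨fun h => ⟨Q.idxOf v, by omega, List.getElem_idxOf hv⟩, ?_⟩
  rintro ⟨j, hj, rfl⟩
  rw [hQ.idxOf_getElem]
  omega

theorem rankColumns_spec {V : ℕ} {σ : State} {Q : List (Fin n)} (hE : Env adj σ)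
    (hQ : IsOrdered G Q σ) :
    Tri V rankColumns σ fun k τ => k = n ∧ ∀ w, storedColor σ w = true →
      τ.arr 30 w = columnRank (storedColor σ) (fun v => Q.idxOf v) w := by
  have hQn := length_eq_of_nodup hQ.nodup hQ.mem
  simp only [rankColumns, tri_seq, tri_assign, Expr.Ok, Expr.eval, zero_le, true_and]
  refine (for_rule (by decide) (by simp) (by simp) (n := n) (by simpa using hE.size)
    (fun i K τ => K = i ∧ τ.var 2 = ((Q.take i).filter (storedColor σ)).length ∧
      ∀ w ∈ Q.take i, storedColor σ w = true →
        τ.arr 30 w = columnRank (storedColor σ) (fun v => Q.idxOf v) w)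
    ⟨rfl, by simp, by simp⟩ ?_).mono ?_
  · rintro i hi K τ ⟨hK, h2, h30⟩ h3 hs
    have hiQ : i < Q.length := by omega
    have h24 : τ.arr 24 i = Q[i] := by rw [hs.2 24 (by simp)]; exact hQ.holds i hiQ
    have h25 : τ.arr 25 = σ.arr 25 := by rw [hs.2 25 (by simp)]; rfl
    have htake := List.take_succ_eq_append_getElem hiQ
    simp only [tri_seq, tri_assign, tri_ite, tri_store, tri_skip, Expr.Ok, Expr.eval, Test.Ok,
      Test.Holds, State.setVar_var, State.setVar_arr, State.setArr_var, h3, h24, h25, if_true,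
      true_and, le_refl]
    refine ⟨fun hc => ⟨by simp, by omega, ?_, fun w hw hcw => ?_⟩, fun hc => ⟨by omega, ?_,
      fun w hw hcw => ?_⟩⟩
    · rw [htake, List.filter_append]
      simp [storedColor, hc, h2]
    · simp only [State.setVar_arr, State.setArr_arr, if_true, Function.update_apply,
        ← Fin.ext_iff, show ¬ (2 : ℕ) = 4 by decide, if_false]
      split_ifs with h
      · rw [h, columnRank_idxOf hQ.nodup hQ.mem hiQ, h2]
      · rw [htake, List.mem_append, List.mem_singleton] at hw
        exact h30 w (hw.resolve_right h) hcw
    · rw [htake, List.filter_append]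
      simp [storedColor, hc, h2]
    · rw [htake, List.mem_append, List.mem_singleton] at hw
      rcases hw with hw | rfl
      · exact h30 w hw hcw
      · exact absurd (by simpa [storedColor] using hcw) hc
  · rintro k τ - ⟨hk, -, h⟩
    rw [List.take_of_length_le hQn.le] at h
    exact ⟨by omega, fun w => h w (hQ.mem w)⟩

end Ram

/-! ### The dynamic program in constant time per cell -/

namespace Staircase

/-- The number of rows before row `i` that end before column `e` and have at least `y` cells. -/
def rowCount (l d : ℕ → ℕ) (i e y : ℕ) : ℕ :=
  ((Finset.range i).filter fun a => 0 < d a ∧ l a + d a = e ∧ y ≤ d a).card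

/-- Row `a` is the first nonempty row with its last column. -/
def IsHead (l d : ℕ → ℕ) (a : ℕ) : Prop :=
  0 < d a ∧ ∀ a' < a, 0 < d a' → l a' + d a' ≠ l a + d a

/-- The function `h` assigns to each column the address `s a` of the first row `a < i` with this
last column, and `0` if there is no such row. -/
def IsHeadTable (l d s : ℕ → ℕ) (i : ℕ) (h : ℕ → ℕ) : Prop :=
  ∀ j, (h j = 0 ∧ ∀ a < i, 0 < d a → l a + d a ≠ j + 1) ∨
    ∃ a < i, IsHead l d a ∧ l a + d a = j + 1 ∧ h j = s a

variable {l d s : ℕ → ℕ}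

theorem rowCount_succ {i e y : ℕ} : rowCount l d (i + 1) e y =
    rowCount l d i e y + if 0 < d i ∧ l i + d i = e ∧ y ≤ d i then 1 else 0 := by
  rw [rowCount, Finset.range_add_one, Finset.filter_insert]
  split_ifs
  · rw [Finset.card_insert_of_notMem (by simp), rowCount]
  · rfl

theorem mul_rowCount_le {i e y : ℕ} : y * rowCount l d i e y ≤ ∑ a ∈ Finset.range i, d a := by
  rw [rowCount, mul_comm, ← smul_eq_mul]
  refine (Finset.card_nsmul_le_sum _ d y fun a ha => (Finset.mem_filter.1 ha).2.2.2).trans ?_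
  exact Finset.sum_le_sum_of_subset (Finset.filter_subset _ _)

/-- The rows that end inside row `i` begin before it, hence are long enough to be counted. -/
theorem endCount_eq_rowCount (hm : IsMono l d) {i j : ℕ} (hi : 0 < d i) :
    endCount l d i j = rowCount l d i (j + 1) (j + 1 - l i) := by
  rw [endCount, rowCount]
  congr 1
  refine Finset.filter_congr fun a ha => ⟨fun h => ⟨h.1, h.2, ?_⟩, fun h => ⟨h.1, h.2.1⟩⟩
  have := (hm a i (Finset.mem_range.1 ha) h.1 hi).1
  omega

theorem IsHead.length_le (hm : IsMono l d) {a b : ℕ} (ha : IsHead l d a) (hb : 0 < d b)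
    (hab : l a + d a = l b + d b) : d b ≤ d a := by
  rcases lt_trichotomy a b with h | rfl | h
  · have := (hm a b h ha.1 hb).1
    omega
  · exact le_rfl
  · exact absurd hab.symm (ha.2 b h hb)

theorem IsHead.eq {a b : ℕ} (ha : IsHead l d a) (hb : IsHead l d b)
    (hab : l a + d a = l b + d b) : a = b := by
  rcases lt_trichotomy a b with h | h | h
  · exact absurd hab (hb.2 a h ha.1)
  · exact h
  · exact absurd hab.symm (ha.2 b h hb.1)

theorem val_succ_of_mem {i j : ℕ} (h : l i ≤ j) (h' : j < l i + d i) : val l d (i + 1) j =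
    rowVal (val l d i) (endCount l d i) (l i) (d i) (l i + d i - 1 - j) := by
  rw [val, if_pos ⟨h, h'⟩]

theorem rowVal_le (hm : IsMono l d) {i k : ℕ} (hk : k < d i) :
    rowVal (val l d i) (endCount l d i) (l i) (d i) k ≤ ∑ a ∈ Finset.range (i + 1), d a := by
  have := val_le hm (i + 1) (l i + d i - 1 - k)
  rwa [val_succ_of_mem (by omega) (by omega),
    show l i + d i - 1 - (l i + d i - 1 - k) = k by omega] at this

theorem IsHeadTable.succ_of_eq_zero {i : ℕ} {h : ℕ → ℕ} (hh : IsHeadTable l d s i h)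
    (hd : d i = 0) : IsHeadTable l d s (i + 1) h := by
  intro j
  rcases hh j with ⟨h0, hn⟩ | ⟨a, ha, h'⟩
  · refine Or.inl ⟨h0, fun a ha hpos => ?_⟩
    rcases Nat.lt_succ_iff_lt_or_eq.1 ha with h | rfl
    · exact hn a h hpos
    · omega
  · exact Or.inr ⟨a, by omega, h'⟩

/-- Enter row `i` into the table, unless an earlier row has the same last column. -/
theorem IsHeadTable.succ {i : ℕ} {h h' : ℕ → ℕ} (hh : IsHeadTable l d s i h) (hd : 0 < d i)
    (hs : ∀ a < i, 0 < s a)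
    (hh' : h' = Function.update h (l i + d i - 1)
      (if h (l i + d i - 1) = 0 then s i else h (l i + d i - 1))) :
    IsHeadTable l d s (i + 1) h' := by
  intro j
  rw [hh', Function.update_apply]
  by_cases hj : j = l i + d i - 1
  · subst hj
    rw [if_pos rfl]
    rcases hh (l i + d i - 1) with ⟨h0, hn⟩ | ⟨a, ha, hhead, hend, heq⟩
    · rw [if_pos h0]
      refine Or.inr ⟨i, by omega, ⟨hd, fun a ha hpos => ?_⟩, by omega, rfl⟩
      have := hn a ha hpos
      omega
    · have := hs a ha
      rw [if_neg (by omega)]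
      exact Or.inr ⟨a, by omega, hhead, hend, heq⟩
  · rw [if_neg hj]
    rcases hh j with ⟨h0, hn⟩ | ⟨a, ha, hrest⟩
    · refine Or.inl ⟨h0, fun a ha hpos => ?_⟩
      rcases Nat.lt_succ_iff_lt_or_eq.1 ha with h | rfl
      · exact hn a h hpos
      · omega
    · exact Or.inr ⟨a, by omega, hrest⟩

end Staircase

namespace Ram

open Staircase

/-- The numbers that the dynamic program on the rows `a < n` handles are bounded by `V`, and the
blocks of memory cells `s a + y`, `y ≤ d a`, are disjoint. -/
structure IsBlockSystem (V n : ℕ) (l d s : ℕ → ℕ) : Prop where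
  mono : IsMono l d
  pos : ∀ a < n, 0 < s a
  inj : ∀ a < n, ∀ b < n, ∀ y ≤ d a, ∀ z ≤ d b, s a + y = s b + z → a = b
  sum_le : ∑ a ∈ Finset.range n, d a ≤ V
  block_le : ∀ a < n, s a + d a ≤ V
  end_le : ∀ a < n, 0 < d a → l a + d a ≤ V

/-- The state of the dynamic program after `i` rows. Array `31` contains the values, array `32` the
addresses of blocks in array `33`. The block of the first row with a given last column contains at
`y` the number `y` multiplied by the number of rows with at least `y` cells and this last
column. -/
structure DynState (n : ℕ) (l d s : ℕ → ℕ) (i : ℕ) (σ : State) : Prop where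
  best : σ.var 0 = best l d i
  value : ∀ j, σ.arr 31 j = val l d i j
  head : IsHeadTable l d s i (σ.arr 32)
  count : ∀ a < n, IsHead l d a → ∀ y, 0 < y → y ≤ d a →
    σ.arr 33 (s a + y) = y * rowCount l d i (l a + d a) y

/-- The state of the dynamic program inside row `i`, when `y` cells of the row remain; the next cell
is in column `l i + y - 1`. Variable `11` contains the value of the previous cell, variable `12` the
address of the block of the first row with the last column of row `i`. Row `i` has been counted in
this block at the arguments larger than `y`. -/
structure RowState (n : ℕ) (l d s : ℕ → ℕ) (i y : ℕ) (σ : State) : Prop where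
  le : y ≤ d i
  column : σ.var 9 = l i + y - 1
  last : σ.var 10 = l i + d i - 1
  rest : σ.var 13 = y
  current : σ.var 11 = if y = d i then 0 else
    rowVal (val l d i) (endCount l d i) (l i) (d i) (d i - y - 1)
  block : ∃ f < n, IsHead l d f ∧ l f + d f = l i + d i ∧ σ.var 12 = s f
  best : σ.var 0 = best l d i
  value : ∀ j, σ.arr 31 j = if l i + y ≤ j ∧ j < l i + d i then
    rowVal (val l d i) (endCount l d i) (l i) (d i) (l i + d i - 1 - j) else val l d i j
  head : IsHeadTable l d s (i + 1) (σ.arr 32)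
  count : ∀ a < n, IsHead l d a → ∀ z, 0 < z → z ≤ d a → σ.arr 33 (s a + z) =
    z * (rowCount l d i (l a + d a) z + if l a + d a = l i + d i ∧ y < z ∧ z ≤ d i then 1 else 0)

/-- Replace variable `x` by the maximum of the variables `x` and `y`. -/
def Prog.raise (x y : ℕ) : Prog := .ite (.lt (.var x) (.var y)) (.assign x (.var y)) .skip

@[simp] theorem Prog.noVar_raise {x y z : ℕ} : (Prog.raise x y).NoVar z ↔ z ≠ x := by
  simp [Prog.raise]

@[simp] theorem Prog.noArr_raise {x y a : ℕ} : (Prog.raise x y).NoArr a := by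
  simp [Prog.raise]

theorem raise_spec {V x y : ℕ} {σ : State} :
    Tri V (Prog.raise x y) σ fun k τ => k = 0 ∧ τ.var x = max (σ.var x) (σ.var y) := by
  simp only [Prog.raise, tri_ite, tri_assign, tri_skip, Test.Ok, Test.Holds, Expr.Ok, Expr.eval,
    State.setVar_var, if_true, true_and]
  exact ⟨fun h => by omega, fun h => by omega⟩

/-- Add the contribution of the rows that end in the column of the current cell. -/
def addEnds : Prog :=
  .ite (.and (.lt (.var 9) (.var 10)) (.lt (.const 0) (.arr 32 (.var 9))))
    (.assign 11 (.add (.var 11) (.arr 33 (.add (.arr 32 (.var 9)) (.var 13))))) .skip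

/-- One cell of the dynamic program. -/
def cellStep : Prog :=
  .seq addEnds
    (.seq (.assign 14 (.add (.arr 31 (.var 9)) (.var 13)))
      (.seq (.raise 11 14)
        (.seq (.store 31 (.var 9) (.var 11))
          (.seq (.store 33 (.add (.var 12) (.var 13))
              (.add (.arr 33 (.add (.var 12) (.var 13))) (.var 13)))
            (.seq (.assign 9 (.sub (.var 9) (.const 1)))
              (.assign 13 (.sub (.var 13) (.const 1))))))))

/-- The rows that end in the column of the current cell have at least `y` cells, so that their
number multiplied by `y` is the entry at `y` in the block of the first of them. -/
theorem addEnds_spec {V n i y : ℕ} {l d s : ℕ → ℕ} {σ : State} (hS : IsBlockSystem V n l d s)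
    (hi : i < n) (hy : 0 < y) (h : RowState n l d s i y σ) :
    Tri V addEnds σ fun k τ => k = 0 ∧ τ.var 11 = if y = d i then 0 else
      rowVal (val l d i) (endCount l d i) (l i) (d i) (d i - y - 1) +
        endCount l d i (l i + y - 1) * y := by
  have hle := h.le
  have hdi : 0 < d i := by omega
  have hec := endCount_eq_rowCount hS.mono (j := l i + y - 1) hdi
  rw [show l i + y - 1 + 1 - l i = y by omega, show l i + y - 1 + 1 = l i + y by omega] at hec
  have hcur := h.current
  simp only [addEnds, tri_ite, tri_assign, tri_skip, Test.Ok, Test.Holds, Expr.Ok, Expr.eval,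
    State.setVar_var, if_true, true_and, h.column, h.last, h.rest, zero_le]
  refine ⟨fun hb => ?_, fun hb => ?_⟩
  · have hne : y ≠ d i := by omega
    rw [if_neg hne] at hcur
    rcases h.head (l i + y - 1) with ⟨h0, -⟩ | ⟨a, ha, hhead, hend, heq⟩
    · omega
    · have hai : a ≠ i := by rintro rfl; omega
      have hmono := (hS.mono a i (by omega) hhead.1 hdi).1
      have hcount := h.count a (by omega) hhead y hy (by omega)
      rw [if_neg (by omega), show l a + d a = l i + y by omega, add_zero, ← hec] at hcount
      have hbl := hS.block_le a (by omega)
      have hstep : rowVal (val l d i) (endCount l d i) (l i) (d i) (d i - y - 1) +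
          endCount l d i (l i + y - 1) * y ≤
          rowVal (val l d i) (endCount l d i) (l i) (d i) (d i - y - 1 + 1) := by
        rw [rowVal, show l i + d i - 1 - (d i - y - 1 + 1) = l i + y - 1 by omega,
          show d i - (d i - y - 1 + 1) = y by omega]
        exact le_max_right _ _
      have hrv := rowVal_le hS.mono (show d i - y - 1 + 1 < d i by omega)
      have hsum := (Finset.sum_le_sum_of_subset (f := d)
        (Finset.range_subset_range.2 (show i + 1 ≤ n from hi))).trans hS.sum_le
      rw [heq, hcount, hcur, if_neg hne, mul_comm y]
      exact ⟨⟨Or.inr (by omega), Or.inr (by omega)⟩, rfl⟩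
  · rw [hcur]
    split_ifs with hyd
    · rfl
    · rcases h.head (l i + y - 1) with ⟨h0, hn⟩ | ⟨a, ha, hhead, hend, heq⟩
      · have : endCount l d i (l i + y - 1) = 0 := by
          rw [endCount, Finset.card_eq_zero, Finset.filter_eq_empty_iff]
          intro a ha hcon
          exact hn a (by have := Finset.mem_range.1 ha; omega) hcon.1 hcon.2
        rw [this]; simp
      · have := hS.pos a (by omega)
        omega

/-- The cell at which row `i` is counted does not interfere with later reads in the same row, since
earlier columns belong to other blocks. -/
theorem cellStep_spec {V n i y : ℕ} {l d s : ℕ → ℕ} {σ : State} (hS : IsBlockSystem V n l d s)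
    (hi : i < n) (hy : 0 < y) (h : RowState n l d s i y σ) :
    Tri V cellStep σ fun k τ => k = 0 ∧ RowState n l d s i (y - 1) τ := by
  have hle := h.le
  have hsum := (Finset.sum_le_sum_of_subset (f := d)
    (Finset.range_subset_range.2 (show i + 1 ≤ n from hi))).trans hS.sum_le
  rw [Finset.sum_range_succ] at hsum
  have hval := val_le hS.mono i (l i + y - 1)
  obtain ⟨f, hf, hfh, hfe, h12⟩ := h.block
  have hdf := hfh.length_le hS.mono (by omega) hfe
  have hbl := hS.block_le f hf
  rw [cellStep, tri_seq]
  refine (addEnds_spec hS hi hy h).mono ?_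
  rintro k τ hs ⟨rfl, h11⟩
  have harr : τ.arr = σ.arr := funext fun a => hs.2 a (by simp [addEnds])
  have h9 : τ.var 9 = l i + y - 1 := by rw [hs.1 9 (by simp [addEnds]), h.column]
  have h13 : τ.var 13 = y := by rw [hs.1 13 (by simp [addEnds]), h.rest]
  have hv : σ.arr 31 (l i + y - 1) = val l d i (l i + y - 1) := by
    rw [h.value, if_neg (by omega)]
  simp only [tri_seq, tri_assign, Expr.Ok, Expr.eval, harr, h9, h13, hv, true_and]
  refine ⟨Or.inr (by omega), raise_spec.mono ?_⟩
  rintro k υ hs' ⟨rfl, h11'⟩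
  have harr' : υ.arr = σ.arr := by
    rw [← harr]; exact funext fun a => by rw [hs'.2 a (by simp)]; rfl
  have hvar : ∀ x, x ≠ 11 → x ≠ 14 → υ.var x = σ.var x := by
    intro x hx hx'
    rw [hs'.1 x (by simpa using hx), State.setVar_var, if_neg hx',
      hs.1 x (by simpa [addEnds] using hx)]
  have hnew : υ.var 11 = rowVal (val l d i) (endCount l d i) (l i) (d i) (d i - y) := by
    rw [h11']
    simp only [State.setVar_var, if_true, show ¬ (11 : ℕ) = 14 by decide, if_false, h11]
    split_ifs with hyd
    · rw [← hyd, Nat.sub_self, rowVal]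
      simp
    · obtain ⟨k, hk⟩ : ∃ k, d i - y = k + 1 := ⟨d i - y - 1, by omega⟩
      rw [hk, rowVal, ← hk, show l i + d i - 1 - (d i - y) = l i + y - 1 by omega,
        show d i - (d i - y) = y by omega, max_comm, hk, Nat.add_sub_cancel]
  have hc := h.count f hf hfh y hy (by omega)
  rw [if_neg (by omega), add_zero] at hc
  have hcle : y * rowCount l d i (l f + d f) y ≤ _ := mul_rowCount_le
  simp only [tri_store, Expr.Ok, Expr.eval, State.setArr_var, harr',
    State.setArr_arr, State.setVar_var, hvar 9 (by decide) (by decide), h.column,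
    hvar 12 (by decide) (by decide), h12, hvar 13 (by decide) (by decide), h.rest, hnew, true_and,
    show ¬ (33 : ℕ) = 31 by decide, if_false, hc, le_refl,
    show ¬ (13 : ℕ) = 9 by decide]
  refine ⟨Or.inr (by omega), ⟨Or.inr (by omega), Or.inr (by omega)⟩, ?_⟩
  refine ⟨by omega, ?_, ?_, ?_, ?_, ?_, ?_, fun j => ?_, ?_, fun a ha hah z hz hza => ?_⟩
  · simp; omega
  · simp [hvar 10 (by decide) (by decide), h.last]
  · simp
  · rw [if_neg (by omega), show d i - (y - 1) - 1 = d i - y by omega]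
    simpa using hnew
  · exact ⟨f, hf, hfh, hfe, by simp [hvar 12 (by decide) (by decide), h12]⟩
  · simp [hvar 0 (by decide) (by decide), h.best]
  · simp only [State.setVar_arr, State.setArr_arr, harr', show ¬ (31 : ℕ) = 33 by decide, if_false,
      if_true, Function.update_apply]
    split_ifs with h1 h2 h2
    · rw [h1, show l i + d i - 1 - (l i + y - 1) = d i - y by omega]
    · omega
    · rw [h.value, if_pos (by omega)]
    · rw [h.value, if_neg (by omega)]
  · simpa [harr'] using h.head
  · simp only [State.setVar_arr, State.setArr_arr, harr', if_true, Function.update_apply,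
      show ¬ (33 : ℕ) = 31 by decide, if_false]
    split_ifs with h1 h2 h2
    · obtain rfl := hS.inj a ha f hf z hza y (by omega) h1
      obtain rfl : z = y := by omega
      rw [mul_add, mul_one]
    · obtain rfl := hS.inj a ha f hf z hza y (by omega) h1
      exact absurd ⟨hfe, by omega, by omega⟩ h2
    · have hzy : z ≠ y := by
        rintro rfl
        exact h1 (by rw [hah.eq hfh (by omega)])
      rw [h.count a ha hah z hz hza, if_pos (by omega)]
    · rw [h.count a ha hah z hz hza, if_neg (by omega)]

/-- One row of the dynamic program, for the vertex in variable `4`; variable `8` contains the first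
column and variable `13` the length of the row. -/
def rowStep : Prog :=
  .seq (.assign 9 (.sub (.add (.var 8) (.var 13)) (.const 1)))
    (.seq (.ite (.eq (.arr 32 (.var 9)) (.const 0)) (.store 32 (.var 9) (.arr 1 (.var 4))) .skip)
      (.seq (.assign 12 (.arr 32 (.var 9)))
        (.seq (.assign 10 (.var 9))
          (.seq (.assign 11 (.const 0))
            (.seq (.while (.lt (.const 0) (.var 13)) cellStep) (.raise 0 11))))))

theorem rowStep_spec {V n i : ℕ} {l d s : ℕ → ℕ} {σ : State} (hS : IsBlockSystem V n l d s)
    (hi : i < n) (hd : 0 < d i) (h : DynState n l d s i σ) (h8 : σ.var 8 = l i)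
    (h13 : σ.var 13 = d i) (h1 : σ.arr 1 (σ.var 4) = s i) :
    Tri V rowStep σ fun k τ => k = d i ∧ DynState n l d s (i + 1) τ := by
  have hend := hS.end_le i hi hd
  simp only [rowStep, tri_seq, tri_assign, Expr.Ok, Expr.eval, h8, h13, le_refl, true_and, and_true]
  refine ⟨Or.inr hend, ?_⟩
  have hhead : Tri V (.ite (.eq (.arr 32 (.var 9)) (.const 0))
      (.store 32 (.var 9) (.arr 1 (.var 4))) .skip) (σ.setVar 9 (l i + d i - 1)) fun k τ =>
      k = 0 ∧ IsHeadTable l d s (i + 1) (τ.arr 32) := by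
    have key := fun h' => h.head.succ (h' := h') hd fun a ha => hS.pos a (by omega)
    simp only [tri_ite, tri_store, tri_skip, Test.Ok, Test.Holds, Expr.Ok, Expr.eval, true_and,
      State.setVar_var, State.setVar_arr, State.setArr_arr, if_true, zero_le,
      show ¬ (4 : ℕ) = 9 by decide, if_false, h1]
    refine ⟨fun hb => key _ ?_, fun hb => key _ ?_⟩
    · rw [if_pos hb]
    · rw [if_neg hb, Function.update_eq_self]
  refine hhead.mono ?_
  rintro k τ hs ⟨rfl, hH⟩
  have hvar : ∀ x, x ≠ 9 → τ.var x = σ.var x := by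
    intro x hx
    rw [hs.1 x (by simp), State.setVar_var, if_neg hx]
  have hτ9 : τ.var 9 = l i + d i - 1 := by rw [hs.1 9 (by simp)]; simp
  have harr : ∀ a, a ≠ 32 → τ.arr a = σ.arr a := fun a ha => hs.2 a (by simpa using ha)
  simp only [State.setVar_var, hτ9, zero_le, true_and,
    show ¬ (9 : ℕ) = 12 by decide, if_false]
  obtain ⟨f, hf, hfh, hfe, hfs⟩ : ∃ f < n, IsHead l d f ∧ l f + d f = l i + d i ∧
      τ.arr 32 (l i + d i - 1) = s f := by
    rcases hH (l i + d i - 1) with ⟨-, hn⟩ | ⟨a, ha, hah, hae, has⟩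
    · exact absurd (by omega) (hn i (by omega) hd)
    · exact ⟨a, by omega, hah, by omega, has⟩
  refine (while_rule (fun K υ => K ≤ d i ∧ RowState n l d s i (d i - K) υ) (d i) ?_
    (fun K σ' h => h.1) (fun K σ' _ => by simp) ?_).mono ?_
  · refine ⟨Nat.zero_le _, le_rfl, ?_, by simp, ?_, by simp, ⟨f, hf, hfh, hfe, by simpa using hfs⟩,
      ?_, fun j => ?_, hH, fun a ha hah z hz hza => ?_⟩
    · simpa using hτ9
    · simp [hvar, h13]
    · simp [hvar, h.best]
    · rw [if_neg (by omega)]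
      simp [harr, h.value]
    · rw [if_neg (by omega)]
      simp [harr, h.count a ha hah z hz hza]
  · rintro K υ ⟨hK, hR⟩ hb -
    simp only [Test.Holds, Expr.eval, hR.rest] at hb
    refine (cellStep_spec hS hi hb hR).mono ?_
    rintro k ω - ⟨rfl, hR'⟩
    exact ⟨by omega, by rwa [show d i - (K + 0 + 1) = d i - K - 1 by omega]⟩
  · rintro k υ - ⟨⟨hk, hR⟩, hb⟩
    simp only [Test.Holds, Expr.eval, hR.rest] at hb
    obtain rfl : k = d i := by omega
    rw [Nat.sub_self] at hR
    refine raise_spec.mono ?_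
    rintro k ω hs' ⟨rfl, h0⟩
    have harr' : ω.arr = υ.arr := funext fun a => hs'.2 a (by simp)
    refine ⟨by omega, ?_, fun j => ?_, ?_, fun a ha hah y hy hya => ?_⟩
    · rw [h0, hR.best, hR.current, if_neg (by omega), best, if_neg (by omega),
        val_succ_of_mem le_rfl (by omega), show l i + d i - 1 - l i = d i - 0 - 1 by omega]
    · rw [harr', hR.value, val, add_zero]
    · rw [harr']; exact hR.head
    · rw [harr', hR.count a ha hah y hy hya, rowCount_succ]
      congr 3
      simp only [eq_iff_iff]
      constructor <;> intro h' <;> refine ⟨?_, ?_, ?_⟩ <;> omega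

theorem DynState.succ_of_eq_zero {n i : ℕ} {l d s : ℕ → ℕ} {σ : State} (h : DynState n l d s i σ)
    (hd : d i = 0) : DynState n l d s (i + 1) σ := by
  refine ⟨?_, fun j => ?_, h.head.succ_of_eq_zero hd, fun a ha hah y hy hya => ?_⟩
  · rw [h.best, Staircase.best, if_pos hd]
  · rw [h.value, val, if_neg (by omega)]
  · rw [h.count a ha hah y hy hya, rowCount_succ, if_neg (by omega), add_zero]

theorem DynState.of_eq {n i : ℕ} {l d s : ℕ → ℕ} {σ τ : State} (h : DynState n l d s i σ)
    (h0 : τ.var 0 = σ.var 0) (h31 : τ.arr 31 = σ.arr 31) (h32 : τ.arr 32 = σ.arr 32)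
    (h33 : τ.arr 33 = σ.arr 33) : DynState n l d s i τ := by
  refine ⟨?_, ?_, ?_, ?_⟩
  · rw [h0]; exact h.best
  · rw [h31]; exact h.value
  · rw [h32]; exact h.head
  · rw [h33]; exact h.count

/-! ### The algorithm -/

variable {n : ℕ} {G : SimpleGraph (Fin n)} {adj : Fin n → List (Fin n)}

theorem ncard_neighborSet (hadj : IsAdjacencyLists G adj) (v : Fin n) :
    (G.neighborSet v).ncard = (adj v).length := by
  rw [← List.toFinset_card_of_nodup (hadj v).1, ← Set.ncard_coe_finset]
  congr 1
  ext w
  simp [(hadj v).2]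

theorem listStart_eq (hadj : IsAdjacencyLists G adj) :
    listStart adj n = 1 + n + 2 * G.edgeSet.ncard := by
  classical
  have hdeg : ∀ v, (adj v).length = G.degree v := by
    intro v
    rw [← ncard_neighborSet hadj, ← SimpleGraph.card_neighborFinset_eq_degree,
      SimpleGraph.neighborFinset, Set.ncard_eq_toFinset_card']
  have hm : G.edgeSet.ncard = G.edgeFinset.card := by
    rw [SimpleGraph.edgeFinset, Set.ncard_eq_toFinset_card']
  rw [listStart, Finset.sum_add_distrib, Finset.sum_range, hm,
    ← G.sum_degrees_eq_twice_card_edges]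
  simp only [listLen_coe, hdeg, Finset.sum_const, Finset.card_range, smul_eq_mul, mul_one]
  omega

theorem columnRank_le (col : Fin n → Bool) (pos : Fin n → ℕ) (w : Fin n) :
    columnRank col pos w ≤ n := by
  rw [columnRank]
  exact (Set.ncard_le_ncard (Set.subset_univ _)).trans (by simp [Set.ncard_univ])

theorem IsOrdered.exists_isLayout {Q : List (Fin n)} {σ : State} (h : IsOrdered G Q σ) :
    ∃ l d, IsLayout G (storedColor σ) (fun v => Q.idxOf v) l d := by
  have hidx : ∀ v, Q.idxOf v < Q.length := fun v => List.idxOf_lt_length_of_mem (h.mem v)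
  refine ⟨fun k => if hk : k < Q.length then
      sInf (columnRank (storedColor σ) (fun v => Q.idxOf v) '' G.neighborSet Q[k]) else 0,
    fun k => if hk : k < Q.length then if storedColor σ Q[k] = true then 0 else
      (G.neighborSet Q[k]).ncard else 0,
    h.coloring, fun x y hxy => (List.idxOf_inj (h.mem x)).1 hxy, h.strong, h.exists_adj,
    fun v hv => ?_, fun k hk => ?_, fun v hv hne => ?_⟩
  · simp only [dif_pos (hidx v), List.getElem_idxOf, hv, Bool.false_eq_true, if_false]
  · split_ifs with hkn hc
    · rfl
    · exact absurd (h.nodup.idxOf_getElem k hkn) (hk _ (by simpa using hc))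
    · rfl
  · simp only [dif_pos (hidx v), List.getElem_idxOf]
    exact ⟨Nat.sInf_mem (hne.image _), fun x hx => Nat.sInf_le hx⟩

theorem IsOrdered.length_eq {Q : List (Fin n)} {σ : State} {l d : ℕ → ℕ}
    (hadj : IsAdjacencyLists G adj) (h : IsOrdered G Q σ)
    (hL : IsLayout G (storedColor σ) (fun v => Q.idxOf v) l d) {i : ℕ} (hi : i < Q.length) :
    d i = if storedColor σ Q[i] = true then 0 else (adj Q[i]).length := by
  split_ifs with hc
  · refine hL.length_eq_zero i fun v hv hvi => ?_
    subst hvi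
    simp [List.getElem_idxOf, hv] at hc
  · have := hL.length Q[i] (by simpa using hc)
    rwa [h.nodup.idxOf_getElem, ncard_neighborSet hadj] at this

theorem IsOrdered.isBlockSystem {Q : List (Fin n)} {σ : State} {l d : ℕ → ℕ}
    (hadj : IsAdjacencyLists G adj) (h : IsOrdered G Q σ)
    (hL : IsLayout G (storedColor σ) (fun v => Q.idxOf v) l d) :
    IsBlockSystem (2 * listStart adj n) n l d
      fun i => if hi : i < Q.length then listStart adj Q[i] else 0 := by
  have hn := length_eq_of_nodup h.nodup h.mem
  have hd : ∀ i (hi : i < Q.length), d i ≤ (adj Q[i]).length := by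
    intro i hi
    rw [h.length_eq hadj hL hi]
    split_ifs <;> omega
  have hsn : n ≤ listStart adj n := by rw [listStart_eq hadj]; omega
  refine ⟨hL.isMono, fun a ha => ?_, fun a ha b hb y hy z hz hyz => ?_, ?_, fun a ha => ?_,
    fun a ha hpos => ?_⟩
  · rw [dif_pos (by omega)]
    exact listStart_pos _
  · rw [dif_pos (by omega), dif_pos (by omega)] at hyz
    have := eq_of_listStart_add_eq (hy.trans (hd a (by omega))) (hz.trans (hd b (by omega))) hyz
    exact h.nodup.getElem_inj_iff.1 this
  · have key : ∀ k ≤ n, ∑ a ∈ Finset.range k, d a ≤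
        ((Q.take k).map fun v => (adj v).length + 1).sum := by
      intro k
      induction k with
      | zero => simp
      | succ k ih =>
        intro hk
        have hkQ : k < Q.length := by omega
        have := hd k hkQ
        have := ih (by omega)
        rw [Finset.sum_range_succ, List.take_succ_eq_append_getElem hkQ, List.map_append,
          List.sum_append, List.map_singleton, List.sum_singleton]
        omega
    have h1 := key n le_rfl
    rw [List.take_of_length_le hn.le] at h1
    have h2 := sum_listLen_le (adj := adj) h.nodup
    omega
  · have haQ : a < Q.length := by omega
    have := hd a haQ
    have := listStart_add_le (adj := adj) Q[a]
    rw [dif_pos haQ]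
    omega
  · have haQ : a < Q.length := by omega
    have := hd a haQ
    have := listStart_add_le (adj := adj) Q[a]
    have hla : l a ≤ n := by
      obtain ⟨v, hv, rfl⟩ := hL.exists_row hpos
      have hne : (G.neighborSet v).Nonempty := by
        rw [hL.length v hv] at hpos
        exact Set.nonempty_of_ncard_ne_zero hpos.ne'
      obtain ⟨w, -, hw⟩ := (hL.left v hv hne).1
      rw [← hw]
      exact columnRank_le _ _ _
    omega

/-- Compute the least entry of array `30` at a neighbor of the vertex in variable `4`. -/
def firstColumn : Prog :=
  .seq (.assign 8 (.var 1))
    (.forBlock 0 4 (.ite (.lt (.arr 30 (.var 7)) (.var 8)) (.assign 8 (.arr 30 (.var 7))) .skip))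

theorem firstColumn_spec {V : ℕ} {σ : State} (hE : Env adj σ) (hV : listStart adj n ≤ V)
    {v : Fin n} (h4 : σ.var 4 = v) (hne : 0 < (adj v).length) {r : Fin n → ℕ}
    (hr : ∀ w ∈ adj v, σ.arr 30 w = r w) (hrn : ∀ w, r w ≤ n) :
    Tri V firstColumn σ fun k τ => k = (adj v).length ∧
      IsLeast (r '' {w | w ∈ adj v}) (τ.var 8) := by
  simp only [firstColumn, tri_seq, tri_assign, Expr.Ok, Expr.eval, hE.size, true_and]
  have hE' : Env adj (σ.setVar 8 n) := ⟨by simpa using hE.size, hE.start, hE.length, hE.nbr⟩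
  refine (forBlock_rule hE' hV v (by simpa using h4) (adj v) rfl (hE'.nbr v) (by simp) (by simp)
    (by simp) (fun t τ => τ.var 8 ≤ n ∧ (∀ w ∈ (adj v).take t, τ.var 8 ≤ r w) ∧
      (τ.var 8 = n ∨ ∃ w ∈ (adj v).take t, r w = τ.var 8)) ⟨by simp, by simp, by simp⟩
      ?_ ?_).mono ?_
  · rintro t τ y z hy ⟨h1, h2, h3⟩
    have : (τ.setVar y z).var 8 = τ.var 8 := by rcases hy with rfl | rfl | rfl <;> simp
    rw [this]
    exact ⟨h1, h2, h3⟩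
  · rintro t ht τ ⟨h1, h2, h3⟩ h7 hs
    have h30 : τ.arr 30 (adj v)[t] = r (adj v)[t] := by
      rw [hs.2 30 (by simp)]
      exact hr _ (List.getElem_mem ht)
    have htake := List.take_succ_eq_append_getElem ht
    simp only [tri_ite, tri_assign, tri_skip, Test.Ok, Test.Holds, Expr.Ok, Expr.eval, h7, h30,
      State.setVar_var, if_true, true_and, htake, List.mem_append, List.mem_singleton]
    refine ⟨fun hb => ⟨hrn _, fun w hw => ?_, Or.inr ⟨_, Or.inr rfl, rfl⟩⟩,
      fun hb => ⟨h1, fun w hw => ?_, h3.imp_right fun ⟨w, hw, hwr⟩ => ⟨w, Or.inl hw, hwr⟩⟩⟩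
    · rcases hw with hw | rfl
      · exact hb.le.trans (h2 w hw)
      · exact le_rfl
    · rcases hw with hw | rfl
      · exact h2 w hw
      · omega
  · rintro k τ - ⟨hk, -, h2, h3⟩
    rw [List.take_length] at h2 h3
    refine ⟨by omega, ?_, ?_⟩
    · rcases h3 with h3 | ⟨w, hw, hwr⟩
      · have h0 := h2 _ (List.getElem_mem hne)
        exact ⟨_, List.getElem_mem hne, by have := hrn (adj v)[0]; omega⟩
      · exact ⟨w, hw, hwr⟩
    rintro _ ⟨u, hu, rfl⟩
    exact h2 u hu

/-- The dynamic program, for the rows in the order of array `24`. -/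
def dynamicProgram : Prog :=
  .forLoop 3 1
    (.seq (.assign 4 (.arr 24 (.var 3)))
      (.seq (.assign 13 (.arr 0 (.arr 1 (.var 4))))
        (.ite (.and (.not (.eq (.arr 25 (.var 4)) (.const 1))) (.lt (.const 0) (.var 13)))
          (.seq firstColumn rowStep) .skip)))

theorem dynamicProgram_spec {σ : State} {Q : List (Fin n)} {l d : ℕ → ℕ}
    (hadj : IsAdjacencyLists G adj) (hE : Env adj σ)
    (hQ : IsOrdered G Q σ) (hL : IsLayout G (storedColor σ) (fun v => Q.idxOf v) l d)
    (hrank : ∀ w, storedColor σ w = true →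
      σ.arr 30 w = columnRank (storedColor σ) (fun v => Q.idxOf v) w)
    (h0 : σ.var 0 = 0) (h31 : ∀ i, σ.arr 31 i = 0) (h32 : ∀ i, σ.arr 32 i = 0)
    (h33 : ∀ i, σ.arr 33 i = 0) :
    Tri (2 * listStart adj n) dynamicProgram σ fun k τ =>
      k ≤ 2 * listStart adj n ∧ τ.var 0 = best l d n := by
  have hn := length_eq_of_nodup hQ.nodup hQ.mem
  have hS := hQ.isBlockSystem hadj hL
  set s : ℕ → ℕ := fun i => if hi : i < Q.length then listStart adj Q[i] else 0 with hs_def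
  have hnv : ∀ x, dynamicProgram.NoVar x ↔ x ≠ 0 ∧ x ≠ 3 ∧ x ≠ 4 ∧ x ≠ 5 ∧ x ≠ 6 ∧ x ≠ 7 ∧
      x ≠ 8 ∧ x ≠ 9 ∧ x ≠ 10 ∧ x ≠ 11 ∧ x ≠ 12 ∧ x ≠ 13 ∧ x ≠ 14 := by
    intro x
    simp only [dynamicProgram, firstColumn, rowStep, cellStep, addEnds, Prog.noVar_forLoop,
      Prog.noVar_forBlock, Prog.noVar_raise, Prog.NoVar]
    tauto
  have hna : ∀ a, dynamicProgram.NoArr a ↔ a ≠ 31 ∧ a ≠ 32 ∧ a ≠ 33 := by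
    intro x
    simp only [dynamicProgram, firstColumn, rowStep, cellStep, addEnds, Prog.noArr_forLoop,
      Prog.noArr_forBlock, Prog.noArr_raise, Prog.NoArr]
    tauto
  refine (for_rule (by decide) (by simp [firstColumn, rowStep, cellStep, addEnds])
    (by simp [firstColumn, rowStep, cellStep, addEnds]) hE.size (fun i K τ =>
    K ≤ 2 * ((Q.take i).map fun v => (adj v).length + 1).sum ∧ DynState n l d s i τ) ?_ ?_).mono ?_
  · refine ⟨by simp, by simpa [best] using h0, fun j => by simpa [val] using h31 j,
      fun j => Or.inl ⟨h32 j, by simp⟩, fun a _ _ y _ _ => by simpa [rowCount] using h33 _⟩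
  · rintro i hi K τ ⟨hK, hD⟩ h3 hs
    have hiQ : i < Q.length := by omega
    have hE' : Env adj τ := hE.of_same hs ((hnv 1).2 (by decide)) ((hna 0).2 (by decide))
      ((hna 1).2 (by decide))
    have h24 : τ.arr 24 i = Q[i] := by rw [hs.2 24 ((hna 24).2 (by decide))]; exact hQ.holds i hiQ
    have h25 : τ.arr 25 = σ.arr 25 := hs.2 25 ((hna 25).2 (by decide))
    have h30 : τ.arr 30 = σ.arr 30 := hs.2 30 ((hna 30).2 (by decide))
    have hdi := hQ.length_eq hadj hL hiQ
    rw [List.take_succ_eq_append_getElem hiQ, List.map_append, List.sum_append, List.map_singleton,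
      List.sum_singleton]
    simp only [tri_seq, tri_assign, tri_ite, tri_skip, Test.Ok, Test.Holds, Expr.Ok, Expr.eval, h3,
      h24, h25, State.setVar_var, State.setVar_arr, if_true, hE'.start, hE'.length, true_and,
      show ¬ (4 : ℕ) = 13 by decide, if_false, le_refl, zero_le]
    refine ⟨fun hb => ?_, fun hb => ⟨by omega, ?_⟩⟩
    · have hc : storedColor σ Q[i] = false := by simpa [storedColor] using hb.1
      rw [if_neg (by simp [hc])] at hdi
      have hE'' : Env adj ((τ.setVar 4 Q[i]).setVar 13 (adj Q[i]).length) :=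
        ⟨by simpa using hE'.size, hE'.start, hE'.length, hE'.nbr⟩
      refine (firstColumn_spec hE'' (by omega) (v := Q[i]) (by simp) hb.2
        (r := columnRank (storedColor σ) fun v => Q.idxOf v) (fun w hw => ?_)
        (columnRank_le _ _)).mono ?_
      · simp only [State.setVar_arr, h30]
        exact hrank w (hL.col_eq_true hc (((hadj _).2 w).1 hw))
      · rintro k υ hsυ ⟨hk, hleast⟩
        have hset : {w | w ∈ adj Q[i]} = G.neighborSet Q[i] := by
          ext w; simp [(hadj _).2]
        have hli : υ.var 8 = l i := by
          rw [hset] at hleast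
          have hne : (G.neighborSet Q[i]).Nonempty := by
            rw [← hset]; exact ⟨_, List.getElem_mem hb.2⟩
          have := hL.left Q[i] hc hne
          rw [hQ.nodup.idxOf_getElem] at this
          exact hleast.unique this
        refine (rowStep_spec hS hi (by omega) (hD.of_eq ?_ ?_ ?_ ?_) hli ?_ ?_).mono ?_
        · rw [hsυ.1 0 (by simp [firstColumn])]; simp
        · rw [hsυ.2 31 (by simp [firstColumn])]; rfl
        · rw [hsυ.2 32 (by simp [firstColumn])]; rfl
        · rw [hsυ.2 33 (by simp [firstColumn])]; rfl
        · rw [hsυ.1 13 (by simp [firstColumn]), hdi]; simp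
        · rw [hsυ.2 1 (by simp [firstColumn]), hsυ.1 4 (by simp [firstColumn])]
          simp [hE'.start, hs_def, hiQ]
        · rintro k' ω - ⟨hk', hD'⟩
          exact ⟨by omega, hD'.of_eq (by simp) rfl rfl rfl⟩
    · have hd0 : d i = 0 := by
        rw [hdi]
        split_ifs with hc
        · rfl
        · have hc' : σ.arr 25 Q[i] ≠ 1 := by simpa [storedColor] using hc
          by_contra hpos
          exact hb ⟨hc', by omega⟩
      exact (hD.succ_of_eq_zero hd0).of_eq (by simp) rfl rfl rfl
  · rintro k τ - ⟨hk, hD⟩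
    rw [List.take_of_length_le hn.le] at hk
    have := sum_listLen_le (adj := adj) hQ.nodup
    exact ⟨by omega, hD.best⟩

/-- The algorithm that computes the strong chromatic index; the result is in variable `0`. -/
def strongChromaticIndexProgram : Prog :=
  .seq orderVertices (.seq rankColumns dynamicProgram)

theorem strongChromaticIndexProgram_spec (hadj : IsAdjacencyLists G adj)
    (hG : IsPermutationGraph G) (hbip : G.IsBipartite) :
    Tri (2 * listStart adj n) strongChromaticIndexProgram
      (State.init (encodeAdjacencyLists adj)) fun k τ =>
        k ≤ 8 * n + 6 * listStart adj n ∧ τ.var 0 = strongChromaticIndex G := by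
  rw [strongChromaticIndexProgram, tri_seq]
  refine (orderVertices_spec hadj hG hbip (by omega)).mono ?_
  rintro k₁ σ₁ hs₁ ⟨hk₁, hE₁, Q, hQ⟩
  obtain ⟨l, d, hL⟩ := hQ.exists_isLayout
  rw [tri_seq]
  refine (rankColumns_spec hE₁ hQ).mono ?_
  rintro k₂ σ₂ hs₂ ⟨hk₂, hr⟩
  have h25 : σ₂.arr 25 = σ₁.arr 25 := hs₂.2 25 (by simp [rankColumns])
  have hcol : storedColor (n := n) σ₂ = storedColor σ₁ := by
    funext v; rw [storedColor, storedColor, h25]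
  have hQ₂ : IsOrdered G Q σ₂ := by
    obtain ⟨h1, h2, h3, h4, h5, h6⟩ := hQ
    rw [← hcol] at h4 h5 h6
    exact ⟨h1, h2, h3.of_eq (hs₂.2 24 (by simp [rankColumns])), h4, h5, h6⟩
  have hE₂ := hE₁.of_same hs₂ (by simp [rankColumns]) (by simp [rankColumns])
    (by simp [rankColumns])
  have hzero : ∀ a i, 31 ≤ a → σ₂.arr a i = 0 := by
    intro a i ha
    rw [hs₂.2 a (by simp [rankColumns]; omega), hs₁.2 a (by
      simp [orderVertices, setup, sortByDegree, sortLists, bfs, exhaustQueue, visitNeighbor,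
        reverseOrder]; omega)]
    simp [State.init, show a ≠ 0 by omega]
  have hv0 : σ₂.var 0 = 0 := by
    rw [hs₂.1 0 (by simp [rankColumns]), hs₁.1 0 (by
      simp [orderVertices, setup, sortByDegree, sortLists, bfs, exhaustQueue, visitNeighbor,
        reverseOrder])]
    simp [State.init]
  rw [← hcol] at hr hL
  refine (dynamicProgram_spec hadj hE₂ hQ₂ hL hr hv0 (fun i => hzero _ i (by decide))
    (fun i => hzero _ i (by decide)) fun i => hzero _ i (by decide)).mono ?_
  rintro k₃ σ₃ - ⟨hk₃, h0⟩
  refine ⟨by omega, ?_⟩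
  rw [h0, hL.strongChromaticIndex_eq_best fun v => ?_]
  exact (List.idxOf_lt_length_of_mem (hQ.mem v)).trans_eq (length_eq_of_nodup hQ.nodup hQ.mem)

/-- The input contains no number larger than the number of vertices. -/
theorem bounded_init (hadj : IsAdjacencyLists G adj) :
    (State.init (encodeAdjacencyLists adj)).Bounded n := by
  refine ⟨fun x => Nat.zero_le _, fun a i => ?_⟩
  simp only [State.init]
  split_ifs
  · by_cases hi : i < (encodeAdjacencyLists adj).length
    · rw [List.getD_eq_getElem _ _ hi]
      have hmem := List.getElem_mem hi
      generalize (encodeAdjacencyLists adj)[i] = x at hmem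
      simp only [encodeAdjacencyLists, List.mem_cons, List.mem_flatMap, List.mem_finRange,
        List.mem_map, true_and] at hmem
      rcases hmem with rfl | ⟨v, rfl | ⟨w, -, rfl⟩⟩
      · exact le_rfl
      · rw [← List.toFinset_card_of_nodup (hadj v).1]
        exact (Finset.card_le_univ _).trans (by simp)
      · exact w.2.le
    · rw [List.getD_eq_default _ _ (by omega)]
      exact Nat.zero_le _
  · exact Nat.zero_le _

end Ram

theorem mainTheorem4 :
    ∃ (p : Ram.Prog) (c : ℕ),
      ∀ (n : ℕ) (G : SimpleGraph (Fin n)) (adj : Fin n → List (Fin n)),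
        G.IsBipartite → IsPermutationGraph G → IsAdjacencyLists G adj →
          ∃ (t : ℕ) (τ : Ram.State),
            Ram.Exec (c * (n + G.edgeSet.ncard + 1)) p
              (Ram.State.init (encodeAdjacencyLists adj)) t τ ∧
            t ≤ c * (n + G.edgeSet.ncard + 1) ∧
            τ.var 0 = strongChromaticIndex G := by
  -- With `s = 1 + n + 2 m`, which is at most `2 (n + m + 1)`, sums are bounded by `2 s`, and there
  -- are at most `8 n + 6 s` loop iterations.
  refine ⟨Ram.strongChromaticIndexProgram, 4 + Ram.strongChromaticIndexProgram.weight * 14, ?_⟩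
  intro n G adj hbip hG hadj
  obtain ⟨k, τ, hrun, hk, h0⟩ := Ram.strongChromaticIndexProgram_spec hadj hG hbip
  obtain ⟨t, ht, hexec⟩ := hrun.exec
  have hS := Ram.listStart_eq hadj
  set m := G.edgeSet.ncard with hm
  have ht' : t ≤ Ram.strongChromaticIndexProgram.weight * 14 * (n + m + 1) := by
    refine ht.trans ?_
    rw [mul_assoc]
    exact Nat.mul_le_mul_left _ (by omega)
  have hW : 4 * (n + m + 1) + t ≤
      (4 + Ram.strongChromaticIndexProgram.weight * 14) * (n + m + 1) := by
    rw [add_mul]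
    omega
  exact ⟨t, τ, (hexec (4 * (n + m + 1)) _ (by omega) (by omega)
    ((Ram.bounded_init hadj).mono (by omega)) hW).1, by omega, h0⟩
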